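/- **Setting.** Let $d\in\{2,3\}$ and $k\ge 1$. Let $\Omega\subset\mathbb R^d$ be a polygonal/polyhedral domain partitioned into two non-overlapping domains $\Omega^s,\Omega^b$ (open and connected), with conforming simplicial triangulations $\mathcal T^s,\mathcal T^b$ that match at the interface $\Gamma_I=\partial\Omega^s\cap\partial\Omega^b$, and $\mathcal T=\mathcal T^s\cup\mathcal T^b$. They are shape regular with constant $\sigma$: every cell $K$ contains a ball of some radius $\rho>0$ with $h_K\le\sigma\rho$, where $h_K$ is the diameter of $K$. Put $\Gamma^j=\partial\Omega\cap\partial\Omega^j$ ($j=s,b$). Let $\Gamma^s=\Gamma^s_D\cup\Gamma^s_N$, $\Gamma^b=\Gamma^b_D\cup\Gamma^b_N$ and $\Gamma^b=\Gamma^b_P\cup\Gamma^b_F$ be partitions into unions of facets of the triangulations, with $|\Gamma^j_D|>0$, $|\Gamma^j_N|>0$ ($j=s,b$) and $|\Gamma^b_P|>0$. Let $n^j$ be the outward unit normal of a cell of $\mathcal T^j$, $n=n^s=-n^b$ on $\Gamma_I$, and $w^t=w-(w\cdot n)n$. Let $\mu^s,\mu^b,\lambda,\kappa,\gamma>0$,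 $0<\alpha<1$, $c_0\ge 0$, and let $\beta^s,\beta^b>0$ be penalty parameters. **Spaces.** With $\mathcal F^j$ the set of facets of $\mathcal T^j$ and $\Gamma_0^j$ their union, let $V_h$, $Q_h$ be the spaces of functions on $\Omega$ that are in $[P_k(K)]^d$, respectively $P_{k-1}(K)$, on each $K\in\mathcal T$; $V_h^b$, $Q_h^b$ the same on $\Omega^b$ with $\mathcal T^b$; $\bar V_h^j$ the functions on $\Gamma_0^j$ that are in $[P_k(F)]^d$ for each $F\in\mathcal F^j$ and vanish on $\Gamma_D^j$; $\bar Q_h^j$ the functions on $\Gamma_0^j$ that are in $P_k(F)$ for each $F\in\mathcal F^j$; and $\bar Q_h^{b0}=\{\bar q\in\bar Q_h^b:\bar q=0\text{ on }\Gamma_P^b\}$. Put $\boldsymbol V_h=V_h\times\bar V_h^s\times\bar V_h^b$, $\boldsymbol Q_h=Q_h\times\bar Q_h^s\times\bar Q_h^b$, $\boldsymbol Q_h^{b0}=Q_h^b\times\bar Q_h^{b0}$, $\boldsymbol X_h=\boldsymbol V_h\times\boldsymbol Q_h\times V_h^b\times\boldsymbol Q_h^{b0}$. **Forms.** Let $(\cdot,\cdot)_D$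 be the $L^2(D)$ inner product, $\langle\cdot,\cdot\rangle$ the surface $L^2$ inner product, $\langle\cdot,\cdot\rangle_{\partial\mathcal T^j}=\sum_{K\in\mathcal T^j}\langle\cdot,\cdot\rangle_{\partial K}$, $\varepsilon(u)=(\nabla u+\nabla u^T)/2$ (derivatives cellwise), and $$a_h^j(\boldsymbol u,\boldsymbol v)=(2\mu^j\varepsilon(u),\varepsilon(v))_{\Omega^j}+\sum_{K\in\mathcal T^j}\langle 2\beta^j\mu^jh_K^{-1}(u-\bar u^j),v-\bar v^j\rangle_{\partial K}-\langle2\mu^j\varepsilon(u)n^j,v-\bar v^j\rangle_{\partial\mathcal T^j}-\langle2\mu^j\varepsilon(v)n^j,u-\bar u^j\rangle_{\partial\mathcal T^j},$$ $$b_h^j(\boldsymbol q,\boldsymbol v)=-(q,\nabla\cdot v)_{\Omega^j}+\langle\bar q^j,(v-\bar v^j)\cdot n^j\rangle_{\partial\mathcal T^j},$$ $a_h=a_h^s+a_h^b$, $b_h=b_h^s+b_h^b$, $c_h((p,r),q)=(\lambda^{-1}(\alpha p-r),q)_{\Omega^b}$, $$a_h^I((\bar u^s,\bar u^b),(\bar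 v^s,\bar v^b))=\langle\gamma(\mu^s/\kappa)^{1/2}(\bar u^s-\bar u^b)^t,(\bar v^s-\bar v^b)^t\rangle_{\Gamma_I},\qquad b_h^I(\bar q,(\bar v^s,\bar v^b))=\langle\bar q,(\bar v^s-\bar v^b)\cdot n\rangle_{\Gamma_I}.$$ **Method.** Let $\Delta t>0$, $t^n=n\Delta t$ for $0\le n\le N$, $d_ty^{n+1}=(y^{n+1}-y^n)/\Delta t$, and let $f^{n}=f(t^n)\in L^2(\Omega)^d$, $g^{b,n}=g^b(t^n)\in L^2(\Omega^b)$ for $1\le n\le N$. Given the values in $\boldsymbol X_h$ at $t^n$, one step of the fully discrete method is: find $(\boldsymbol u_h^{n+1},\boldsymbol p_h^{n+1},z_h^{n+1},\boldsymbol p_h^{p,n+1})\in\boldsymbol X_h$, where $\boldsymbol u_h=(u_h,\bar u_h^s,\bar u_h^b)$, $\boldsymbol p_h=(p_h,\bar p_h^s,\bar p_h^b)$, $p_h^b=p_h|_{\Omega^b}$, $\boldsymbol p_h^p=(p_h^p,\bar p_h^p)$, such that for all $(\boldsymbol v_h,\boldsymbol q_h,w_h,\boldsymbol q_h^p)\in\boldsymbol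 X_h$ $$a_h(\boldsymbol u_h^{n+1},\boldsymbol v_h)+a_h^I((\bar u_h^{s,n+1},d_t\bar u_h^{b,n+1}),(\bar v_h^s,\bar v_h^b))+b_h(\boldsymbol p_h^{n+1},\boldsymbol v_h)+b_h^I(\bar p_h^{p,n+1},(\bar v_h^s,\bar v_h^b))=(f^{n+1},v_h)_\Omega,$$ $$b_h(\boldsymbol q_h,\boldsymbol u_h^{n+1})+c_h((p_h^{p,n+1},p_h^{b,n+1}),q_h^b)=0,$$ $$(c_0d_tp_h^{p,n+1},q_h^p)_{\Omega^b}+c_h((d_tp_h^{p,n+1},d_tp_h^{b,n+1}),\alpha q_h^p)-b_h^b(\boldsymbol q_h^p,(z_h^{n+1},0))-b_h^I(\bar q_h^p,(\bar u_h^{s,n+1},d_t\bar u_h^{b,n+1}))=(g^{b,n+1},q_h^p)_{\Omega^b},$$ $$(\kappa^{-1}z_h^{n+1},w_h)_{\Omega^b}+b_h^b(\boldsymbol p_h^{p,n+1},(w_h,0))=0.$$ **Lemma (existence and uniqueness).** There is $\beta_0>0$, depending only on $d$, $k$ and $\sigma$, such that whenever $\beta^s,\beta^b\ge\beta_0$,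 the following holds for all data as above: at every time step $0\le n<N$ and for all previous values in $\boldsymbol X_h$, the fully discrete system has exactly one solution in $\boldsymbol X_h$. Consequently, for every initial value in $\boldsymbol X_h$ there is exactly one sequence of values in $\boldsymbol X_h$ at $t^0,\dots,t^N$ that starts with it and solves the system at every step. -/

import Mathlib

open MeasureTheory

namespace StokesBiot

/-! ### Simplices and triangulations

A simplex is given by the finite set of its vertices; the closed simplex is the convex hull. -/

/-- Euclidean space `ℝ^d`. -/
abbrev E (d : ℕ) := EuclideanSpace ℝ (Fin d)

/-- The closed simplex with the vertex set `S`. -/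
def hull {d : ℕ} (S : Finset (E d)) : Set (E d) := convexHull ℝ (S : Set (E d))

/-- The facets of a `d`-simplex `K`: the sets of `d` of its `d + 1` vertices. -/
def facetsOf {d : ℕ} (K : Finset (E d)) : Finset (Finset (E d)) := K.powersetCard d

open scoped Classical in
/-- The outward unit normal of the simplex `K` on its facet `F`: the normalized component, orthogonal
to `F`, of a vector from the vertex of `K` opposite to `F` to a point (the barycentre) of `F`. -/
noncomputable def outwardNormal {d : ℕ} (K F : Finset (E d)) : E d :=
  let w : E d := (vectorSpan ℝ (F : Set (E d)))ᗮ.starProjection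
    ((d : ℝ)⁻¹ • (∑ x ∈ F, x) - ∑ x ∈ K \ F, x)
  ‖w‖⁻¹ • w

/-- The diameter `h_K`. -/
noncomputable def diam {d : ℕ} (K : Finset (E d)) : ℝ := Metric.diam (hull K)

/-- A finite conforming simplicial triangulation: two cells meet in a common face or not at all. -/
structure Triangulation (d : ℕ) where
  cells : Finset (Finset (E d))
  card_cell : ∀ K ∈ cells, K.card = d + 1
  indep : ∀ K ∈ cells, AffineIndependent ℝ ((↑) : K → E d)
  conforming : ∀ K ∈ cells, ∀ L ∈ cells,
    hull K ∩ hull L ⊆ convexHull ℝ ((K : Set (E d)) ∩ (L : Set (E d)))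

/-- The open set that is triangulated: the interior of the union of the closed cells. -/
def Triangulation.domain {d : ℕ} (T : Triangulation d) : Set (E d) :=
  interior (⋃ K ∈ T.cells, hull K)

open scoped Classical in
/-- The set of all facets of a triangulation. -/
noncomputable def Triangulation.facets {d : ℕ} (T : Triangulation d) : Finset (Finset (E d)) :=
  T.cells.biUnion facetsOf

/-- Shape regularity with constant `σ`: each cell contains a ball of radius `ρ` with
`h_K ≤ σ ρ`. -/
def Triangulation.ShapeRegular {d : ℕ} (T : Triangulation d) (σ : ℝ) : Prop :=
  ∀ K ∈ T.cells, ∃ c : E d, ∃ ρ : ℝ, 0 < ρ ∧ Metric.closedBall c ρ ⊆ hull K ∧ diam K ≤ σ * ρ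

open scoped Classical in
/-- The facets of the triangulation `T` that lie on `∂Ω`. -/
noncomputable def Triangulation.facetsOn {d : ℕ} (T : Triangulation d) (Ω : Set (E d)) :
    Finset (Finset (E d)) :=
  T.facets.filter fun F => hull F ⊆ frontier Ω ∩ frontier T.domain

/-- The domain `Ω`, the interior of the union of the closures of two triangulated domains. -/
def unionDomain {d : ℕ} (Ts Tb : Triangulation d) : Set (E d) :=
  interior ((⋃ K ∈ Ts.cells, hull K) ∪ ⋃ K ∈ Tb.cells, hull K)

open scoped Classical in
/-- The geometric data: matching triangulations `Ts`, `Tb` of the non-overlapping domains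
`Ω^s`, `Ω^b`, and the partitions of `Γ^s = ∂Ω ∩ ∂Ω^s` and `Γ^b = ∂Ω ∩ ∂Ω^b`. Each part of the boundary
is a union of facets and is given by the set of these facets; it has positive surface measure iff that
set is nonempty. -/
structure Mesh (d : ℕ) where
  Ts : Triangulation d
  Tb : Triangulation d
  nonoverlapping : Disjoint Ts.cells Tb.cells
  matching : ∀ K ∈ Ts.cells, ∀ L ∈ Tb.cells,
    hull K ∩ hull L ⊆ convexHull ℝ ((K : Set (E d)) ∩ (L : Set (E d)))
  connected_s : IsConnected Ts.domain
  connected_b : IsConnected Tb.domain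
  /-- `Γ^s = Γ^s_D ∪ Γ^s_N` (velocity and traction conditions for the fluid) -/
  FDs : Finset (Finset (E d))
  FNs : Finset (Finset (E d))
  disjoint_s : Disjoint FDs FNs
  cover_s : FDs ∪ FNs = Ts.facetsOn (unionDomain Ts Tb)
  FDs_nonempty : FDs.Nonempty
  FNs_nonempty : FNs.Nonempty
  /-- `Γ^b = Γ^b_D ∪ Γ^b_N` (displacement and traction conditions for the solid) -/
  FDb : Finset (Finset (E d))
  FNb : Finset (Finset (E d))
  disjoint_b : Disjoint FDb FNb
  cover_b : FDb ∪ FNb = Tb.facetsOn (unionDomain Ts Tb)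
  FDb_nonempty : FDb.Nonempty
  FNb_nonempty : FNb.Nonempty
  /-- `Γ^b = Γ^b_P ∪ Γ^b_F` (pore pressure and flux conditions) -/
  FPb : Finset (Finset (E d))
  FFb : Finset (Finset (E d))
  disjoint_p : Disjoint FPb FFb
  cover_p : FPb ∪ FFb = Tb.facetsOn (unionDomain Ts Tb)
  FPb_nonempty : FPb.Nonempty

open scoped Classical in
/-- The set of all cells, of `Ts` and of `Tb`. -/
noncomputable def Mesh.cells {d : ℕ} (M : Mesh d) : Finset (Finset (E d)) :=
  M.Ts.cells ∪ M.Tb.cells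

/-! ### Approximation spaces

A piecewise polynomial function on cells is the family of its polynomials on the cells, and a piecewise
polynomial function on facets is the family of its values on the facets. The families are indexed by all
vertex sets and vanish at those that are not a cell, respectively a facet, of the triangulation. -/

/-- Polynomials in `d` variables. -/
abbrev Poly (d : ℕ) := MvPolynomial (Fin d) ℝ

/-- Scalar functions given cell by cell. -/
abbrev CellFun (d : ℕ) := Finset (E d) → Poly d

/-- Vector functions given cell by cell, `v K i` being the component `i` on the cell `K`. -/
abbrev CellVec (d : ℕ) := Finset (E d) → Fin d → Poly d

/-- Scalar functions given facet by facet. -/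
abbrev FacetFun (d : ℕ) := Finset (E d) → E d → ℝ

/-- Vector functions given facet by facet, `v F i` being the component `i` on the facet `F`. -/
abbrev FacetVec (d : ℕ) := Finset (E d) → Fin d → E d → ℝ

/-- The value of a polynomial at a point. -/
noncomputable def ev {d : ℕ} (p : Poly d) (x : E d) : ℝ := MvPolynomial.eval (fun i => x i) p

/-- `P_k(F)`: restrictions to the closed facet `F` of the polynomials of total degree at most `k`. A
function on `F` is represented by its extension by zero to `ℝ^d`. -/
noncomputable def facetPoly {d : ℕ} (k : ℕ) (F : Finset (E d)) : Submodule ℝ (E d → ℝ) where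
  carrier := {q | ∃ p : Poly d, p.totalDegree ≤ k ∧ q = (hull F).indicator (ev p)}
  zero_mem' := ⟨0, by simp, by
    funext x
    by_cases hx : x ∈ hull F <;> simp [hx, ev]⟩
  add_mem' := by
    rintro _ _ ⟨p, hp, rfl⟩ ⟨r, hr, rfl⟩
    refine ⟨p + r, (MvPolynomial.totalDegree_add p r).trans (max_le hp hr), ?_⟩
    funext x
    by_cases hx : x ∈ hull F <;> simp [hx, ev]
  smul_mem' := by
    rintro c _ ⟨p, hp, rfl⟩
    refine ⟨c • p, (MvPolynomial.totalDegree_smul_le c p).trans hp, ?_⟩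
    funext x
    by_cases hx : x ∈ hull F <;> simp [hx, ev, MvPolynomial.smul_eval]

open scoped Classical in
/-- Scalar functions that are in `P_m(K)` on each of the given cells. -/
noncomputable def cellSpace {d : ℕ} (cells : Finset (Finset (E d))) (m : ℕ) :
    Submodule ℝ (CellFun d) :=
  Submodule.pi Set.univ fun K =>
    if K ∈ cells then MvPolynomial.restrictTotalDegree (Fin d) ℝ m else ⊥

open scoped Classical in
/-- Vector functions that are in `P_m(K)^d` on each of the given cells. -/
noncomputable def cellVecSpace {d : ℕ} (cells : Finset (Finset (E d))) (m : ℕ) :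
    Submodule ℝ (CellVec d) :=
  Submodule.pi Set.univ fun K => Submodule.pi Set.univ fun _ =>
    if K ∈ cells then MvPolynomial.restrictTotalDegree (Fin d) ℝ m else ⊥

open scoped Classical in
/-- Scalar functions that are in `P_k(F)` on each facet `F` of `T`, and zero on the facets in `Z`. -/
noncomputable def facetSpace {d : ℕ} (T : Triangulation d) (k : ℕ) (Z : Finset (Finset (E d))) :
    Submodule ℝ (FacetFun d) :=
  Submodule.pi Set.univ fun F => if F ∈ T.facets \ Z then facetPoly k F else ⊥

open scoped Classical in
/-- Vector functions that are in `P_k(F)^d` on each facet `F` of `T`, and zero on the facets in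
`Z`. -/
noncomputable def facetVecSpace {d : ℕ} (T : Triangulation d) (k : ℕ) (Z : Finset (Finset (E d))) :
    Submodule ℝ (FacetVec d) :=
  Submodule.pi Set.univ fun F => Submodule.pi Set.univ fun _ =>
    if F ∈ T.facets \ Z then facetPoly k F else ⊥

/-- Triples `(v, v̄^s, v̄^b)`. -/
abbrev VTuple (d : ℕ) := CellVec d × FacetVec d × FacetVec d

/-- Triples `(q, q̄^s, q̄^b)`. -/
abbrev QTuple (d : ℕ) := CellFun d × FacetFun d × FacetFun d

/-- Tuples `((v, v̄^s, v̄^b), (q, q̄^s, q̄^b), w, (q^p, q̄^p))`. -/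
abbrev XTuple (d : ℕ) := VTuple d × QTuple d × CellVec d × (CellFun d × FacetFun d)

/-- `V_h × V̄_h^s × V̄_h^b`. -/
noncomputable def Mesh.Vh {d : ℕ} (M : Mesh d) (k : ℕ) : Submodule ℝ (VTuple d) :=
  (cellVecSpace M.cells k).prod ((facetVecSpace M.Ts k M.FDs).prod (facetVecSpace M.Tb k M.FDb))

/-- `Q_h × Q̄_h^s × Q̄_h^b`. -/
noncomputable def Mesh.Qh {d : ℕ} (M : Mesh d) (k : ℕ) : Submodule ℝ (QTuple d) :=
  (cellSpace M.cells (k - 1)).prod ((facetSpace M.Ts k ∅).prod (facetSpace M.Tb k ∅))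

/-- `V_h^b`. -/
noncomputable def Mesh.Wh {d : ℕ} (M : Mesh d) (k : ℕ) : Submodule ℝ (CellVec d) :=
  cellVecSpace M.Tb.cells k

/-- `Q_h^b × Q̄_h^{b0}`. -/
noncomputable def Mesh.Qhb0 {d : ℕ} (M : Mesh d) (k : ℕ) :
    Submodule ℝ (CellFun d × FacetFun d) :=
  (cellSpace M.Tb.cells (k - 1)).prod (facetSpace M.Tb k M.FPb)

/-- The space `X_h`. -/
noncomputable def Mesh.Xh {d : ℕ} (M : Mesh d) (k : ℕ) : Submodule ℝ (XTuple d) :=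
  (M.Vh k).prod ((M.Qh k).prod ((M.Wh k).prod (M.Qhb0 k)))

/-! ### Forms -/

/-- The integral over the closed cell `K`. -/
noncomputable def cellInt {d : ℕ} (K : Finset (E d)) (φ : E d → ℝ) : ℝ :=
  ∫ x in hull K, φ x

/-- The integral over the facet `F` with respect to `(d-1)`-dimensional surface measure. -/
noncomputable def facetInt {d : ℕ} (F : Finset (E d)) (φ : E d → ℝ) : ℝ :=
  ∫ x in hull F, φ x ∂(Measure.euclideanHausdorffMeasure (d - 1))

/-- The integral over `∂K` of the function that is `φ F` on the facet `F`. -/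
noncomputable def bdryInt {d : ℕ} (K : Finset (E d)) (φ : Finset (E d) → E d → ℝ) : ℝ :=
  ∑ F ∈ facetsOf K, facetInt F (φ F)

/-- `ε(v) = (∇v + (∇v)ᵀ)/2`. -/
noncomputable def strain {d : ℕ} (v : Fin d → Poly d) (x : E d) : Matrix (Fin d) (Fin d) ℝ :=
  fun i j => (ev (MvPolynomial.pderiv j (v i)) x + ev (MvPolynomial.pderiv i (v j)) x) / 2

/-- `∇ ⬝ v`. -/
noncomputable def divergence {d : ℕ} (v : Fin d → Poly d) (x : E d) : ℝ :=
  ∑ i, ev (MvPolynomial.pderiv i (v i)) x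

/-- The trace of `v - v̄` on the facet `F` of the cell `K`. -/
noncomputable def jump {d : ℕ} (v : CellVec d) (vbar : FacetVec d) (K F : Finset (E d)) (x : E d) :
    Fin d → ℝ :=
  fun i => ev (v K i) x - vbar F i x

/-- `ε(v)n` on the facet `F` of the cell `K`. -/
noncomputable def strainNormal {d : ℕ} (v : CellVec d) (K F : Finset (E d)) (x : E d) : Fin d → ℝ :=
  fun i => ∑ j, strain (v K) x i j * outwardNormal K F j

/-- The form `a_h^j`, with viscosity `μ` and penalty parameter `β`. -/
noncomputable def aj {d : ℕ} (T : Triangulation d) (μ β : ℝ) (u : CellVec d) (ubar : FacetVec d)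
    (v : CellVec d) (vbar : FacetVec d) : ℝ :=
  ∑ K ∈ T.cells,
    (cellInt K (fun x => 2 * μ * ∑ i, ∑ j, strain (u K) x i j * strain (v K) x i j)
      + bdryInt K (fun F x => 2 * β * μ * (diam K)⁻¹ * (jump u ubar K F x ⬝ᵥ jump v vbar K F x))
      - bdryInt K (fun F x => 2 * μ * (strainNormal u K F x ⬝ᵥ jump v vbar K F x))
      - bdryInt K (fun F x => 2 * μ * (strainNormal v K F x ⬝ᵥ jump u ubar K F x)))

/-- The form `b_h^j`. -/
noncomputable def bj {d : ℕ} (T : Triangulation d) (q : CellFun d) (qbar : FacetFun d)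
    (v : CellVec d) (vbar : FacetVec d) : ℝ :=
  ∑ K ∈ T.cells,
    (-(cellInt K (fun x => ev (q K) x * divergence (v K) x))
      + bdryInt K (fun F x => qbar F x * (jump v vbar K F x ⬝ᵥ fun i => outwardNormal K F i)))

/-- The `L²` inner product `(p, q)` over the given cells. -/
noncomputable def l2 {d : ℕ} (cells : Finset (Finset (E d))) (p q : CellFun d) : ℝ :=
  ∑ K ∈ cells, cellInt K (fun x => ev (p K) x * ev (q K) x)

/-- The `L²` inner product of vector functions over the given cells. -/
noncomputable def l2Vec {d : ℕ} (cells : Finset (Finset (E d))) (w z : CellVec d) : ℝ :=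
  ∑ K ∈ cells, cellInt K (fun x => ∑ i, ev (w K i) x * ev (z K i) x)

/-- The tangential part `w^t = w - (w ⬝ n) n`. -/
def tangential {d : ℕ} (n w : Fin d → ℝ) : Fin d → ℝ := w - (w ⬝ᵥ n) • n

open scoped Classical in
/-- The integral over `Γ_I`. On an interface facet `F` (a facet of both triangulations), which belongs to
exactly one cell `K` of `Ω^s`, the integrand `φ n F` is taken with the normal `n = n^s` of `K`. -/
noncomputable def Mesh.interfaceInt {d : ℕ} (M : Mesh d)
    (φ : (Fin d → ℝ) → Finset (E d) → E d → ℝ) : ℝ :=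
  ∑ K ∈ M.Ts.cells, ∑ F ∈ facetsOf K with F ∈ M.Tb.facets,
    facetInt F (φ (fun i => outwardNormal K F i) F)

/-- The physical parameters. -/
structure Params where
  μs : ℝ
  μb : ℝ
  lam : ℝ
  α : ℝ
  c₀ : ℝ
  κ : ℝ
  γ : ℝ
  μs_pos : 0 < μs
  μb_pos : 0 < μb
  lam_pos : 0 < lam
  α_pos : 0 < α
  α_lt_one : α < 1
  c₀_nonneg : 0 ≤ c₀
  κ_pos : 0 < κ
  γ_pos : 0 < γ

/-- The form `a_h`. -/
noncomputable def Mesh.ah {d : ℕ} (M : Mesh d) (P : Params) (βs βb : ℝ) (u v : VTuple d) : ℝ :=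
  aj M.Ts P.μs βs u.1 u.2.1 v.1 v.2.1 + aj M.Tb P.μb βb u.1 u.2.2 v.1 v.2.2

/-- The form `b_h`. -/
noncomputable def Mesh.bh {d : ℕ} (M : Mesh d) (q : QTuple d) (v : VTuple d) : ℝ :=
  bj M.Ts q.1 q.2.1 v.1 v.2.1 + bj M.Tb q.1 q.2.2 v.1 v.2.2

/-- The form `c_h((p, r), q)`. -/
noncomputable def Mesh.ch {d : ℕ} (M : Mesh d) (P : Params) (p r q : CellFun d) : ℝ :=
  l2 M.Tb.cells (P.lam⁻¹ • (P.α • p - r)) q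

/-- The form `a_h^I((ū^s, ū^b), (v̄^s, v̄^b))`. -/
noncomputable def Mesh.aI {d : ℕ} (M : Mesh d) (P : Params) (us ub vs vb : FacetVec d) : ℝ :=
  M.interfaceInt fun n F x => P.γ * Real.sqrt (P.μs / P.κ) *
    (tangential n (fun i => us F i x - ub F i x) ⬝ᵥ tangential n (fun i => vs F i x - vb F i x))

/-- The form `b_h^I(q̄, (v̄^s, v̄^b))`. -/
noncomputable def Mesh.bI {d : ℕ} (M : Mesh d) (q : FacetFun d) (vs vb : FacetVec d) : ℝ :=
  M.interfaceInt fun n F x => q F x * ((fun i => vs F i x - vb F i x) ⬝ᵥ n)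

/-! ### The fully discrete method -/

/-- The backward difference `(y - y₀) / Δt`. -/
noncomputable def dt {X : Type*} [AddCommGroup X] [Module ℝ X] (Δt : ℝ) (y₀ y : X) : X :=
  Δt⁻¹ • (y - y₀)

/-- One step of the backward Euler HDG method, with body force `f` and source term `g` at the new
time level, previous values `x₀` and new values `x`. Here `x = (u, p, z, p^p)` with
`u = (u, ū^s, ū^b)`, `p = (p, p̄^s, p̄^b)` and `p^p = (p^p, p̄^p)`. -/
def Mesh.IsStep {d : ℕ} (M : Mesh d) (k : ℕ) (P : Params) (βs βb Δt : ℝ) (f : E d → E d)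
    (g : E d → ℝ) (x₀ x : XTuple d) : Prop :=
  match x₀, x with
  | (u₀, p₀, _, pp₀), (u, p, z, pp) =>
    (∀ v ∈ M.Vh k,
      M.ah P βs βb u v + M.aI P u.2.1 (dt Δt u₀.2.2 u.2.2) v.2.1 v.2.2
        + M.bh p v + M.bI pp.2 v.2.1 v.2.2
        = ∑ K ∈ M.cells, cellInt K (fun x => ∑ i, f x i * ev (v.1 K i) x)) ∧
    (∀ q ∈ M.Qh k, M.bh q u + M.ch P pp.1 p.1 q.1 = 0) ∧
    (∀ r ∈ M.Qhb0 k,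
      l2 M.Tb.cells (P.c₀ • dt Δt pp₀.1 pp.1) r.1
        + M.ch P (dt Δt pp₀.1 pp.1) (dt Δt p₀.1 p.1) (P.α • r.1)
        - bj M.Tb r.1 r.2 z 0 - M.bI r.2 u.2.1 (dt Δt u₀.2.2 u.2.2)
        = ∑ K ∈ M.Tb.cells, cellInt K (fun x => g x * ev (r.1 K) x)) ∧
    (∀ w ∈ M.Wh k,
      l2Vec M.Tb.cells (P.κ⁻¹ • z) w + bj M.Tb pp.1 pp.2 w 0 = 0)

end StokesBiot

namespace StokesBiot

/-! ### Geometry of a simplex -/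

/-! One time step is a square linear system on the finite-dimensional space `M.Xh k`: the four
equations together say that a linear map from `M.Xh k` to its dual takes a prescribed value.
Existence therefore follows from uniqueness, and uniqueness means that the homogeneous system has
only the zero solution (`Mesh.eq_zero_of_isStep`). Only injectivity is needed, so qualitative forms
of Korn's inequality and of the inf-sup condition suffice. The one quantitative ingredient is
coercivity of the viscous forms, which fixes the threshold for the penalty parameters.

With s = 1/Δt, test the homogeneous system with the solution itself, but with the displacement on
Ω^b replaced by the velocity s u, and with the Ω^b part of the second equation multiplied by s. All
b-terms and interface pressure terms cancel, and the sum of a^s(u,u), s a^b(u,u), the tangential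
slip term, (s/λ)‖αp^p - p‖², c₀ s‖p^p‖² and κ⁻¹‖z‖² is zero. Every term is nonnegative, hence zero.

Coercivity (`exists_coercive`) rests on a discrete trace inequality with a constant depending on d
and k only. It comes from writing a simplex as a cone over a facet (`IsSimplex.cellInt_eq_cone`) and
using a one-dimensional polynomial inequality on every ray, so no reference simplex is needed. Shape
regularity enters by bounding the heights of a cell from below by h_K/(|σ|+1).

Vanishing energy leaves a field with zero strain on each cell that agrees with its facet unknowns.
Two such fields on cells with a common facet coincide, a connected domain is connected through
facets (`Triangulation.eq_of_isConnected`), and the field vanishes on a Dirichlet facet; so u = 0.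
Also z = 0 and αp^p = p on Ω^b.

The pressures are handled by the local kernel of the divergence form
(`IsSimplex.eq_const_of_divergence_form_eq_zero`): on a cell only constants annihilate all test
fields. By connectedness each pressure is one constant on its subdomain. The pore pressure vanishes
by its condition on Γ_P, hence so does p on Ω^b, and with it the facet pressure there. On Ω^s the
constant is removed by testing with the normal on a facet of Γ_N. -/

/-- `K` is the vertex set of a nondegenerate `d`-simplex. -/
def IsSimplex {d : ℕ} (K : Finset (E d)) : Prop :=
  K.card = d + 1 ∧ AffineIndependent ℝ ((↑) : K → E d)

theorem Triangulation.isSimplex {d : ℕ} (T : Triangulation d) {K : Finset (E d)}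
    (hK : K ∈ T.cells) : IsSimplex K :=
  ⟨T.card_cell K hK, T.indep K hK⟩

/-- The vertices of a simplex as an affine basis. -/
noncomputable def IsSimplex.basis {d : ℕ} {K : Finset (E d)} (h : IsSimplex K) :
    AffineBasis K ℝ (E d) :=
  ⟨(↑), h.2, by
    rw [h.2.affineSpan_eq_top_iff_card_eq_finrank_add_one]
    simp [h.1]⟩

@[simp]
theorem IsSimplex.basis_apply {d : ℕ} {K : Finset (E d)} (h : IsSimplex K) (a : K) :
    h.basis a = a := rfl

open scoped Classical in
/-- The barycentric coordinate of the simplex `K` that belongs to the vertex `a`. -/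
noncomputable def coord {d : ℕ} (K : Finset (E d)) (a : E d) : E d →ᵃ[ℝ] ℝ :=
  if h : IsSimplex K ∧ a ∈ K then h.1.basis.coord ⟨a, h.2⟩ else 0

theorem IsSimplex.coord_eq {d : ℕ} {K : Finset (E d)} (h : IsSimplex K) (a : K) :
    coord K a = h.basis.coord a := by
  simp [coord, h, a.2]

theorem IsSimplex.coord_self {d : ℕ} {K : Finset (E d)} (h : IsSimplex K) {a : E d}
    (ha : a ∈ K) : coord K a a = 1 := by
  have := h.basis.coord_apply_eq ⟨a, ha⟩
  rwa [← h.coord_eq] at this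

theorem IsSimplex.coord_ne {d : ℕ} {K : Finset (E d)} (h : IsSimplex K) {a b : E d}
    (ha : a ∈ K) (hb : b ∈ K) (hab : a ≠ b) : coord K a b = 0 := by
  have := h.basis.coord_apply_ne (i := ⟨a, ha⟩) (j := ⟨b, hb⟩) (by simpa using hab)
  rwa [← h.coord_eq] at this

theorem IsSimplex.sum_coord {d : ℕ} {K : Finset (E d)} (h : IsSimplex K) (x : E d) :
    ∑ a ∈ K, coord K a x = 1 := by
  rw [← Finset.sum_coe_sort, ← h.basis.sum_coord_apply_eq_one x]
  simp [h.coord_eq]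

theorem IsSimplex.sum_coord_smul {d : ℕ} {K : Finset (E d)} (h : IsSimplex K) (x : E d) :
    ∑ a ∈ K, coord K a x • a = x := by
  conv_rhs => rw [← h.basis.linear_combination_coord_eq_self x]
  rw [← Finset.sum_coe_sort]
  simp [h.coord_eq]

theorem continuous_coord {d : ℕ} (K : Finset (E d)) (a : E d) : Continuous (coord K a) :=
  (coord K a).continuous_of_finiteDimensional

theorem affine_sum_smul {d : ℕ} (φ : E d →ᵃ[ℝ] ℝ) {s : Finset (E d)} {w : E d → ℝ}
    (hw : ∑ y ∈ s, w y = 1) : φ (∑ y ∈ s, w y • y) = ∑ y ∈ s, w y * φ y := by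
  have hφ : ∀ y, φ y = φ.linear y + φ 0 := fun y => by simpa using φ.map_vadd 0 y
  have : φ 0 = ∑ y ∈ s, w y * φ 0 := by rw [← Finset.sum_mul, hw, one_mul]
  rw [hφ, map_sum, this, ← Finset.sum_add_distrib]
  refine Finset.sum_congr rfl fun y _ => ?_
  rw [hφ y, map_smul, smul_eq_mul, mul_add]

/-- An affine function takes a value that is the combination, with the barycentric coordinates as
weights, of the values at the vertices. -/
theorem IsSimplex.affine_eq {d : ℕ} {K : Finset (E d)} (h : IsSimplex K) (φ : E d →ᵃ[ℝ] ℝ)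
    (x : E d) : φ x = ∑ a ∈ K, coord K a x * φ a := by
  conv_lhs => rw [← h.sum_coord_smul x]
  exact affine_sum_smul φ (h.sum_coord x)

/-- The weights of a convex combination of vertices in `S`, extended by zero to `K`, are its
barycentric coordinates. This describes a cell and its faces by signs and zeros of the same affine
functions. -/
theorem IsSimplex.mem_hull_subset {d : ℕ} {K S : Finset (E d)} (h : IsSimplex K) (hS : S ⊆ K)
    {x : E d} : x ∈ hull S ↔ (∀ a ∈ K, 0 ≤ coord K a x) ∧ ∀ a ∈ K, a ∉ S → coord K a x = 0 := by
  constructor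
  · intro hx
    rw [hull, Finset.mem_convexHull'] at hx
    obtain ⟨w, hw0, hw1, rfl⟩ := hx
    have key : ∀ a ∈ K, coord K a (∑ y ∈ S, w y • y) = ∑ y ∈ S, w y * coord K a y :=
      fun a _ => affine_sum_smul _ hw1
    refine ⟨fun a ha => ?_, fun a ha haS => ?_⟩
    · rw [key a ha]
      refine Finset.sum_nonneg fun y hy => mul_nonneg (hw0 y hy) ?_
      by_cases hay : a = y
      · rw [← hay, h.coord_self ha]; exact zero_le_one
      · rw [h.coord_ne ha (hS hy) hay]
    · rw [key a ha]
      refine Finset.sum_eq_zero fun y hy => ?_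
      rw [h.coord_ne ha (hS hy) (by rintro rfl; exact haS hy), mul_zero]
  · rintro ⟨h0, h1⟩
    rw [hull, Finset.mem_convexHull']
    refine ⟨fun a => coord K a x, fun a ha => h0 a (hS ha), ?_, ?_⟩
    · rw [← h.sum_coord x]
      exact Finset.sum_subset hS fun a ha haS => h1 a ha haS
    · conv_rhs => rw [← h.sum_coord_smul x]
      exact Finset.sum_subset hS fun a ha haS => by
        simp only [h1 a ha haS, zero_smul]

theorem IsSimplex.mem_hull {d : ℕ} {K : Finset (E d)} (h : IsSimplex K) {x : E d} :
    x ∈ hull K ↔ ∀ a ∈ K, 0 ≤ coord K a x := by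
  rw [h.mem_hull_subset subset_rfl]
  exact ⟨fun h => h.1, fun h => ⟨h, fun a ha hn => absurd ha hn⟩⟩

theorem IsSimplex.interior_hull {d : ℕ} {K : Finset (E d)} (h : IsSimplex K) :
    interior (hull K) = {x | ∀ a ∈ K, 0 < coord K a x} := by
  have := h.basis.interior_convexHull
  have hr : Set.range h.basis = (K : Set (E d)) := by ext; simp
  rw [hr] at this
  rw [hull, this]
  ext x
  simp only [Set.mem_ofPred_eq, ← h.coord_eq, Subtype.forall]

theorem IsSimplex.interior_nonempty {d : ℕ} {K : Finset (E d)} (h : IsSimplex K) :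
    (interior (hull K)).Nonempty := by
  have hr : Set.range h.basis = (K : Set (E d)) := by ext; simp
  have := h.basis.centroid_mem_interior_convexHull
  rw [hr] at this
  exact ⟨_, this⟩

theorem isCompact_hull {d : ℕ} (S : Finset (E d)) : IsCompact (hull S) :=
  S.finite_toSet.isCompact_convexHull ℝ

theorem convex_hull {d : ℕ} (S : Finset (E d)) : Convex ℝ (hull S) := convex_convexHull ℝ _

theorem subset_hull {d : ℕ} {S : Finset (E d)} {a : E d} (ha : a ∈ S) : a ∈ hull S :=
  subset_convexHull ℝ _ ha

theorem hull_mono {d : ℕ} {S T : Finset (E d)} (h : S ⊆ T) : hull S ⊆ hull T :=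
  convexHull_mono (by simpa using h)

/-- The barycentre of a set of vertices. -/
noncomputable def centre {d : ℕ} (S : Finset (E d)) : E d := ∑ x ∈ S, (S.card : ℝ)⁻¹ • x

theorem centre_mem_hull {d : ℕ} {S : Finset (E d)} (hS : S.Nonempty) : centre S ∈ hull S := by
  have hc : (S.card : ℝ) ≠ 0 := by simpa using hS.ne_empty
  refine (convex_hull S).sum_mem (fun _ _ => by positivity) ?_ fun x hx => subset_hull hx
  rw [Finset.sum_const, nsmul_eq_mul, mul_inv_cancel₀ hc]

theorem IsSimplex.coord_centre_pos {d : ℕ} {K S : Finset (E d)} (h : IsSimplex K) (hS : S ⊆ K)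
    {b : E d} (hb : b ∈ S) : 0 < coord K b (centre S) := by
  have hc : 0 < (S.card : ℝ)⁻¹ := by
    rw [inv_pos]; exact_mod_cast Finset.card_pos.2 ⟨b, hb⟩
  rw [centre, affine_sum_smul _ (by
    rw [Finset.sum_const, nsmul_eq_mul, mul_inv_cancel₀ (inv_pos.1 hc).ne'])]
  refine Finset.sum_pos' (fun x hx => mul_nonneg hc.le ?_) ⟨b, hb, ?_⟩
  · by_cases hbx : b = x
    · rw [← hbx, h.coord_self (hS hb)]; exact zero_le_one
    · rw [h.coord_ne (hS hb) (hS hx) hbx]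
  · rw [h.coord_self (hS hb)]; simpa using hc

/-- Carries almost-everywhere identities between continuous functions to the whole closed simplex,
and allows points near any point of the simplex to be chosen in its interior. -/
theorem IsSimplex.subset_closure_interior {d : ℕ} {K : Finset (E d)} (h : IsSimplex K) :
    hull K ⊆ closure (interior (hull K)) := by
  rw [(convex_hull K).closure_interior_eq_closure_of_nonempty_interior h.interior_nonempty]
  exact subset_closure

/-! ### Facets, heights and normals -/

open scoped Classical in
theorem mem_facetsOf {d : ℕ} {K F : Finset (E d)} (hK : K.card = d + 1) :
    F ∈ facetsOf K ↔ ∃ a ∈ K, F = K.erase a := by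
  rw [facetsOf, Finset.mem_powersetCard]
  constructor
  · rintro ⟨hF, hc⟩
    obtain ⟨a, ha⟩ : ∃ a, K \ F = {a} := by
      rw [← Finset.card_eq_one, Finset.card_sdiff_of_subset hF]; omega
    have haK : a ∈ K \ F := by rw [ha]; simp
    refine ⟨a, (Finset.mem_sdiff.1 haK).1, ?_⟩
    rw [← Finset.sdiff_singleton_eq_erase, ← ha, Finset.sdiff_sdiff_eq_self hF]
  · rintro ⟨a, ha, rfl⟩
    exact ⟨Finset.erase_subset _ _, by rw [Finset.card_erase_of_mem ha, hK]; rfl⟩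

open scoped Classical in
-- Indexing facets by the opposite vertex ties each boundary integral to a height and a barycentric
-- coordinate.
theorem sum_facetsOf {d : ℕ} {K : Finset (E d)} (hK : K.card = d + 1)
    {M : Type*} [AddCommMonoid M] (g : Finset (E d) → M) :
    ∑ F ∈ facetsOf K, g F = ∑ a ∈ K, g (K.erase a) := by
  symm
  refine Finset.sum_bij (fun a _ => K.erase a) ?_ ?_ ?_ ?_
  · intro a ha
    exact (mem_facetsOf hK).2 ⟨a, ha, rfl⟩
  · intro a ha b hb hab
    exact (Finset.erase_inj _ ha).1 hab
  · intro F hF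
    obtain ⟨a, ha, rfl⟩ := (mem_facetsOf hK).1 hF
    exact ⟨a, ha, rfl⟩
  · intros; rfl

open scoped Classical in
/-- The distance of the vertex of `K` opposite to the facet `F` from the hyperplane of `F`. -/
noncomputable def height {d : ℕ} (K F : Finset (E d)) : ℝ :=
  ‖(vectorSpan ℝ (F : Set (E d)))ᗮ.starProjection
    ((d : ℝ)⁻¹ • (∑ x ∈ F, x) - ∑ x ∈ K \ F, x)‖

open scoped Classical in
-- The vector from `a` to the barycentre of the facet differs from `b - a` by a vector parallel to
-- the facet. Both thus have the same component w orthogonal to the facet, and pairing with w/‖w‖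
-- leaves ‖w‖.
theorem IsSimplex.inner_vertex_normal {d : ℕ} (hd : 0 < d) {K : Finset (E d)} (h : IsSimplex K)
    {a b : E d} (ha : a ∈ K) (hb : b ∈ K.erase a) :
    inner ℝ (b - a) (outwardNormal K (K.erase a)) = height K (K.erase a) := by
  set F := K.erase a with hF
  have hKF : K \ F = {a} := by
    rw [hF, ← Finset.sdiff_singleton_eq_erase, Finset.sdiff_sdiff_eq_self (by simpa using ha)]
  have hcF : F.card = d := by rw [hF, Finset.card_erase_of_mem ha, h.1]; rfl
  have hd' : (d : ℝ) ≠ 0 := by positivity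
  set U := vectorSpan ℝ (F : Set (E d)) with hU
  set v : E d := (d : ℝ)⁻¹ • (∑ x ∈ F, x) - ∑ x ∈ K \ F, x with hv
  set w : E d := Uᗮ.starProjection v with hw
  have hwU : w ∈ Uᗮ := by rw [hw]; exact Submodule.starProjection_apply_mem _ _
  have hbv : b - a - v ∈ U := by
    have : b - a - v = (d : ℝ)⁻¹ • ∑ x ∈ F, (b - x) := by
      rw [hv, hKF, Finset.sum_singleton, Finset.sum_sub_distrib, Finset.sum_const, hcF, smul_sub,
        ← Nat.cast_smul_eq_nsmul ℝ, smul_smul, inv_mul_cancel₀ hd', one_smul]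
      abel
    rw [this]
    refine Submodule.smul_mem _ _ (Submodule.sum_mem _ fun x hx => ?_)
    exact vsub_mem_vectorSpan ℝ hb hx
  have h1 : inner ℝ (b - a) w = ‖w‖ ^ 2 := by
    have e : b - a = (b - a - v) + v := by abel
    rw [e, inner_add_left, Submodule.inner_right_of_mem_orthogonal hbv hwU, zero_add]
    have h3 : inner ℝ (v - w) w = 0 := by
      rw [real_inner_comm]
      exact Submodule.inner_right_of_mem_orthogonal hwU (by
        rw [hw]
        exact Submodule.sub_starProjection_mem_orthogonal _)
    have : v = (v - w) + w := by abel
    rw [this, inner_add_left, h3, zero_add, real_inner_self_eq_norm_sq]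
  change inner ℝ (b - a) (‖w‖⁻¹ • w) = ‖w‖
  rw [inner_smul_right, h1]
  by_cases h0 : ‖w‖ = 0
  · simp [h0]
  · field_simp

open scoped Classical in
/-- The barycentric coordinate in terms of the normal of the opposite facet. -/
theorem IsSimplex.inner_normal {d : ℕ} (hd : 0 < d) {K : Finset (E d)} (h : IsSimplex K)
    {a : E d} (ha : a ∈ K) (x : E d) :
    inner ℝ (x - a) (outwardNormal K (K.erase a)) =
      height K (K.erase a) * (1 - coord K a x) := by
  -- Writing `x - a` as a combination of edges at `a` reduces the claim to vertices: `a` contributes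
  -- zero and every other vertex contributes the height.
  have e : x - a = ∑ b ∈ K, coord K b x • (b - a) := by
    simp only [smul_sub]
    rw [Finset.sum_sub_distrib, h.sum_coord_smul, ← Finset.sum_smul, h.sum_coord, one_smul]
  rw [e, sum_inner, ← Finset.add_sum_erase _ _ ha]
  have : ∑ b ∈ K.erase a, inner ℝ (coord K b x • (b - a)) (outwardNormal K (K.erase a)) =
      ∑ b ∈ K.erase a, coord K b x * height K (K.erase a) := by
    refine Finset.sum_congr rfl fun b hb => ?_
    rw [real_inner_smul_left, h.inner_vertex_normal hd ha hb]
  rw [this, ← Finset.sum_mul, ← h.sum_coord x, ← Finset.add_sum_erase _ _ ha]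
  simp
  ring

open scoped Classical in
-- With height zero, the vector from `a` to the barycentre of the facet would be parallel to the
-- facet, hence killed by the linear part of `coord K a`. But that linear part sends it to -1, the
-- difference between the values on the facet and at `a`.
theorem IsSimplex.height_pos {d : ℕ} (hd : 0 < d) {K : Finset (E d)} (h : IsSimplex K)
    {a : E d} (ha : a ∈ K) : 0 < height K (K.erase a) := by
  refine lt_of_le_of_ne (norm_nonneg _) fun h0 => ?_
  have hw : (vectorSpan ℝ (K.erase a : Set (E d)))ᗮ.starProjection
      ((d : ℝ)⁻¹ • (∑ x ∈ K.erase a, x) - ∑ x ∈ K \ K.erase a, x) = 0 := norm_eq_zero.1 h0.symm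
  set U := vectorSpan ℝ (K.erase a : Set (E d)) with hU
  set v : E d := (d : ℝ)⁻¹ • (∑ x ∈ K.erase a, x) - ∑ x ∈ K \ K.erase a, x with hv
  have hvU : v ∈ U := by
    have := Submodule.sub_starProjection_mem_orthogonal (K := Uᗮ) v
    rw [hw, sub_zero, Submodule.orthogonal_orthogonal] at this
    exact this
  obtain ⟨b, hb⟩ : (K.erase a).Nonempty := by
    rw [← Finset.card_pos, Finset.card_erase_of_mem ha, h.1]; simpa
  have hlin : ∀ u ∈ U, (coord K a).linear u = 0 := by
    intro u hu
    have : U ≤ LinearMap.ker (coord K a).linear := by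
      rw [hU, vectorSpan, Submodule.span_le]
      rintro _ ⟨y, hy, z, hz, rfl⟩
      have hy' := Finset.mem_erase.1 (Finset.mem_coe.1 hy)
      have hz' := Finset.mem_erase.1 (Finset.mem_coe.1 hz)
      simp only [SetLike.mem_coe, LinearMap.mem_ker]
      rw [AffineMap.linearMap_vsub, h.coord_ne ha hy'.2 hy'.1.symm, h.coord_ne ha hz'.2 hz'.1.symm]
      simp
    exact this hu
  have hKF : K \ K.erase a = {a} := by
    rw [← Finset.sdiff_singleton_eq_erase, Finset.sdiff_sdiff_eq_self (by simpa using ha)]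
  have hd' : (d : ℝ) ≠ 0 := by positivity
  have hcF : (K.erase a).card = d := by rw [Finset.card_erase_of_mem ha, h.1]; rfl
  have hv2 : v = (d : ℝ)⁻¹ • ∑ x ∈ K.erase a, (x - a) := by
    rw [hv, hKF, Finset.sum_singleton, Finset.sum_sub_distrib, Finset.sum_const, hcF, smul_sub,
      ← Nat.cast_smul_eq_nsmul ℝ, smul_smul, inv_mul_cancel₀ hd', one_smul]
  have h1 := hlin v hvU
  rw [hv2, map_smul, map_sum] at h1
  have h2 : ∀ x ∈ K.erase a, (coord K a).linear (x - a) = -1 := by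
    intro x hx
    have hx' := Finset.mem_erase.1 hx
    have := AffineMap.linearMap_vsub (coord K a) x a
    rw [vsub_eq_sub] at this
    rw [this, h.coord_ne ha hx'.2 hx'.1.symm, h.coord_self ha]
    norm_num
  rw [Finset.sum_congr rfl h2, Finset.sum_const, hcF, nsmul_eq_mul] at h1
  simp at h1
  omega

theorem norm_outwardNormal {d : ℕ} {K F : Finset (E d)} (h : height K F ≠ 0) :
    ‖outwardNormal K F‖ = 1 := by
  rw [outwardNormal, norm_smul, norm_inv, norm_norm]
  exact inv_mul_cancel₀ h

theorem inner_eq_dotProduct {d : ℕ} (x y : E d) : inner ℝ x y = ∑ i, x i * y i := by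
  rw [PiLp.inner_apply]
  exact Finset.sum_congr rfl fun i _ => by simp [mul_comm]

/-! ### Integration over a simplex by slices parallel to a facet -/

open scoped Classical in
theorem IsSimplex.inner_facet {d : ℕ} (hd : 0 < d) {K : Finset (E d)} (h : IsSimplex K)
    {a : E d} (ha : a ∈ K) {y : E d} (hy : y ∈ hull (K.erase a)) :
    inner ℝ (y - a) (outwardNormal K (K.erase a)) = height K (K.erase a) := by
  rw [h.inner_normal hd ha,
    ((h.mem_hull_subset (Finset.erase_subset _ _)).1 hy).2 a ha (Finset.notMem_erase _ _)]
  ring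

theorem finrank_orthogonal_span {d : ℕ} {n : E d} (hn : ‖n‖ = 1) :
    Module.finrank ℝ (ℝ ∙ n)ᗮ = d - 1 := by
  have hn0 : n ≠ 0 := by rintro rfl; simp at hn
  have := Submodule.finrank_add_finrank_orthogonal (ℝ ∙ n)
  rw [finrank_span_singleton hn0, finrank_euclideanSpace_fin] at this
  omega

open scoped Classical in
theorem IsSimplex.facet_subset_range {d : ℕ} (hd : 0 < d) {K : Finset (E d)} (h : IsSimplex K)
    {a : E d} (ha : a ∈ K) {y : E d} (hy : y ∈ hull (K.erase a)) :
    y - (a + height K (K.erase a) • outwardNormal K (K.erase a)) ∈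
      (ℝ ∙ outwardNormal K (K.erase a))ᗮ := by
  have hn := norm_outwardNormal (h.height_pos hd ha).ne'
  rw [Submodule.mem_orthogonal_singleton_iff_inner_left, ← sub_sub, inner_sub_left,
    h.inner_facet hd ha hy, real_inner_smul_left, real_inner_self_eq_norm_sq, hn]
  ring

/-- A facet integral is an integral over the hyperplane orthogonal to the normal. -/
theorem setIntegral_hausdorff_eq {d : ℕ} {n : E d} (hn : ‖n‖ = 1) (p : E d) {s : Set (E d)}
    (hs : ∀ y ∈ s, y - p ∈ (ℝ ∙ n)ᗮ) (hsm : MeasurableSet s) (g : E d → ℝ) :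
    ∫ y in s, g y ∂(Measure.euclideanHausdorffMeasure (d - 1)) =
      ∫ w : (ℝ ∙ n)ᗮ in {w : (ℝ ∙ n)ᗮ | (w : E d) + p ∈ s}, g (w + p) := by
  have hι : Isometry (fun w : (ℝ ∙ n)ᗮ => (w : E d) + p) :=
    (isometry_add_right p).comp isometry_subtype_coe
  -- The Hausdorff measure is normalised to be Lebesgue measure in its own dimension, so the
  -- isometric parametrisation of the hyperplane introduces no factor.
  have hμ : (volume : Measure (ℝ ∙ n)ᗮ) = Measure.euclideanHausdorffMeasure (d - 1) := by
    rw [← finrank_orthogonal_span hn]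
    exact InnerProductSpace.euclideanHausdorffMeasure_eq_volume.symm
  have hr : s ⊆ Set.range (fun w : (ℝ ∙ n)ᗮ => (w : E d) + p) :=
    fun y hy => ⟨⟨y - p, hs y hy⟩, by simp⟩
  have hemb : MeasurableEmbedding (fun w : (ℝ ∙ n)ᗮ => (w : E d) + p) :=
    hι.isClosedEmbedding.measurableEmbedding
  have := hemb.setIntegral_map (μ := volume) g s
  rw [hμ, hι.map_euclideanHausdorffMeasure, Measure.restrict_restrict hsm,
    Set.inter_eq_left.2 hr] at this
  rw [this, ← hμ]
  rfl

open scoped Classical in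
theorem IsSimplex.facetInt_eq {d : ℕ} (hd : 0 < d) {K : Finset (E d)} (h : IsSimplex K)
    {a : E d} (ha : a ∈ K) (g : E d → ℝ) :
    facetInt (K.erase a) g =
      ∫ w : (ℝ ∙ outwardNormal K (K.erase a))ᗮ in
        {w : (ℝ ∙ outwardNormal K (K.erase a))ᗮ | (w : E d) +
          (a + height K (K.erase a) • outwardNormal K (K.erase a)) ∈ hull (K.erase a)},
        g (w + (a + height K (K.erase a) • outwardNormal K (K.erase a))) :=
  setIntegral_hausdorff_eq (norm_outwardNormal (h.height_pos hd ha).ne') _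
    (fun _ hy => h.facet_subset_range hd ha hy) (isCompact_hull _).measurableSet g

/-- Fubini's theorem for the lines parallel to a unit vector `n` and the orthogonal hyperplanes. -/
theorem integral_eq_integral_slices {d : ℕ} {n : E d} (hn : ‖n‖ = 1) (a : E d) {f : E d → ℝ}
    (hf : Integrable f) :
    ∫ x, f x = ∫ s : ℝ, ∫ w : (ℝ ∙ n)ᗮ, f (a + (s • n + w)) := by
  have h1 := (Submodule.measurePreserving_measurableEquivProd (ℝ ∙ n) a).symm
  have hv : (Measure.euclideanHausdorffMeasure (Module.finrank ℝ (E d)) : Measure (E d)) =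
      volume := InnerProductSpace.euclideanHausdorffMeasure_eq_volume
  rw [hv] at h1
  have h2 : MeasurePreserving (fun s : ℝ => LinearIsometryEquiv.toSpanUnitSingleton (𝕜 := ℝ) n hn s)
      volume volume := (LinearIsometryEquiv.toSpanUnitSingleton (𝕜 := ℝ) n hn).measurePreserving
  have hi : Integrable (fun q : (ℝ ∙ n) × (ℝ ∙ n)ᗮ =>
      f (((ℝ ∙ n).measurableEquivProd a).symm q)) :=
    (h1.integrable_comp_emb (MeasurableEquiv.measurableEmbedding _)).2 hf
  rw [← h1.integral_comp (MeasurableEquiv.measurableEmbedding _), Measure.volume_eq_prod,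
    integral_prod _ hi, ← h2.integral_comp
      (LinearIsometryEquiv.toSpanUnitSingleton (𝕜 := ℝ) n hn).toHomeomorph.measurableEmbedding]
  refine integral_congr_ae (Filter.Eventually.of_forall fun s => ?_)
  refine integral_congr_ae (Filter.Eventually.of_forall fun w => ?_)
  simp [add_comm]

open scoped Classical in
theorem IsSimplex.coord_line {d : ℕ} {K : Finset (E d)} (h : IsSimplex K) {a b : E d}
    (ha : a ∈ K) (hb : b ∈ K) (t : ℝ) (y : E d) :
    coord K b (a + t • (y - a)) = t * coord K b y + if b = a then 1 - t else 0 := by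
  have : a + t • (y - a) = AffineMap.lineMap a y t := by
    rw [AffineMap.lineMap_apply_module']; abel
  rw [this, AffineMap.apply_lineMap, AffineMap.lineMap_apply_module']
  split_ifs with hba
  · subst hba
    rw [h.coord_self ha]; simp only [smul_eq_mul]; ring
  · rw [h.coord_ne hb ha hba]; simp

open scoped Classical in
-- The homothety with centre `a` and ratio t multiplies the other barycentric coordinates by t > 0
-- and turns the one of `a` from 0 into 1 - t ≥ 0, so no sign changes.
theorem IsSimplex.mem_hull_cone {d : ℕ} {K : Finset (E d)} (h : IsSimplex K) {a : E d}
    (ha : a ∈ K) {t : ℝ} (ht : 0 < t) (ht1 : t ≤ 1) {y : E d} (hy : coord K a y = 0) :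
    a + t • (y - a) ∈ hull K ↔ y ∈ hull (K.erase a) := by
  rw [h.mem_hull, h.mem_hull_subset (Finset.erase_subset _ _)]
  constructor
  · intro H
    refine ⟨fun b hb => ?_, fun b hb hb' => ?_⟩
    · by_cases hba : b = a
      · rw [hba, hy]
      · have := H b hb
        rw [h.coord_line ha hb, if_neg hba, add_zero] at this
        exact nonneg_of_mul_nonneg_right this ht
    · have : b = a := by
        by_contra hne
        exact hb' (Finset.mem_erase.2 ⟨hne, hb⟩)
      rw [this, hy]
  · rintro ⟨H, -⟩ b hb
    rw [h.coord_line ha hb]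
    have := mul_nonneg ht.le (H b hb)
    split_ifs <;> linarith

open scoped Classical in
/-- The integral over a simplex in terms of the integrals over the slices parallel to a facet. -/
theorem IsSimplex.cellInt_eq_cone {d : ℕ} (hd : 0 < d) {K : Finset (E d)} (h : IsSimplex K)
    {a : E d} (ha : a ∈ K) {f : E d → ℝ} (hf : ContinuousOn f (hull K)) :
    cellInt K f = height K (K.erase a) *
      ∫ t in (0 : ℝ)..1, t ^ (d - 1) * facetInt (K.erase a) (fun y => f (a + t • (y - a))) := by
  set F := K.erase a with hF
  set n := outwardNormal K F with hn'
  set H := height K F with hH'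
  have hH : 0 < H := h.height_pos hd ha
  have hn : ‖n‖ = 1 := norm_outwardNormal hH.ne'
  have hm : MeasurableSet (hull K) := (isCompact_hull K).measurableSet
  have hfi : Integrable ((hull K).indicator f) :=
    (integrable_indicator_iff hm).2 (hf.integrableOn_compact (isCompact_hull K))
  rw [cellInt, ← integral_indicator hm, integral_eq_integral_slices hn a hfi]
  set J : ℝ → ℝ := fun s => ∫ w : (ℝ ∙ n)ᗮ, (hull K).indicator f (a + (s • n + w)) with hJ
  -- The slice at signed distance s from `a` along the normal is the level set where the coordinate
  -- of `a` is 1 - s/H. Hence only 0 ≤ s ≤ H meets the simplex.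
  have hcoord : ∀ (s : ℝ) (w : (ℝ ∙ n)ᗮ), H * (1 - coord K a (a + (s • n + w))) = s := by
    intro s w
    have hw := Submodule.mem_orthogonal_singleton_iff_inner_left.1 w.2
    rw [← h.inner_normal hd ha, add_sub_cancel_left, inner_add_left, real_inner_smul_left]
    rw [← hF, ← hn', real_inner_self_eq_norm_sq, hn, hw]
    ring
  have hJ0 : ∀ s, s ∉ Set.Icc 0 H → J s = 0 := by
    intro s hs
    refine integral_eq_zero_of_ae (Filter.Eventually.of_forall fun w => ?_)
    refine Set.indicator_of_notMem (fun hx => hs ?_) _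
    have hx' := h.mem_hull.1 hx
    have h1 : coord K a (a + (s • n + w)) ≤ 1 := by
      rw [← h.sum_coord (a + (s • n + w))]
      exact Finset.single_le_sum (f := fun b => coord K b (a + (s • n + w))) hx' ha
    have h0 := hx' a ha
    rw [← hcoord s w]
    constructor
    · exact mul_nonneg hH.le (by linarith)
    · nlinarith
  -- The slice at distance tH is the image of the facet under the homothety of ratio t about `a`,
  -- whose Jacobian in the hyperplane is t^(d-1).
  have hJt : ∀ t ∈ Set.Ioc (0 : ℝ) 1,
      J (t * H) = t ^ (d - 1) * facetInt F (fun y => f (a + t • (y - a))) := by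
    intro t ht
    have hcomp := Measure.integral_comp_smul (volume : Measure (ℝ ∙ n)ᗮ)
      (fun w => (hull K).indicator f (a + ((t * H) • n + w))) t
    rw [finrank_orthogonal_span hn, abs_of_pos (inv_pos.2 (pow_pos ht.1 _)), smul_eq_mul] at hcomp
    have ht0 : t ^ (d - 1) ≠ 0 := (pow_pos ht.1 _).ne'
    have : J (t * H) = t ^ (d - 1) * ∫ w : (ℝ ∙ n)ᗮ,
        (hull K).indicator f (a + ((t * H) • n + ((t • w : (ℝ ∙ n)ᗮ) : E d))) := by
      rw [hcomp]; field_simp; rfl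
    rw [this, h.facetInt_eq hd ha, ← integral_indicator]
    · congr 1
      refine integral_congr_ae (Filter.Eventually.of_forall fun w => ?_)
      simp only
      have e : a + ((t * H) • n + ((t • w : (ℝ ∙ n)ᗮ) : E d)) =
          a + t • (((w : E d) + (a + H • n)) - a) := by
        rw [Submodule.coe_smul, mul_smul, smul_sub, smul_add, smul_add]; abel
      have hy : coord K a ((w : E d) + (a + H • n)) = 0 := by
        have := hcoord H w
        have e2 : a + (H • n + (w : E d)) = (w : E d) + (a + H • n) := by abel
        rw [e2] at this
        have h3 : (1 - coord K a ((w : E d) + (a + H • n))) = 1 :=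
          mul_left_cancel₀ hH.ne' (by rw [this, mul_one])
        linarith
      rw [e]
      have hiff := h.mem_hull_cone ha ht.1 ht.2 hy
      by_cases hmem : (w : E d) + (a + H • n) ∈ hull F
      · rw [Set.indicator_of_mem (hiff.2 hmem), Set.indicator_of_mem]
        exact hmem
      · rw [Set.indicator_of_notMem (fun hh => hmem (hiff.1 hh)), Set.indicator_of_notMem]
        exact hmem
    · exact ((isCompact_hull _).measurableSet).preimage (by fun_prop)
  have h1 : ∫ s, J s = ∫ s in (0 : ℝ)..H, J s := by
    rw [intervalIntegral.integral_of_le hH.le, ← integral_Icc_eq_integral_Ioc,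
      setIntegral_eq_integral_of_forall_compl_eq_zero hJ0]
  rw [h1]
  have h2 := intervalIntegral.mul_integral_comp_mul_right (a := 0) (b := 1) (f := J) H
  rw [zero_mul, one_mul] at h2
  rw [← h2]
  congr 1
  refine intervalIntegral.integral_congr_ae (Filter.Eventually.of_forall fun t ht => ?_)
  rw [Set.uIoc_of_le zero_le_one] at ht
  exact hJt t ht

/-! ### Polynomials as functions -/

@[simp] theorem ev_zero {d : ℕ} (x : E d) : ev (0 : Poly d) x = 0 := map_zero _
@[simp] theorem ev_add {d : ℕ} (p q : Poly d) (x : E d) : ev (p + q) x = ev p x + ev q x :=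
  map_add _ _ _
@[simp] theorem ev_sub {d : ℕ} (p q : Poly d) (x : E d) : ev (p - q) x = ev p x - ev q x :=
  map_sub _ _ _
@[simp] theorem ev_mul {d : ℕ} (p q : Poly d) (x : E d) : ev (p * q) x = ev p x * ev q x :=
  map_mul _ _ _
@[simp] theorem ev_C {d : ℕ} (c : ℝ) (x : E d) : ev (MvPolynomial.C c : Poly d) x = c :=
  MvPolynomial.eval_C _
@[simp] theorem ev_X {d : ℕ} (i : Fin d) (x : E d) : ev (MvPolynomial.X i : Poly d) x = x i :=
  MvPolynomial.eval_X _
@[simp] theorem ev_smul {d : ℕ} (c : ℝ) (p : Poly d) (x : E d) : ev (c • p) x = c * ev p x :=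
  MvPolynomial.smul_eval _ _ _
@[simp] theorem ev_sum {d : ℕ} {ι : Type*} (s : Finset ι) (p : ι → Poly d) (x : E d) :
    ev (∑ i ∈ s, p i) x = ∑ i ∈ s, ev (p i) x := map_sum _ _ _

theorem continuous_ev {d : ℕ} (p : Poly d) : Continuous (ev p) :=
  (MvPolynomial.continuous_eval p).comp (by fun_prop)

/-- A polynomial that vanishes on a nonempty open set is zero. -/
theorem eq_zero_of_ev_eq_zero {d : ℕ} {p : Poly d} {s : Set (E d)} (hs : (interior s).Nonempty)
    (h : ∀ x ∈ s, ev p x = 0) : p = 0 := by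
  obtain ⟨x, hx⟩ := hs
  have hopen : IsOpen ((WithLp.toLp 2 : (Fin d → ℝ) → E d) ⁻¹' interior s) :=
    isOpen_interior.preimage (PiLp.continuous_toLp 2 _)
  obtain ⟨ε, hε, hball⟩ := Metric.isOpen_iff.1 hopen (WithLp.ofLp x) hx
  refine MvPolynomial.funext_set (fun i => Metric.ball (x i) ε) (fun i => ?_) fun y hy => ?_
  · rw [Real.ball_eq_Ioo]
    exact Set.Ioo_infinite (by linarith)
  · rw [map_zero]
    have : y ∈ Metric.ball (WithLp.ofLp x) ε := by
      rw [ball_pi _ hε]; exact hy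
    exact h _ (interior_subset (hball this))

/-- The derivative of a polynomial in the direction `h`. -/
noncomputable def ddir {d : ℕ} (h : E d) (p : Poly d) : Poly d :=
  ∑ i, MvPolynomial.C (h i) * MvPolynomial.pderiv i p

theorem ev_ddir {d : ℕ} (h : E d) (p : Poly d) (x : E d) :
    ev (ddir h p) x = ∑ i, h i * ev (MvPolynomial.pderiv i p) x := by
  simp [ddir]

theorem ddir_mul {d : ℕ} (h : E d) (p q : Poly d) :
    ddir h (p * q) = ddir h p * q + p * ddir h q := by
  simp only [ddir, MvPolynomial.pderiv_mul, Finset.sum_mul, Finset.mul_sum]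
  rw [← Finset.sum_add_distrib]
  exact Finset.sum_congr rfl fun i _ => by ring

theorem hasDerivAt_ev {d : ℕ} (p : Poly d) (a h : E d) (t : ℝ) :
    HasDerivAt (fun t : ℝ => ev p (a + t • h)) (ev (ddir h p) (a + t • h)) t := by
  induction p using MvPolynomial.induction_on with
  | C c => simpa [ddir] using hasDerivAt_const t c
  | add p q hp hq =>
    have : ddir h (p + q) = ddir h p + ddir h q := by
      simp [ddir, mul_add, Finset.sum_add_distrib]
    simpa [this] using hp.fun_add hq
  | mul_X p i hp =>
    rw [ddir_mul]
    have h1 : ddir h (MvPolynomial.X i : Poly d) = MvPolynomial.C (h i) := by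
      simp [ddir, MvPolynomial.pderiv_X, Pi.single_apply]
    have h2 : HasDerivAt (fun t : ℝ => a i + t * h i) (h i) t := by
      simpa using ((hasDerivAt_id t).mul_const (h i)).const_add (a i)
    simpa [h1] using hp.fun_mul h2

/-- The restriction of a polynomial to the line through `a` and `y`. -/
noncomputable def onLine {d : ℕ} (p : Poly d) (a y : E d) : Polynomial ℝ :=
  MvPolynomial.aeval (fun i => Polynomial.C (a i) + Polynomial.C (y i - a i) * Polynomial.X) p

theorem eval_onLine {d : ℕ} (p : Poly d) (a y : E d) (t : ℝ) :
    (onLine p a y).eval t = ev p (a + t • (y - a)) := by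
  induction p using MvPolynomial.induction_on with
  | C c => simp [onLine]
  | add p q hp hq => simp_all [onLine]
  | mul_X p i hp =>
    simp only [onLine, map_mul, Polynomial.eval_mul, ev_mul] at hp ⊢
    rw [hp]
    simp [mul_comm]

theorem natDegree_onLine_le {d : ℕ} (p : Poly d) (a y : E d) :
    (onLine p a y).natDegree ≤ p.totalDegree := by
  refine (MvPolynomial.aeval_natDegree_le p le_rfl _ (n := 1) fun i => ?_).trans (mul_one _).le
  rw [Polynomial.natDegree_C_add]
  exact (Polynomial.natDegree_C_mul_le _ _).trans Polynomial.natDegree_X_le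

/-! ### Integrals over cells and facets -/

theorem integrableOn_hull {d : ℕ} (K : Finset (E d)) {f : E d → ℝ} (hf : ContinuousOn f (hull K)) :
    IntegrableOn f (hull K) := hf.integrableOn_compact (isCompact_hull K)

open scoped Classical in
-- Hausdorff measure on all of space is not locally finite. Transported to the hyperplane of the
-- facet it is Lebesgue measure, for which continuity on a compact set is enough.
theorem IsSimplex.integrableOn_facet {d : ℕ} (hd : 0 < d) {K : Finset (E d)} (h : IsSimplex K)
    {a : E d} (ha : a ∈ K) {f : E d → ℝ} (hf : ContinuousOn f (hull (K.erase a))) :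
    IntegrableOn f (hull (K.erase a)) (Measure.euclideanHausdorffMeasure (d - 1)) := by
  set n := outwardNormal K (K.erase a) with hn'
  have hn : ‖n‖ = 1 := norm_outwardNormal (h.height_pos hd ha).ne'
  set p := a + height K (K.erase a) • n with hp
  have hs := fun y hy => h.facet_subset_range hd ha (y := y) hy
  have hι : Isometry (fun w : (ℝ ∙ n)ᗮ => (w : E d) + p) :=
    (isometry_add_right p).comp isometry_subtype_coe
  have hμ : (volume : Measure (ℝ ∙ n)ᗮ) = Measure.euclideanHausdorffMeasure (d - 1) := by
    rw [← finrank_orthogonal_span hn]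
    exact InnerProductSpace.euclideanHausdorffMeasure_eq_volume.symm
  have hr : hull (K.erase a) ⊆ Set.range (fun w : (ℝ ∙ n)ᗮ => (w : E d) + p) :=
    fun y hy => ⟨⟨y - p, hs y hy⟩, by simp⟩
  have hemb := hι.isClosedEmbedding.measurableEmbedding
  have := hemb.integrableOn_map_iff (μ := volume) (f := f) (s := hull (K.erase a))
  rw [hμ, hι.map_euclideanHausdorffMeasure, IntegrableOn,
    Measure.restrict_restrict (isCompact_hull _).measurableSet, Set.inter_eq_left.2 hr,
    ← hμ] at this
  refine this.2 (ContinuousOn.integrableOn_compact ?_ ?_)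
  · exact hι.isClosedEmbedding.isCompact_preimage (isCompact_hull _)
  · exact hf.comp hι.continuous.continuousOn (Set.mapsTo_preimage _ _)

/-- The function vanishes almost everywhere, and by continuity everywhere, because the closed
simplex is the closure of its interior. -/
theorem IsSimplex.eq_zero_of_cellInt {d : ℕ} {K : Finset (E d)} (h : IsSimplex K)
    {f : E d → ℝ} (hf : ContinuousOn f (hull K)) (h0 : ∀ x ∈ hull K, 0 ≤ f x)
    (hi : cellInt K f = 0) : ∀ x ∈ hull K, f x = 0 := by
  have hm : MeasurableSet (hull K) := (isCompact_hull K).measurableSet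
  have := (setIntegral_eq_zero_iff_of_nonneg_ae (ae_restrict_of_forall_mem hm h0)
    (integrableOn_hull K hf)).1 hi
  exact Measure.eqOn_of_ae_eq this hf continuousOn_const h.subset_closure_interior

open scoped Classical in
-- In coordinates of its hyperplane the facet is a compact convex set with nonempty interior (it
-- contains the barycentre), so the argument for cells applies one dimension lower.
theorem IsSimplex.eq_zero_of_facetInt {d : ℕ} (hd : 0 < d) {K : Finset (E d)} (h : IsSimplex K)
    {a : E d} (ha : a ∈ K) {f : E d → ℝ} (hf : ContinuousOn f (hull (K.erase a)))
    (h0 : ∀ x ∈ hull (K.erase a), 0 ≤ f x) (hi : facetInt (K.erase a) f = 0) :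
    ∀ x ∈ hull (K.erase a), f x = 0 := by
  rw [h.facetInt_eq hd ha] at hi
  set n := outwardNormal K (K.erase a) with hn'
  set H := height K (K.erase a) with hH'
  have hH : 0 < H := h.height_pos hd ha
  have hn : ‖n‖ = 1 := norm_outwardNormal hH.ne'
  set p := a + H • n with hp
  have hs := fun y hy => h.facet_subset_range hd ha (y := y) hy
  have hcont : Continuous (fun w : (ℝ ∙ n)ᗮ => (w : E d) + p) := by fun_prop
  set S : Set (ℝ ∙ n)ᗮ := {w : (ℝ ∙ n)ᗮ | (w : E d) + p ∈ hull (K.erase a)} with hS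
  have hSm : IsClosed S := (isCompact_hull _).isClosed.preimage hcont
  have hfS : ContinuousOn (fun w : (ℝ ∙ n)ᗮ => f ((w : E d) + p)) S :=
    hf.comp hcont.continuousOn (fun w hw => hw)
  have hSc : IsCompact S := by
    have hι : Isometry (fun w : (ℝ ∙ n)ᗮ => (w : E d) + p) :=
      (isometry_add_right p).comp isometry_subtype_coe
    exact hι.isClosedEmbedding.isCompact_preimage (isCompact_hull _)
  have hSconv : Convex ℝ S := by
    intro x hx y hy s t hs ht hst
    have := convex_hull (K.erase a) hx hy hs ht hst
    simp only [hS, Set.mem_ofPred_eq]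
    convert this using 1
    have e : p = (s + t) • p := by rw [hst, one_smul]
    conv_lhs => rw [e]
    simp only [Submodule.coe_add, Submodule.coe_smul, smul_add, add_smul]
    abel
  have hcoord : ∀ w : (ℝ ∙ n)ᗮ, coord K a ((w : E d) + p) = 0 := by
    intro w
    have hw := Submodule.mem_orthogonal_singleton_iff_inner_left.1 w.2
    have h1 := h.inner_normal hd ha ((w : E d) + p)
    rw [← hn', ← hH', hp] at h1
    have e : (w : E d) + (a + H • n) - a = w + H • n := by abel
    rw [e, inner_add_left, hw, real_inner_smul_left, real_inner_self_eq_norm_sq, hn] at h1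
    have h3 : (1 - coord K a ((w : E d) + (a + H • n))) = 1 :=
      mul_left_cancel₀ hH.ne' (by linarith)
    rw [hp]; linarith
  have hSint : (interior S).Nonempty := by
    set U : Set (ℝ ∙ n)ᗮ := ⋂ b ∈ K.erase a, {w | 0 < coord K b ((w : E d) + p)} with hU
    have hUo : IsOpen U := isOpen_biInter_finset fun b _ =>
      isOpen_lt continuous_const ((continuous_coord K b).comp hcont)
    have hUS : U ⊆ S := by
      intro w hw
      simp only [hU, Set.mem_iInter] at hw
      refine (h.mem_hull_subset (Finset.erase_subset _ _)).2 ⟨fun b hb => ?_, fun b hb hb' => ?_⟩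
      · by_cases hba : b = a
        · rw [hba, hcoord]
        · exact (hw b (Finset.mem_erase.2 ⟨hba, hb⟩)).le
      · have : b = a := by
          by_contra hne
          exact hb' (Finset.mem_erase.2 ⟨hne, hb⟩)
        rw [this, hcoord]
    have hne : (K.erase a).Nonempty := by
      rw [← Finset.card_pos, Finset.card_erase_of_mem ha, h.1]; simpa
    refine ⟨⟨centre (K.erase a) - p, hs _ (centre_mem_hull hne)⟩,
      interior_mono hUS (hUo.interior_eq.symm ▸ ?_)⟩
    simp only [hU, Set.mem_iInter, Set.mem_ofPred_eq, sub_add_cancel]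
    exact fun b hb => h.coord_centre_pos (Finset.erase_subset _ _) hb
  have hScl : S ⊆ closure (interior S) := by
    rw [hSconv.closure_interior_eq_closure_of_nonempty_interior hSint]; exact subset_closure
  have hae := (setIntegral_eq_zero_iff_of_nonneg_ae
    (ae_restrict_of_forall_mem hSm.measurableSet fun w hw => h0 _ hw)
    (hfS.integrableOn_compact hSc)).1 hi
  have := Measure.eqOn_of_ae_eq hae hfS continuousOn_const hScl
  intro x hx
  have hx' : (⟨x - p, hs x hx⟩ : (ℝ ∙ n)ᗮ) ∈ S := by simpa [hS] using hx
  simpa using this hx'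

open scoped Classical in
-- Exchanging the two integrals turns the cone formula into an integral over the facet of
-- one-dimensional integrals along rays from the opposite vertex.
theorem IsSimplex.facetInt_intervalIntegral {d : ℕ} (hd : 0 < d) {K : Finset (E d)}
    (h : IsSimplex K) {a : E d} (ha : a ∈ K) {φ : ℝ → E d → ℝ}
    (hφ : Continuous (Function.uncurry φ)) :
    facetInt (K.erase a) (fun y => ∫ t in (0 : ℝ)..1, φ t y) =
      ∫ t in (0 : ℝ)..1, facetInt (K.erase a) (φ t) := by
  set F := K.erase a
  have hfin : IsFiniteMeasure
      ((Measure.euclideanHausdorffMeasure (d - 1) : Measure (E d)).restrict (hull F)) := by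
    have := h.integrableOn_facet hd ha (f := fun _ => 1) continuousOn_const
    refine ⟨?_⟩
    have h2 := (integrableOn_const_iff (by simp : ‖(1 : ℝ)‖ₑ ≠ ⊤)).1 this
    simpa using h2
  simp only [facetInt, intervalIntegral.integral_of_le zero_le_one]
  refine (integral_integral_swap ?_).symm
  have hm : MeasurableSet (Set.Ioc (0 : ℝ) 1 ×ˢ hull F) :=
    measurableSet_Ioc.prod (isCompact_hull _).measurableSet
  obtain ⟨C, hC⟩ := ((isCompact_Icc (a := (0 : ℝ)) (b := 1)).prod
    (isCompact_hull F)).exists_bound_of_continuousOn hφ.continuousOn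
  refine Integrable.of_bound hφ.aestronglyMeasurable C ?_
  rw [Measure.ae_prod_iff_ae_ae]
  · refine ae_restrict_of_forall_mem measurableSet_Ioc fun t ht => ?_
    refine ae_restrict_of_forall_mem (isCompact_hull _).measurableSet fun y hy => ?_
    exact hC (t, y) ⟨Set.Ioc_subset_Icc_self ht, hy⟩
  · exact measurableSet_le hφ.norm.measurable measurable_const

/-! ### A discrete trace inequality -/

/-- On polynomials of bounded degree, the value at `1` is controlled by a weighted `L²` norm. -/
theorem exists_eval_one_sq_le (n m : ℕ) : ∃ C : ℝ, 0 < C ∧ ∀ q : Polynomial ℝ, q.natDegree ≤ n →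
    (q.eval 1) ^ 2 ≤ C * ∫ t in (0 : ℝ)..1, t ^ m * (q.eval t) ^ 2 := by
  let V := Polynomial.degreeLT ℝ (n + 1)
  have : FiniteDimensional ℝ V := (Polynomial.degreeLTEquiv ℝ (n + 1)).symm.finiteDimensional
  have hint : ∀ p q : Polynomial ℝ,
      IntervalIntegrable (fun t => t ^ m * (p.eval t * q.eval t)) volume 0 1 := fun p q =>
    Continuous.intervalIntegrable (by fun_prop) _ _
  let B : V →ₗ[ℝ] V →ₗ[ℝ] ℝ := LinearMap.mk₂ ℝ
    (fun p q => ∫ t in (0 : ℝ)..1, t ^ m * ((p : Polynomial ℝ).eval t * (q : Polynomial ℝ).eval t))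
    (fun p p' q => by
      rw [← intervalIntegral.integral_add (hint _ _) (hint _ _)]
      congr 1; funext t; simp; ring)
    (fun c p q => by
      rw [smul_eq_mul, ← intervalIntegral.integral_const_mul]
      congr 1; funext t; simp; ring)
    (fun p q q' => by
      rw [← intervalIntegral.integral_add (hint _ _) (hint _ _)]
      congr 1; funext t; simp; ring)
    (fun c p q => by
      rw [smul_eq_mul, ← intervalIntegral.integral_const_mul]
      congr 1; funext t; simp; ring)
  have hB : ∀ p q : V, B p q = ∫ t in (0 : ℝ)..1,
      t ^ m * ((p : Polynomial ℝ).eval t * (q : Polynomial ℝ).eval t) := fun p q => rfl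
  have hpos : ∀ p : V, 0 ≤ B p p := fun p => by
    rw [hB]
    refine intervalIntegral.integral_nonneg zero_le_one fun t ht => ?_
    exact mul_nonneg (pow_nonneg ht.1 _) (mul_self_nonneg _)
  have hsymm : ∀ p q : V, B p q = B q p := fun p q => by
    rw [hB, hB]; congr 1; funext t; ring
  have hdef : ∀ p : V, B p p = 0 → p = 0 := by
    intro p hp
    have hcont : ContinuousOn (fun t : ℝ => t ^ m * ((p : Polynomial ℝ).eval t *
        (p : Polynomial ℝ).eval t)) (Set.Icc 0 1) := by fun_prop
    have h0 : ∀ t ∈ Set.Ioo (0 : ℝ) 1, (p : Polynomial ℝ).eval t = 0 := by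
      intro t ht
      by_contra hne
      have : 0 < B p p := by
        rw [hB]
        refine intervalIntegral.integral_pos zero_lt_one hcont (fun s hs => ?_) ⟨t, ⟨ht.1.le, ht.2.le⟩, ?_⟩
        · exact mul_nonneg (pow_nonneg hs.1.le _) (mul_self_nonneg _)
        · exact mul_pos (pow_pos ht.1 _) (mul_self_pos.2 hne)
      linarith
    have : (p : Polynomial ℝ) = 0 := Polynomial.eq_zero_of_infinite_isRoot _
      ((Set.Ioo_infinite (zero_lt_one' ℝ)).mono fun t ht => h0 t ht)
    exact Subtype.ext this
  have hinj : Function.Injective B := by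
    rw [← LinearMap.ker_eq_bot, LinearMap.ker_eq_bot']
    exact fun p hp => hdef p (by rw [hp]; rfl)
  have hsurj : Function.Surjective B :=
    (LinearMap.injective_iff_surjective_of_finrank_eq_finrank
      (Subspace.dual_finrank_eq (K := ℝ) (V := V)).symm).1 hinj
  -- The weighted inner product is definite on a finite-dimensional space, so evaluation at 1 is
  -- represented by some `g`. Cauchy-Schwarz then gives the bound with constant `B g g`; adding 1
  -- makes positivity of the constant immediate.
  obtain ⟨g, hg⟩ := hsurj ((Polynomial.leval (1 : ℝ)).comp V.subtype)
  refine ⟨B g g + 1, by linarith [hpos g], fun q hq => ?_⟩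
  have hqV : q ∈ Polynomial.degreeLT ℝ (n + 1) := by
    rw [Polynomial.mem_degreeLT]
    exact lt_of_le_of_lt Polynomial.degree_le_natDegree (by exact_mod_cast Nat.lt_succ_of_le hq)
  have h1 : B g ⟨q, hqV⟩ = q.eval 1 := by rw [hg]; rfl
  have h2 : ∫ t in (0 : ℝ)..1, t ^ m * (q.eval t) ^ 2 = B ⟨q, hqV⟩ ⟨q, hqV⟩ := by
    rw [hB]; congr 1; funext t; simp [sq]
  rw [h2]
  have h3 := LinearMap.BilinForm.apply_mul_apply_le_of_forall_zero_le B hpos g ⟨q, hqV⟩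
  rw [hsymm ⟨q, hqV⟩ g, h1] at h3
  nlinarith [hpos ⟨q, hqV⟩]

open scoped Classical in
/-- The discrete trace inequality. -/
theorem exists_facetInt_sq_le {d : ℕ} (hd : 0 < d) (k : ℕ) : ∃ C : ℝ, 0 < C ∧
    ∀ K : Finset (E d), IsSimplex K → ∀ a ∈ K, ∀ p : Poly d, p.totalDegree ≤ k →
      height K (K.erase a) * facetInt (K.erase a) (fun x => ev p x ^ 2) ≤
        C * cellInt K (fun x => ev p x ^ 2) := by
  -- The weight t^(d-1) is the Jacobian of the cone formula. On the ray from `a` to a point y of the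
  -- facet the polynomial has degree at most `k`, and y corresponds to t = 1, so the constant does
  -- not see the shape of the simplex.
  obtain ⟨C, hC, h1⟩ := exists_eval_one_sq_le k (d - 1)
  refine ⟨C, hC, fun K h a ha p hp => ?_⟩
  have hev := continuous_ev p
  have hH := h.height_pos hd ha
  rw [h.cellInt_eq_cone hd ha (f := fun x => ev p x ^ 2) (by fun_prop), ← mul_assoc,
    mul_comm C, mul_assoc]
  refine mul_le_mul_of_nonneg_left ?_ hH.le
  have h2 : ∀ t : ℝ, t ^ (d - 1) * facetInt (K.erase a) (fun y => ev p (a + t • (y - a)) ^ 2) =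
      facetInt (K.erase a) (fun y => t ^ (d - 1) * ev p (a + t • (y - a)) ^ 2) := fun t =>
    (integral_const_mul _ _).symm
  have hjc : Continuous (Function.uncurry fun (t : ℝ) (y : E d) =>
      t ^ (d - 1) * ev p (a + t • (y - a)) ^ 2) := by
    simp only [Function.uncurry_def]
    fun_prop
  simp only [h2]
  rw [← h.facetInt_intervalIntegral hd ha hjc]
  simp only [facetInt]
  rw [← integral_const_mul]
  have hjc' : Continuous fun y : E d =>
      ∫ t in (0 : ℝ)..1, t ^ (d - 1) * ev p (a + t • (y - a)) ^ 2 :=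
    intervalIntegral.continuous_parametric_intervalIntegral_of_continuous'
      (by simp only [Function.uncurry_def]; fun_prop) _ _
  refine setIntegral_mono_on (h.integrableOn_facet hd ha (by fun_prop))
    (h.integrableOn_facet hd ha (continuous_const.mul hjc').continuousOn)
    (isCompact_hull _).measurableSet fun y _ => ?_
  have := h1 (onLine p a y) ((natDegree_onLine_le p a y).trans hp)
  simpa only [eval_onLine, one_smul, add_sub_cancel] using this

/-! ### The divergence theorem on a simplex -/

open scoped Classical in
-- This is the divergence theorem for the field p(x)(x - a), which is tangential to all facets
-- through `a`. Along a ray the integrand, with its Jacobian, is the derivative of t^d p(a + t(y -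
-- a)), so the fundamental theorem of calculus leaves the value at t = 1.
theorem IsSimplex.integral_radial {d : ℕ} (hd : 0 < d) {K : Finset (E d)} (h : IsSimplex K)
    {a : E d} (ha : a ∈ K) (p : Poly d) :
    cellInt K (fun x => d * ev p x + ev (ddir (x - a) p) x) =
      height K (K.erase a) * facetInt (K.erase a) (ev p) := by
  have hev := continuous_ev p
  have hdd : ∀ (y x : E d), ev (ddir y p) x = ∑ i, y i * ev (MvPolynomial.pderiv i p) x :=
    fun y x => ev_ddir y p x
  have hpd : ∀ i, Continuous (ev (MvPolynomial.pderiv i p)) := fun i => continuous_ev _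
  rw [h.cellInt_eq_cone hd ha (by simp only [hdd]; fun_prop)]
  congr 1
  have h2 : ∀ t : ℝ, t ^ (d - 1) * facetInt (K.erase a)
      (fun y => d * ev p (a + t • (y - a)) + ev (ddir (a + t • (y - a) - a) p) (a + t • (y - a))) =
      facetInt (K.erase a) (fun y => t ^ (d - 1) * (d * ev p (a + t • (y - a)) +
        ev (ddir (a + t • (y - a) - a) p) (a + t • (y - a)))) := fun t =>
    (integral_const_mul _ _).symm
  simp only [h2]
  rw [← h.facetInt_intervalIntegral hd ha
    (by simp only [Function.uncurry_def, hdd]; fun_prop)]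
  congr 1
  funext y
  have hder : ∀ t : ℝ, HasDerivAt (fun t : ℝ => t ^ d * ev p (a + t • (y - a)))
      (t ^ (d - 1) * (d * ev p (a + t • (y - a)) +
        ev (ddir (a + t • (y - a) - a) p) (a + t • (y - a)))) t := by
    intro t
    refine ((hasDerivAt_pow d t).fun_mul (hasDerivAt_ev p a (y - a) t)).congr_deriv ?_
    have e : ev (ddir (a + t • (y - a) - a) p) (a + t • (y - a)) =
        t * ev (ddir (y - a) p) (a + t • (y - a)) := by
      rw [hdd, hdd, Finset.mul_sum]
      refine Finset.sum_congr rfl fun i _ => ?_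
      simp; ring
    have e2 : t ^ d = t ^ (d - 1) * t := by rw [← pow_succ, Nat.sub_add_cancel hd]
    rw [e, e2]
    ring
  rw [intervalIntegral.integral_eq_sub_of_hasDerivAt (fun t _ => hder t)
    (Continuous.intervalIntegrable (by simp only [hdd]; fun_prop) _ _)]
  simp [hd.ne']

open scoped Classical in
/-- The divergence theorem on a simplex for a scalar function times the direction of an edge. -/
theorem IsSimplex.integral_ddir {d : ℕ} (hd : 0 < d) {K : Finset (E d)} (h : IsSimplex K)
    {a b : E d} (ha : a ∈ K) (hb : b ∈ K) (p : Poly d) :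
    cellInt K (ev (ddir (b - a) p)) =
      height K (K.erase a) * facetInt (K.erase a) (ev p) -
        height K (K.erase b) * facetInt (K.erase b) (ev p) := by
  have hev := continuous_ev p
  have hpd : ∀ i, Continuous (ev (MvPolynomial.pderiv i p)) := fun i => continuous_ev _
  -- Subtracting the radial identities at `a` and `b` cancels the terms d·p and leaves the direction
  -- (x - a) - (x - b) = b - a.
  rw [← h.integral_radial hd ha, ← h.integral_radial hd hb, cellInt, cellInt, cellInt,
    ← integral_sub]
  · congr 1
    funext x
    simp only [ev_ddir]
    rw [add_sub_add_left_eq_sub, ← Finset.sum_sub_distrib]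
    refine Finset.sum_congr rfl fun i _ => ?_
    simp; ring
  · exact integrableOn_hull K (by simp only [ev_ddir]; fun_prop)
  · exact integrableOn_hull K (by simp only [ev_ddir]; fun_prop)

/-! ### Polynomials with prescribed degree -/

theorem totalDegree_pderiv_le {d : ℕ} (i : Fin d) (p : Poly d) :
    (MvPolynomial.pderiv i p).totalDegree ≤ p.totalDegree - 1 := by
  refine Finset.sup_le fun m hm => ?_
  rw [MvPolynomial.mem_support_iff, MvPolynomial.coeff_pderiv] at hm
  have h1 := MvPolynomial.le_totalDegree (MvPolynomial.mem_support_iff.2 (left_ne_zero_of_mul hm))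
  have h2 : (m + Finsupp.single i 1).degree = m.degree + 1 := by simp
  change (m + Finsupp.single i 1).degree ≤ _ at h1
  change m.degree ≤ _
  omega

theorem totalDegree_ddir_le {d : ℕ} (h : E d) (p : Poly d) :
    (ddir h p).totalDegree ≤ p.totalDegree - 1 :=
  MvPolynomial.totalDegree_finsetSum_le fun i _ => (MvPolynomial.totalDegree_mul _ _).trans (by
    rw [MvPolynomial.totalDegree_C, zero_add]
    exact totalDegree_pderiv_le i p)

theorem totalDegree_C_mul_le {d : ℕ} (c : ℝ) (p : Poly d) :
    (MvPolynomial.C c * p).totalDegree ≤ p.totalDegree :=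
  (MvPolynomial.totalDegree_mul _ _).trans (by rw [MvPolynomial.totalDegree_C, zero_add])

theorem exists_poly_eq_coord {d : ℕ} (K : Finset (E d)) (a : E d) :
    ∃ p : Poly d, p.totalDegree ≤ 1 ∧ ∀ x, ev p x = coord K a x := by
  set φ := coord K a
  refine ⟨MvPolynomial.C (φ 0) +
    ∑ i, MvPolynomial.C (φ.linear (EuclideanSpace.single i 1)) * MvPolynomial.X i, ?_, fun x => ?_⟩
  · refine (MvPolynomial.totalDegree_add _ _).trans (max_le (by simp) ?_)
    refine MvPolynomial.totalDegree_finsetSum_le fun i _ => ?_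
    exact (totalDegree_C_mul_le _ _).trans (MvPolynomial.totalDegree_X i).le
  · have hφ : φ x = φ.linear x + φ 0 := by simpa using φ.map_vadd 0 x
    have hx : x = ∑ i, x i • EuclideanSpace.single i (1 : ℝ) := by
      simpa using ((EuclideanSpace.basisFun (Fin d) ℝ).sum_repr x).symm
    rw [hφ]
    conv_rhs => rw [hx, map_sum]
    simp [add_comm, mul_comm]

open scoped Classical in
/-- On a facet, a polynomial of degree at most `k` is a combination of the barycentric coordinates
with polynomial coefficients of degree at most `k - 1`. -/
theorem IsSimplex.exists_coord_combination {d : ℕ} {K : Finset (E d)} (h : IsSimplex K) {a : E d}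
    (ha : a ∈ K) {k : ℕ} (p : Poly d) (hp : p.totalDegree ≤ k) :
    ∃ φ : E d → Poly d, (∀ b, (φ b).totalDegree ≤ k - 1) ∧ ∀ x, coord K a x = 0 →
      ev p x = ∑ b ∈ K.erase a, coord K b x * ev (φ b) x := by
  have hmon : ∀ m ∈ p.support, ∃ φ : E d → Poly d, (∀ b, (φ b).totalDegree ≤ k - 1) ∧
      ∀ x, coord K a x = 0 → ev (MvPolynomial.monomial m (p.coeff m)) x =
        ∑ b ∈ K.erase a, coord K b x * ev (φ b) x := by
    intro m hm
    have hmk : m.degree ≤ k := (MvPolynomial.le_totalDegree hm).trans hp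
    -- On the facet the remaining coordinates sum to 1, which treats constants. A nonconstant
    -- monomial gives up one factor X_i, rewritten as the combination of the i-th components of the
    -- vertices; this lowers the degree of the coefficients by one.
    by_cases hm0 : m = 0
    · refine ⟨fun _ => MvPolynomial.C (p.coeff m), by simp, fun x hx => ?_⟩
      have := h.sum_coord x
      rw [← Finset.add_sum_erase _ _ ha, hx, zero_add] at this
      simp only [ev_C]
      rw [← Finset.sum_mul, this, hm0]
      simp [ev]
    · obtain ⟨i, hi⟩ : ∃ i, m i ≠ 0 := by
        by_contra hcon
        push Not at hcon
        exact hm0 (Finsupp.ext hcon)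
      set m' := m - Finsupp.single i 1 with hm'
      have hle : Finsupp.single i 1 ≤ m := by
        rw [Finsupp.single_le_iff]; omega
      have hmm : m' + Finsupp.single i 1 = m := tsub_add_cancel_of_le hle
      have hdeg : m'.degree + 1 = m.degree := by rw [← hmm]; simp
      have hfac : MvPolynomial.monomial m (p.coeff m) =
          MvPolynomial.X i * MvPolynomial.monomial m' (p.coeff m) := by
        rw [mul_comm, MvPolynomial.X, MvPolynomial.monomial_mul, hmm, mul_one]
      refine ⟨fun b => MvPolynomial.C (b i) * MvPolynomial.monomial m' (p.coeff m),
        fun b => (totalDegree_C_mul_le _ _).trans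
          ((MvPolynomial.totalDegree_monomial_le _ _).trans ?_), fun x hx => ?_⟩
      · change m'.degree ≤ _; omega
      · have hxi : x i = ∑ b ∈ K.erase a, coord K b x * b i := by
          have h2 : (∑ b ∈ K, coord K b x • b) i = x i := by rw [h.sum_coord_smul x]
          rw [← Finset.add_sum_erase _ _ ha, hx] at h2
          simpa using h2.symm
        rw [hfac, ev_mul, ev_X]
        conv_lhs => rw [hxi]
        rw [Finset.sum_mul]
        exact Finset.sum_congr rfl fun b _ => by rw [ev_mul, ev_C]; ring
  choose! φ hφ1 hφ2 using hmon
  refine ⟨fun b => ∑ m ∈ p.support, φ m b,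
    fun b => MvPolynomial.totalDegree_finsetSum_le fun m hm => hφ1 m hm b, fun x hx => ?_⟩
  conv_lhs => rw [p.as_sum, ev_sum]
  simp only [ev_sum, Finset.mul_sum]
  rw [Finset.sum_comm]
  exact Finset.sum_congr rfl fun m hm => hφ2 m hm x hx

/-! ### The local kernel of the divergence form -/

theorem divergence_C_mul {d : ℕ} (t : E d) (g : Poly d) (x : E d) :
    divergence (fun i => MvPolynomial.C (t i) * g) x = ev (ddir t g) x := by
  rw [divergence, ev_ddir]
  exact Finset.sum_congr rfl fun i _ => by rw [MvPolynomial.pderiv_C_mul, ev_mul, ev_C]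

open scoped Classical in
-- An edge is parallel to every facet containing both its ends, so a test field along an edge has a
-- normal component on just the two facets opposite its ends.
theorem IsSimplex.inner_edge_normal {d : ℕ} (hd : 0 < d) {K : Finset (E d)} (h : IsSimplex K)
    {c : E d} (hc : c ∈ K) (a b : E d) :
    inner ℝ (b - a) (outwardNormal K (K.erase c)) =
      height K (K.erase c) * (coord K c a - coord K c b) := by
  have e : b - a = (b - c) - (a - c) := by abel
  rw [e, inner_sub_left, h.inner_normal hd hc, h.inner_normal hd hc]
  ring

open scoped Classical in
/-- If a cell polynomial and facet polynomials annihilate all vector polynomials in the divergence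
form on a simplex, then they are one and the same constant. -/
theorem IsSimplex.eq_const_of_divergence_form_eq_zero {d : ℕ} (hd : 0 < d) {K : Finset (E d)}
    (h : IsSimplex K) {k : ℕ} (hk : 1 ≤ k) {q : Poly d} (hq : q.totalDegree ≤ k - 1)
    {r : Finset (E d) → E d → ℝ}
    (hr : ∀ F ∈ facetsOf K, ∃ p : Poly d, p.totalDegree ≤ k ∧ ∀ x ∈ hull F, r F x = ev p x)
    (H : ∀ w : Fin d → Poly d, (∀ i, (w i).totalDegree ≤ k) →
      -(cellInt K fun x => ev q x * divergence w x) +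
        bdryInt K (fun F x => r F x * ((fun i => ev (w i) x) ⬝ᵥ fun i => outwardNormal K F i)) = 0) :
    ∃ c, (∀ x, ev q x = c) ∧ ∀ F ∈ facetsOf K, ∀ x ∈ hull F, r F x = c := by
  have hcont := fun p : Poly d => continuous_ev p
  have hfac : ∀ a ∈ K, K.erase a ∈ facetsOf K := fun a ha => (mem_facetsOf h.1).2 ⟨a, ha, rfl⟩
  have hrc : ∀ a ∈ K, ContinuousOn (r (K.erase a)) (hull (K.erase a)) := fun a ha => by
    obtain ⟨p, -, hp⟩ := hr _ (hfac a ha)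
    exact (hcont p).continuousOn.congr hp
  -- Test with the field g (b - a). Its normal component lives on the facets opposite `a` and `b`,
  -- and `g` vanishes on the latter. Integration by parts along the edge moves the derivative from
  -- `g` to `q`.
  have star : ∀ a ∈ K, ∀ b ∈ K, a ≠ b → ∀ g : Poly d, g.totalDegree ≤ k →
      (∀ x ∈ hull (K.erase b), ev g x = 0) →
      cellInt K (ev (g * ddir (b - a) q)) =
        height K (K.erase a) * facetInt (K.erase a) (fun x => (ev q x - r (K.erase a) x) * ev g x) := by
    intro a ha b hb hab g hg hgb
    have h1 := H (fun i => MvPolynomial.C ((b - a) i) * g)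
      (fun i => (totalDegree_C_mul_le _ _).trans hg)
    simp only [divergence_C_mul] at h1
    have h2 : bdryInt K (fun F x => r F x * ((fun i => ev (MvPolynomial.C ((b - a) i) * g) x) ⬝ᵥ
        fun i => outwardNormal K F i)) =
        height K (K.erase a) * facetInt (K.erase a) (fun x => r (K.erase a) x * ev g x) := by
      rw [bdryInt, sum_facetsOf h.1, Finset.sum_eq_single a]
      · rw [facetInt, facetInt, ← integral_const_mul]
        congr 1; funext x
        have := h.inner_edge_normal hd ha a b
        rw [inner_eq_dotProduct, h.coord_self ha, h.coord_ne ha hb hab] at this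
        simp only [dotProduct, ev_mul, ev_C]
        have e : ∑ i, (b - a) i * ev g x * outwardNormal K (K.erase a) i =
            ev g x * ∑ i, (b - a) i * outwardNormal K (K.erase a) i := by
          rw [Finset.mul_sum]; exact Finset.sum_congr rfl fun i _ => by ring
        rw [e, this]; ring
      · intro c hc hca
        refine setIntegral_eq_zero_of_forall_eq_zero fun x hx => ?_
        simp only [dotProduct, ev_mul, ev_C]
        have e : ∑ i, (b - a) i * ev g x * outwardNormal K (K.erase c) i =
            ev g x * ∑ i, (b - a) i * outwardNormal K (K.erase c) i := by
          rw [Finset.mul_sum]; exact Finset.sum_congr rfl fun i _ => by ring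
        rw [e]
        by_cases hcb : c = b
        · subst hcb; rw [hgb x hx]; ring
        · have := h.inner_edge_normal hd hc a b
          rw [inner_eq_dotProduct, h.coord_ne hc ha hca, h.coord_ne hc hb hcb] at this
          rw [this]; ring
      · exact fun hn => absurd ha hn
    have h3 := h.integral_ddir hd ha hb (q * g)
    have h4 : facetInt (K.erase b) (ev (q * g)) = 0 :=
      setIntegral_eq_zero_of_forall_eq_zero fun x hx => by rw [ev_mul, hgb x hx, mul_zero]
    have h5 : cellInt K (ev (ddir (b - a) (q * g))) =
        cellInt K (ev (g * ddir (b - a) q)) + cellInt K (fun x => ev q x * ev (ddir (b - a) g) x) := by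
      rw [cellInt, cellInt, cellInt, ← integral_add]
      · congr 1; funext x; rw [ddir_mul]; simp only [ev_add, ev_mul]; ring
      · exact integrableOn_hull K (hcont _).continuousOn
      · exact integrableOn_hull K ((hcont _).mul (hcont _)).continuousOn
    have h6 : facetInt (K.erase a) (fun x => (ev q x - r (K.erase a) x) * ev g x) =
        facetInt (K.erase a) (ev (q * g)) -
          facetInt (K.erase a) (fun x => r (K.erase a) x * ev g x) := by
      rw [facetInt, facetInt, facetInt, ← integral_sub]
      · congr 1; funext x; rw [ev_mul]; ring
      · exact h.integrableOn_facet hd ha (hcont _).continuousOn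
      · exact h.integrableOn_facet hd ha ((hrc a ha).mul (hcont _).continuousOn)
    rw [h4] at h3
    rw [h2] at h1
    rw [h6]
    linarith
  choose lam hlam1 hlam2 using exists_poly_eq_coord K
  have hlam0 : ∀ a ∈ K, ∀ x ∈ hull (K.erase a), ev (lam a) x = 0 := fun a ha x hx => by
    rw [hlam2]
    exact ((h.mem_hull_subset (Finset.erase_subset _ _)).1 hx).2 a ha (Finset.notMem_erase _ _)
  have hgrad : ∀ a ∈ K, ∀ b ∈ K, ddir (b - a) q = 0 := by
    intro a ha b hb
    by_cases hab : a = b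
    · subst hab; simp [ddir]
    by_contra hne
    set ψ := ddir (b - a) q with hψ
    have hdeg : ψ.totalDegree ≤ q.totalDegree - 1 := totalDegree_ddir_le _ _
    -- If ψ is nonzero then `q` is not constant, so the subtraction in `hdeg` does not truncate and
    -- ψ has degree at most k - 2.
    have hq1 : 1 ≤ q.totalDegree := by
      by_contra hlt
      have : q.totalDegree = 0 := by omega
      rw [MvPolynomial.totalDegree_eq_zero_iff_eq_C] at this
      rw [hψ, this] at hne
      exact hne (by simp [ddir])
    -- The factor `lam b` makes the test function admissible, `lam a` removes the facet term, and
    -- both bring the degree up to at most k. What remains is the integral of ψ² with a weight that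
    -- is positive inside the cell.
    have h1 := star a ha b hb hab (lam a * (lam b * ψ)) (by
      have e1 := MvPolynomial.totalDegree_mul (lam a) (lam b * ψ)
      have e2 := MvPolynomial.totalDegree_mul (lam b) ψ
      have := hlam1 a
      have := hlam1 b
      omega) (fun x hx => by simp only [ev_mul, hlam0 b hb x hx]; ring)
    have h2 : facetInt (K.erase a) (fun x => (ev q x - r (K.erase a) x) *
        ev (lam a * (lam b * ψ)) x) = 0 :=
      setIntegral_eq_zero_of_forall_eq_zero fun x hx => by
        simp only [ev_mul, hlam0 a ha x hx]; ring
    rw [h2, mul_zero, ← hψ] at h1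
    have h3 := h.eq_zero_of_cellInt (hcont _).continuousOn (fun x hx => by
      have hx' := h.mem_hull.1 hx
      simp only [ev_mul, hlam2]
      have := mul_nonneg (mul_nonneg (hx' a ha) (hx' b hb)) (mul_self_nonneg (ev ψ x))
      linarith) h1
    refine hne (eq_zero_of_ev_eq_zero (s := interior (hull K))
      (by rw [interior_interior]; exact h.interior_nonempty) fun x hx => ?_)
    have h4 := h3 x (interior_subset hx)
    rw [h.interior_hull] at hx
    simp only [ev_mul, hlam2] at h4
    have ha' := (hx a ha).ne'
    have hb' := (hx b hb).ne'
    simpa [ha', hb'] using h4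
  obtain ⟨a₀, ha₀⟩ : K.Nonempty := by rw [← Finset.card_pos, h.1]; omega
  have hconst : ∀ x, ev q x = ev q a₀ := by
    intro x
    have hz : ∀ z, ev (ddir (x - a₀) q) z = 0 := by
      intro z
      have e : x - a₀ = ∑ b ∈ K, coord K b x • (b - a₀) := by
        simp only [smul_sub]
        rw [Finset.sum_sub_distrib, h.sum_coord_smul, ← Finset.sum_smul, h.sum_coord, one_smul]
      have e2 : ev (ddir (x - a₀) q) z = ∑ b ∈ K, coord K b x * ev (ddir (b - a₀) q) z := by
        rw [e]
        simp only [ev_ddir, Finset.mul_sum]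
        rw [Finset.sum_comm]
        refine Finset.sum_congr rfl fun i _ => ?_
        rw [WithLp.ofLp_sum, Finset.sum_apply, Finset.sum_mul]
        exact Finset.sum_congr rfl fun b _ => by simp; ring
      rw [e2]
      exact Finset.sum_eq_zero fun b hb => by rw [hgrad a₀ ha₀ b hb, ev_zero, mul_zero]
    have := is_const_of_deriv_eq_zero (f := fun t : ℝ => ev q (a₀ + t • (x - a₀)))
      (fun t => (hasDerivAt_ev q a₀ (x - a₀) t).differentiableAt)
      (fun t => by rw [(hasDerivAt_ev q a₀ (x - a₀) t).deriv, hz]) 1 0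
    simpa using this
  refine ⟨ev q a₀, hconst, fun F hF => ?_⟩
  obtain ⟨a, ha, rfl⟩ := (mem_facetsOf h.1).1 hF
  obtain ⟨p, hp, hrp⟩ := hr _ hF
  -- On the facet, `q - p` is the sum over b ≠ a of `lam b * φ b`, and each summand is admissible in
  -- `star`: its degree is at most k and it vanishes opposite `b`. As `q` has no gradient, the
  -- residual is orthogonal to each summand, hence to itself.
  obtain ⟨φ, hφ1, hφ2⟩ := h.exists_coord_combination ha (q - p)
    ((MvPolynomial.totalDegree_sub _ _).trans (max_le (hq.trans (Nat.sub_le _ _)) hp))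
  have hzero : ∀ b ∈ K.erase a, facetInt (K.erase a)
      (fun x => (ev q x - r (K.erase a) x) * ev (lam b * φ b) x) = 0 := by
    intro b hb
    have hb' := Finset.mem_erase.1 hb
    have h1 := star a ha b hb'.2 hb'.1.symm (lam b * φ b) (by
      have e1 := MvPolynomial.totalDegree_mul (lam b) (φ b)
      have := hlam1 b
      have := hφ1 b
      omega) (fun x hx => by simp only [ev_mul, hlam0 b hb'.2 x hx]; ring)
    rw [hgrad a ha b hb'.2] at h1
    have h2 : cellInt K (ev (lam b * φ b * 0)) = 0 :=
      setIntegral_eq_zero_of_forall_eq_zero fun x _ => by simp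
    rw [h2] at h1
    exact (mul_eq_zero.1 h1.symm).resolve_left (h.height_pos hd ha).ne'
  have hsq : facetInt (K.erase a) (fun x => (ev q x - ev p x) ^ 2) = 0 := by
    rw [← Finset.sum_eq_zero hzero]
    simp only [facetInt]
    have hint : ∀ b ∈ K.erase a, IntegrableOn
        (fun x => (ev q x - r (K.erase a) x) * ev (lam b * φ b) x) (hull (K.erase a))
        (Measure.euclideanHausdorffMeasure (d - 1)) := fun b _ => h.integrableOn_facet hd ha
      (((hcont q).continuousOn.sub (hrc a ha)).mul (hcont _).continuousOn)
    rw [← integral_finsetSum _ hint]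
    refine setIntegral_congr_fun (isCompact_hull _).measurableSet fun x hx => ?_
    have h0 : coord K a x = 0 :=
      ((h.mem_hull_subset (Finset.erase_subset _ _)).1 hx).2 a ha (Finset.notMem_erase _ _)
    have := hφ2 x h0
    rw [ev_sub] at this
    rw [← Finset.mul_sum, hrp x hx, sq]
    simp only [ev_mul, hlam2]
    rw [← this]
  intro x hx
  have := h.eq_zero_of_facetInt hd ha (((hcont q).sub (hcont p)).pow 2).continuousOn
    (fun y _ => sq_nonneg _) hsq x hx
  have h3 : ev q x - ev p x = 0 := pow_eq_zero_iff (two_ne_zero) |>.1 this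
  rw [hrp x hx, ← hconst x]
  linarith

/-! ### Vector polynomials with zero strain -/

/-- With h = x - y, the derivative of v(y + th)·h in t is the quadratic form of the strain at h,
because the antisymmetric part of the gradient drops out. -/
theorem inner_sub_eq_of_strain_eq_zero {d : ℕ} {v : Fin d → Poly d}
    (hs : ∀ x i j, strain v x i j = 0) (x y : E d) :
    ∑ i, ev (v i) x * (x i - y i) = ∑ i, ev (v i) y * (x i - y i) := by
  have hder : ∀ t : ℝ, HasDerivAt (fun t : ℝ => ∑ i, ev (v i) (y + t • (x - y)) * (x i - y i)) 0 t := by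
    intro t
    have h1 := HasDerivAt.fun_sum (u := Finset.univ) fun i _ =>
      (hasDerivAt_ev (v i) y (x - y) t).mul_const (x i - y i)
    refine h1.congr_deriv ?_
    set z := y + t • (x - y)
    have h2 : ∑ i, ev (ddir (x - y) (v i)) z * (x i - y i) =
        ∑ i, ∑ j, (x j - y j) * ev (MvPolynomial.pderiv j (v i)) z * (x i - y i) := by
      refine Finset.sum_congr rfl fun i _ => ?_
      rw [ev_ddir, Finset.sum_mul]; rfl
    have h3 : ∑ i, ∑ j, (x j - y j) * ev (MvPolynomial.pderiv j (v i)) z * (x i - y i) =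
        ∑ i, ∑ j, (x j - y j) * ev (MvPolynomial.pderiv i (v j)) z * (x i - y i) := by
      rw [Finset.sum_comm]
      exact Finset.sum_congr rfl fun i _ => Finset.sum_congr rfl fun j _ => by ring
    have h4 : ∑ i, ∑ j, (x j - y j) * ev (MvPolynomial.pderiv j (v i)) z * (x i - y i) +
        ∑ i, ∑ j, (x j - y j) * ev (MvPolynomial.pderiv i (v j)) z * (x i - y i) = 0 := by
      rw [← Finset.sum_add_distrib]
      refine Finset.sum_eq_zero fun i _ => ?_
      rw [← Finset.sum_add_distrib]
      refine Finset.sum_eq_zero fun j _ => ?_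
      have := hs z i j
      rw [strain] at this
      have e : ev (MvPolynomial.pderiv i (v j)) z = - ev (MvPolynomial.pderiv j (v i)) z := by
        linarith
      rw [e]; ring
    rw [h2]
    linarith
  have := is_const_of_deriv_eq_zero (fun t => (hder t).differentiableAt)
    (fun t => (hder t).deriv) 1 0
  simpa using this

open scoped Classical in
/-- A vector polynomial with zero strain that vanishes on a facet of a simplex is zero. -/
theorem IsSimplex.eq_zero_of_strain_eq_zero {d : ℕ} {K : Finset (E d)} (h : IsSimplex K) {a : E d}
    (ha : a ∈ K) {v : Fin d → Poly d} (hs : ∀ x i j, strain v x i j = 0)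
    (hF : ∀ x ∈ hull (K.erase a), ∀ i, ev (v i) x = 0) : v = 0 := by
  funext i
  refine eq_zero_of_ev_eq_zero (s := interior (hull K))
      (by rw [interior_interior]; exact h.interior_nonempty) fun x hx => ?_
  rw [h.interior_hull] at hx
  set V : E d := WithLp.toLp 2 (fun i => ev (v i) x) with hV
  have hVi : ∀ i, V i = ev (v i) x := fun i => rfl
  -- For a facet vertex b, v(b) = 0 turns the rigidity identity into V·(x - b) = 0.
  have h1 : ∀ b ∈ K.erase a, inner ℝ V b = inner ℝ V x := by
    intro b hb
    have := inner_sub_eq_of_strain_eq_zero hs x b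
    simp only [hF b (subset_hull hb), zero_mul, Finset.sum_const_zero, mul_sub,
      Finset.sum_sub_distrib] at this
    rw [inner_eq_dotProduct, inner_eq_dotProduct]
    simp only [hVi]
    linarith
  have hexp : ∀ y : E d, inner ℝ V y = ∑ c ∈ K, coord K c y * inner ℝ V c := by
    intro y
    conv_lhs => rw [← h.sum_coord_smul y, inner_sum]
    exact Finset.sum_congr rfl fun c _ => by rw [real_inner_smul_right]
  -- Since x is interior, `a` enters its barycentric combination with positive weight. All other
  -- vertices already have the value at x, so `a` must have it too.
  have h2 : inner ℝ V a = inner ℝ V x := by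
    have e := hexp x
    have e1 := h.sum_coord x
    rw [← Finset.add_sum_erase _ _ ha] at e e1
    rw [Finset.sum_congr rfl fun b hb => by rw [h1 b hb], ← Finset.sum_mul] at e
    have e2 : ∑ c ∈ K.erase a, coord K c x = 1 - coord K a x := by linarith
    rw [e2] at e
    have : coord K a x * (inner ℝ V a - inner ℝ V x) = 0 := by linarith
    have := (mul_eq_zero.1 this).resolve_left (hx a ha).ne'
    linarith
  have h3 : ∀ c ∈ K, inner ℝ V c = inner ℝ V x := fun c hc => by
    by_cases hca : c = a
    · rw [hca, h2]
    · exact h1 c (Finset.mem_erase.2 ⟨hca, hc⟩)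
  have h4 : ∀ y : E d, inner ℝ V y = inner ℝ V x := fun y => by
    rw [hexp, Finset.sum_congr rfl fun c hc => by rw [h3 c hc], ← Finset.sum_mul, h.sum_coord,
      one_mul]
  -- The functional y ↦ V·y is constant on all of space; its values at V and at 0 are compared.
  have h5 : inner ℝ V V = 0 := by rw [h4 V, ← h4 0, inner_zero_right]
  have h6 : V = 0 := inner_self_eq_zero.1 h5
  rw [← hVi, h6]; rfl

/-! ### Connectivity of a triangulation through its facets -/

open scoped Classical in
theorem Triangulation.mem_hull_inter {d : ℕ} (T : Triangulation d) {K L : Finset (E d)}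
    (hK : K ∈ T.cells) (hL : L ∈ T.cells) {x : E d} (hxK : x ∈ hull K) (hxL : x ∈ hull L) :
    x ∈ hull (K ∩ L) := by
  have := T.conforming K hK L hL ⟨hxK, hxL⟩
  rwa [← Finset.coe_inter] at this

theorem Triangulation.interior_hull_subset {d : ℕ} (T : Triangulation d) {K : Finset (E d)}
    (hK : K ∈ T.cells) : interior (hull K) ⊆ T.domain :=
  interior_mono (Set.subset_biUnion_of_mem (u := hull) hK)

open scoped Classical in
theorem Triangulation.inter_mem_facetsOf {d : ℕ} (T : Triangulation d) {K L : Finset (E d)}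
    (hK : K ∈ T.cells) (hL : L ∈ T.cells) (hKL : K ≠ L) (hc : d ≤ (K ∩ L).card) :
    K ∩ L ∈ facetsOf K ∧ K ∩ L ∈ facetsOf L := by
  have hlt : (K ∩ L).card ≠ d + 1 := fun he => by
    have h1 := Finset.eq_of_subset_of_card_le (Finset.inter_subset_left (s₁ := K) (s₂ := L))
      (by rw [T.card_cell K hK, he])
    have h2 := Finset.eq_of_subset_of_card_le (Finset.inter_subset_right (s₁ := K) (s₂ := L))
      (by rw [T.card_cell L hL, he])
    exact hKL (h1.symm.trans h2)
  have hle := Finset.card_le_card (Finset.inter_subset_left (s₁ := K) (s₂ := L))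
  rw [T.card_cell K hK] at hle
  have : (K ∩ L).card = d := by omega
  exact ⟨Finset.mem_powersetCard.2 ⟨Finset.inter_subset_left, this⟩,
    Finset.mem_powersetCard.2 ⟨Finset.inter_subset_right, this⟩⟩

open scoped Classical in
/-- In a nonempty open set there is a point that is not in the affine span of a given point and
a face of codimension two. -/
theorem Triangulation.exists_generic {d : ℕ} (T : Triangulation d) (x : E d) {U : Set (E d)}
    (hU : IsOpen U) (hne : U.Nonempty) : ∃ y ∈ U, ∀ K ∈ T.cells, ∀ S ⊆ K, S.card + 1 ≤ d →
      y ∉ affineSpan ℝ (insert x (S : Set (E d))) := by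
  set I := (T.cells.biUnion Finset.powerset).filter fun S => S.card + 1 ≤ d with hI
  -- A point together with at most d - 1 others spans an affine subspace of dimension at most d - 1,
  -- which is null. Finitely many such subspaces cannot cover a nonempty open set.
  have hnull : volume (⋃ S ∈ I, (affineSpan ℝ (insert x (S : Set (E d))) : Set (E d))) = 0 := by
    refine (measure_biUnion_null_iff I.countable_toSet).2 fun S hS => ?_
    refine Measure.addHaar_affineSubspace volume _ fun htop => ?_
    have hcard := (Finset.mem_filter.1 hS).2
    have h1 : Module.finrank ℝ (vectorSpan ℝ (insert x (S : Set (E d)))) ≤ S.card := by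
      rw [← Finset.coe_insert]
      have hins : (insert x S).Nonempty := Finset.insert_nonempty _ _
      have := finrank_vectorSpan_image_finset_le ℝ (id : E d → E d) (insert x S)
        (n := (insert x S).card - 1) (by have := hins.card_pos; omega)
      rw [Finset.image_id] at this
      have := Finset.card_insert_le x S
      omega
    rw [← direction_affineSpan, htop, AffineSubspace.direction_top, finrank_top,
      finrank_euclideanSpace_fin] at h1
    omega
  by_contra hcon
  push Not at hcon
  have : U ⊆ ⋃ S ∈ I, (affineSpan ℝ (insert x (S : Set (E d))) : Set (E d)) := by
    intro y hy
    obtain ⟨K, hK, S, hS, hc, hyS⟩ := hcon y hy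
    refine Set.mem_biUnion (x := S) ?_ hyS
    exact Finset.mem_filter.2 ⟨Finset.mem_biUnion.2 ⟨K, hK, Finset.mem_powerset.2 hS⟩, hc⟩
  exact (hU.measure_pos volume hne).ne' (measure_mono_null this hnull)

open scoped Classical in
/-- A quantity that agrees on cells with a common facet is constant, if the triangulated domain is
connected. -/
theorem Triangulation.eq_of_isConnected {d : ℕ} (T : Triangulation d)
    (hT : IsConnected T.domain) {α : Type*} (val : Finset (E d) → α)
    (hadj : ∀ K ∈ T.cells, ∀ L ∈ T.cells, ∀ F, F ∈ facetsOf K → F ∈ facetsOf L → val K = val L) :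
    ∀ K ∈ T.cells, ∀ L ∈ T.cells, val K = val L := by
  intro K₀ hK₀ L₀ hL₀
  by_contra hne
  -- If the quantity takes another value, the cells split into two closed unions covering the
  -- domain. Connectedness yields a domain point z in both.
  set A : Set (E d) := ⋃ K ∈ T.cells.filter (fun K => val K = val K₀), hull K with hA
  set B : Set (E d) := ⋃ K ∈ T.cells.filter (fun K => val K ≠ val K₀), hull K with hB
  have hAc : IsClosed A := isClosed_biUnion_finset fun K _ => (isCompact_hull K).isClosed
  have hBc : IsClosed B := isClosed_biUnion_finset fun K _ => (isCompact_hull K).isClosed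
  have hAmem : ∀ {x}, x ∈ A ↔ ∃ K ∈ T.cells, val K = val K₀ ∧ x ∈ hull K := by
    intro x; simp [hA, and_assoc]
  have hBmem : ∀ {x}, x ∈ B ↔ ∃ K ∈ T.cells, val K ≠ val K₀ ∧ x ∈ hull K := by
    intro x; simp [hB, and_assoc]
  have hcov : T.domain ⊆ A ∪ B := by
    intro x hx
    obtain ⟨K, hK, hxK⟩ := Set.mem_iUnion₂.1 (interior_subset hx)
    by_cases hv : val K = val K₀
    · exact Or.inl (hAmem.2 ⟨K, hK, hv, hxK⟩)
    · exact Or.inr (hBmem.2 ⟨K, hK, hv, hxK⟩)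
  have hAne : (T.domain ∩ A).Nonempty := by
    obtain ⟨x, hx⟩ := (T.isSimplex hK₀).interior_nonempty
    exact ⟨x, T.interior_hull_subset hK₀ hx, hAmem.2 ⟨K₀, hK₀, rfl, interior_subset hx⟩⟩
  have hBne : (T.domain ∩ B).Nonempty := by
    obtain ⟨x, hx⟩ := (T.isSimplex hL₀).interior_nonempty
    exact ⟨x, T.interior_hull_subset hL₀ hx,
      hBmem.2 ⟨L₀, hL₀, fun e => hne e.symm, interior_subset hx⟩⟩
  obtain ⟨z, hz, hzA, hzB⟩ :=
    isPreconnected_closed_iff.1 hT.isPreconnected A B hAc hBc hcov hAne hBne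
  obtain ⟨K, hK, hvK, hzK⟩ := hAmem.1 hzA
  obtain ⟨L, hL, hvL, hzL⟩ := hBmem.1 hzB
  have hopen : IsOpen T.domain := isOpen_interior
  obtain ⟨ε, hε, hball⟩ := Metric.isOpen_iff.1 hopen z hz
  obtain ⟨x, hxb, hxK⟩ := mem_closure_iff.1 ((T.isSimplex hK).subset_closure_interior hzK)
    _ Metric.isOpen_ball (Metric.mem_ball_self hε)
  -- In a ball about z inside the domain, x and y are interior points of cells of the two kinds, and
  -- y is generic, so that the segment from x to y avoids faces of codimension at least two. The
  -- segment is connected and must cross from `A` to `B`.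
  obtain ⟨y, ⟨hyb, hyL⟩, hgen⟩ := T.exists_generic x (Metric.isOpen_ball.inter isOpen_interior)
    (mem_closure_iff.1 ((T.isSimplex hL).subset_closure_interior hzL)
      _ Metric.isOpen_ball (Metric.mem_ball_self hε))
  have hseg : segment ℝ x y ⊆ A ∪ B :=
    ((convex_ball z ε).segment_subset hxb hyb).trans (hball.trans hcov)
  obtain ⟨w, hw, hwA, hwB⟩ := isPreconnected_closed_iff.1 (convex_segment x y).isPreconnected A B
    hAc hBc hseg ⟨x, left_mem_segment ℝ x y, hAmem.2 ⟨K, hK, hvK, interior_subset hxK⟩⟩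
    ⟨y, right_mem_segment ℝ x y, hBmem.2 ⟨L, hL, hvL, interior_subset hyL⟩⟩
  obtain ⟨K', hK', hvK', hwK'⟩ := hAmem.1 hwA
  obtain ⟨L', hL', hvL', hwL'⟩ := hBmem.1 hwB
  have hne' : K' ≠ L' := by rintro rfl; exact hvL' hvK'
  have hwS := T.mem_hull_inter hK' hL' hwK' hwL'
  by_cases hcard : (K' ∩ L').card + 1 ≤ d
  · rw [segment_eq_image_lineMap] at hw
    obtain ⟨t, -, rfl⟩ := hw
    -- At t = 0 the crossing point is x, an interior point of `K`, so the other cell would contain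
    -- all vertices of `K`. Otherwise y lies on the line through x and a point of the small face,
    -- against genericity.
    by_cases ht : t = 0
    · subst ht
      rw [AffineMap.lineMap_apply_zero] at hwL'
      have hx' := T.mem_hull_inter hK hL' (interior_subset hxK) hwL'
      rw [((T.isSimplex hK).interior_hull)] at hxK
      have hsub : K ⊆ L' := fun c hc => by
        by_contra hcL
        have := (((T.isSimplex hK).mem_hull_subset Finset.inter_subset_left).1 hx').2 c hc
          (fun hc' => hcL (Finset.mem_inter.1 hc').2)
        exact (hxK c hc).ne' this
      have : K = L' := Finset.eq_of_subset_of_card_le hsub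
        (by rw [T.card_cell _ hK, T.card_cell _ hL'])
      exact hvL' (this ▸ hvK)
    · refine hgen K' hK' _ Finset.inter_subset_left hcard ?_
      set Q := affineSpan ℝ (insert x ((K' ∩ L' : Finset (E d)) : Set (E d))) with hQ
      have hxQ : x ∈ Q := subset_affineSpan ℝ _ (Set.mem_insert _ _)
      have hwQ : AffineMap.lineMap x y t ∈ Q :=
        affineSpan_mono ℝ (Set.subset_insert _ _) (convexHull_subset_affineSpan _ hwS)
      have := AffineMap.lineMap_mem t⁻¹ hxQ hwQ
      have e : AffineMap.lineMap x (AffineMap.lineMap x y t) t⁻¹ = y := by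
        rw [AffineMap.lineMap_lineMap_right, inv_mul_cancel₀ ht, AffineMap.lineMap_apply_one]
      rwa [e] at this
  · obtain ⟨h1, h2⟩ := T.inter_mem_facetsOf hK' hL' hne' (by omega)
    exact hvL' ((hadj K' hK' L' hL' _ h1 h2).symm.trans hvK')

/-! ### Boundary facets -/

open scoped Classical in
/-- A facet on the boundary of the triangulated domain belongs to one cell only. -/
theorem Triangulation.eq_of_facet_subset_frontier {d : ℕ} (hd : 0 < d) (T : Triangulation d)
    {K L F : Finset (E d)} (hK : K ∈ T.cells) (hL : L ∈ T.cells) (hFK : F ∈ facetsOf K)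
    (hFL : F ∈ facetsOf L) (hF : hull F ⊆ frontier T.domain) : K = L := by
  by_contra hne
  have hsK := T.isSimplex hK
  have hsL := T.isSimplex hL
  obtain ⟨a, ha, rfl⟩ := (mem_facetsOf hsK.1).1 hFK
  obtain ⟨b, hb, hab⟩ := (mem_facetsOf hsL.1).1 hFL
  have haL : a ∉ L := by
    intro haL
    have hab' : a = b := by
      by_contra h
      have : a ∈ L.erase b := Finset.mem_erase.2 ⟨h, haL⟩
      rw [← hab] at this
      exact Finset.notMem_erase _ _ this
    apply hne
    rw [← Finset.insert_erase ha, hab, hab', Finset.insert_erase hb]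
  have hFne : (K.erase a).Nonempty := by
    rw [← Finset.card_pos, Finset.card_erase_of_mem ha, hsK.1]; simpa
  set c := centre (K.erase a) with hc
  set O : Set (E d) := ⋂ e ∈ K.erase a, {x | 0 < coord K e x ∧ 0 < coord L e x} with hO
  have hOo : IsOpen O := isOpen_biInter_finset fun e _ =>
    (isOpen_lt continuous_const (continuous_coord K e)).inter
      (isOpen_lt continuous_const (continuous_coord L e))
  have hOmem : ∀ {x}, x ∈ O ↔ ∀ e ∈ K.erase a, 0 < coord K e x ∧ 0 < coord L e x := by
    intro x; simp only [hO, Set.mem_iInter, Set.mem_ofPred_eq]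
  have hcO : c ∈ O := hOmem.2 fun e he =>
    ⟨hsK.coord_centre_pos (Finset.erase_subset _ _) he, by
      rw [hc, hab]
      exact hsL.coord_centre_pos (Finset.erase_subset _ _) (hab ▸ he)⟩
  -- Both coordinates vanish on the common facet, so they are proportional; the sign of the factor
  -- tells whether the cells lie on the same side.
  have hμ : ∀ x, coord L b x = coord K a x * coord L b a := by
    intro x
    rw [hsK.affine_eq (coord L b) x, ← Finset.add_sum_erase _ _ ha, Finset.sum_eq_zero, add_zero]
    intro e he
    rw [hab] at he
    have he' := Finset.mem_erase.1 he
    rw [hsL.coord_ne hb he'.2 he'.1.symm, mul_zero]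
  have hKmem : ∀ x ∈ O, 0 ≤ coord K a x → x ∈ hull K := fun x hx h0 => hsK.mem_hull.2 fun e he => by
    by_cases hea : e = a
    · rwa [hea]
    · exact ((hOmem.1 hx) e (Finset.mem_erase.2 ⟨hea, he⟩)).1.le
  have hLmem : ∀ x ∈ O, 0 ≤ coord L b x → x ∈ hull L := fun x hx h0 => hsL.mem_hull.2 fun e he => by
    by_cases heb : e = b
    · rwa [heb]
    · exact ((hOmem.1 hx) e (hab ▸ Finset.mem_erase.2 ⟨heb, he⟩)).2.le
  have hcF : c ∈ hull (K.erase a) := centre_mem_hull hFne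
  -- On the same side, interior points of `K` near the barycentre of the facet would lie in `L`.
  -- Conformity puts them in the common face, where the coordinate of `a` vanishes.
  have hneg : coord L b a < 0 := by
    by_contra hge
    obtain ⟨x, hxO, hxK⟩ := mem_closure_iff.1
      (hsK.subset_closure_interior (hull_mono (Finset.erase_subset _ _) hcF)) O hOo hcO
    have hxK' := hsK.interior_hull ▸ hxK
    have hpos : 0 < coord K a x := hxK' a ha
    have hxL : x ∈ hull L := hLmem x hxO (by rw [hμ]; exact mul_nonneg hpos.le (not_lt.1 hge))
    have hx := T.mem_hull_inter hK hL (interior_subset hxK) hxL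
    have := ((hsK.mem_hull_subset Finset.inter_subset_left).1 hx).2 a ha
      (fun h => haL (Finset.mem_inter.1 h).2)
    linarith
  -- With the cells on opposite sides, every point of `O` lies in one of them. The barycentre of the
  -- facet is then interior to the domain and cannot be on its frontier.
  have hOsub : O ⊆ T.domain := interior_maximal (fun x hx => by
    rcases le_or_gt 0 (coord K a x) with h0 | h0
    · exact Set.mem_biUnion hK (hKmem x hx h0)
    · exact Set.mem_biUnion hL (hLmem x hx (by
        rw [hμ]; exact (mul_pos_of_neg_of_neg h0 hneg).le))) hOo
  have hopen : IsOpen T.domain := isOpen_interior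
  have h1 := hF hcF
  rw [hopen.frontier_eq] at h1
  exact h1.2 (hOsub hcO)

/-! ### Membership in the approximation spaces -/

theorem mem_facetPoly {d k : ℕ} {F : Finset (E d)} {q : E d → ℝ} :
    q ∈ facetPoly k F ↔ ∃ p : Poly d, p.totalDegree ≤ k ∧ q = (hull F).indicator (ev p) := Iff.rfl

theorem continuousOn_of_mem_facetPoly {d k : ℕ} {F : Finset (E d)} {q : E d → ℝ}
    (hq : q ∈ facetPoly k F) : ContinuousOn q (hull F) := by
  obtain ⟨p, -, rfl⟩ := hq
  exact (continuous_ev p).continuousOn.congr (Set.eqOn_indicator)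

theorem eq_zero_of_mem_facetPoly {d k : ℕ} {F : Finset (E d)} {q : E d → ℝ}
    (hq : q ∈ facetPoly k F) (h : ∀ x ∈ hull F, q x = 0) : q = 0 := by
  obtain ⟨p, -, rfl⟩ := hq
  funext x
  by_cases hx : x ∈ hull F
  · exact h x hx
  · exact Set.indicator_of_notMem hx _

theorem mem_cellSpace {d : ℕ} {cells : Finset (Finset (E d))} {m : ℕ} {q : CellFun d} :
    q ∈ cellSpace cells m ↔ (∀ K, (q K).totalDegree ≤ m) ∧ ∀ K ∉ cells, q K = 0 := by
  classical
  simp only [cellSpace, Submodule.mem_pi, Set.mem_univ, forall_true_left]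
  refine ⟨fun h => ⟨fun K => ?_, fun K hK => ?_⟩, fun h K => ?_⟩
  · have := h K
    split_ifs at this with hK
    · exact (MvPolynomial.mem_restrictTotalDegree _ _ _).1 this
    · rw [(Submodule.mem_bot ℝ).1 this]; simp
  · have := h K
    rw [if_neg hK] at this
    exact (Submodule.mem_bot ℝ).1 this
  · split_ifs with hK
    · exact (MvPolynomial.mem_restrictTotalDegree _ _ _).2 (h.1 K)
    · exact (Submodule.mem_bot ℝ).2 (h.2 K hK)

theorem mem_cellVecSpace {d : ℕ} {cells : Finset (Finset (E d))} {m : ℕ} {v : CellVec d} :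
    v ∈ cellVecSpace cells m ↔ (∀ K i, (v K i).totalDegree ≤ m) ∧ ∀ K ∉ cells, v K = 0 := by
  classical
  simp only [cellVecSpace, Submodule.mem_pi, Set.mem_univ, forall_true_left]
  refine ⟨fun h => ⟨fun K i => ?_, fun K hK => funext fun i => ?_⟩, fun h K i => ?_⟩
  · have := h K i
    split_ifs at this with hK
    · exact (MvPolynomial.mem_restrictTotalDegree _ _ _).1 this
    · rw [(Submodule.mem_bot ℝ).1 this]; simp
  · have := h K i
    rw [if_neg hK] at this
    exact (Submodule.mem_bot ℝ).1 this
  · split_ifs with hK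
    · exact (MvPolynomial.mem_restrictTotalDegree _ _ _).2 (h.1 K i)
    · exact (Submodule.mem_bot ℝ).2 (by rw [h.2 K hK]; rfl)

open scoped Classical in
theorem mem_facetSpace {d : ℕ} {T : Triangulation d} {k : ℕ} {Z : Finset (Finset (E d))}
    {q : FacetFun d} : q ∈ facetSpace T k Z ↔
      (∀ F, q F ∈ facetPoly k F) ∧ ∀ F, F ∉ T.facets \ Z → q F = 0 := by
  simp only [facetSpace, Submodule.mem_pi, Set.mem_univ, forall_true_left]
  refine ⟨fun h => ⟨fun F => ?_, fun F hF => ?_⟩, fun h F => ?_⟩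
  · have := h F
    split_ifs at this with hF
    · exact this
    · rw [(Submodule.mem_bot ℝ).1 this]; exact Submodule.zero_mem _
  · have := h F
    rw [if_neg hF] at this
    exact (Submodule.mem_bot ℝ).1 this
  · split_ifs with hF
    · exact h.1 F
    · exact (Submodule.mem_bot ℝ).2 (h.2 F hF)

open scoped Classical in
theorem mem_facetVecSpace {d : ℕ} {T : Triangulation d} {k : ℕ} {Z : Finset (Finset (E d))}
    {v : FacetVec d} : v ∈ facetVecSpace T k Z ↔
      (∀ F i, v F i ∈ facetPoly k F) ∧ ∀ F, F ∉ T.facets \ Z → v F = 0 := by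
  simp only [facetVecSpace, Submodule.mem_pi, Set.mem_univ, forall_true_left]
  refine ⟨fun h => ⟨fun F i => ?_, fun F hF => funext fun i => ?_⟩, fun h F i => ?_⟩
  · have := h F i
    split_ifs at this with hF
    · exact this
    · rw [(Submodule.mem_bot ℝ).1 this]; exact Submodule.zero_mem _
  · have := h F i
    rw [if_neg hF] at this
    exact (Submodule.mem_bot ℝ).1 this
  · split_ifs with hF
    · exact h.1 F i
    · exact (Submodule.mem_bot ℝ).2 (by rw [h.2 F hF]; rfl)

theorem Triangulation.mem_facets {d : ℕ} {T : Triangulation d} {F : Finset (E d)} :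
    F ∈ T.facets ↔ ∃ K ∈ T.cells, F ∈ facetsOf K := by
  simp [Triangulation.facets]

/-! ### Coercivity of the viscous form -/

/-- An entry of the strain as a polynomial. -/
noncomputable def strainPoly {d : ℕ} (v : Fin d → Poly d) (i j : Fin d) : Poly d :=
  MvPolynomial.C (1 / 2) * (MvPolynomial.pderiv j (v i) + MvPolynomial.pderiv i (v j))

theorem ev_strainPoly {d : ℕ} (v : Fin d → Poly d) (i j : Fin d) (x : E d) :
    ev (strainPoly v i j) x = strain v x i j := by
  simp [strainPoly, strain]; ring

theorem continuous_strain {d : ℕ} (v : Fin d → Poly d) (i j : Fin d) :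
    Continuous fun x => strain v x i j := by
  simp only [← ev_strainPoly]
  exact continuous_ev _

theorem totalDegree_strainPoly_le {d k : ℕ} {v : Fin d → Poly d}
    (hv : ∀ i, (v i).totalDegree ≤ k) (i j : Fin d) : (strainPoly v i j).totalDegree ≤ k := by
  refine (totalDegree_C_mul_le _ _).trans ((MvPolynomial.totalDegree_add _ _).trans (max_le ?_ ?_))
  · exact (totalDegree_pderiv_le _ _).trans ((Nat.sub_le _ _).trans (hv i))
  · exact (totalDegree_pderiv_le _ _).trans ((Nat.sub_le _ _).trans (hv j))

theorem IsSimplex.diam_pos {d : ℕ} (hd : 0 < d) {K : Finset (E d)} (h : IsSimplex K) :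
    0 < diam K := by
  obtain ⟨a, ha, b, hb, hab⟩ := Finset.one_lt_card.1 (by rw [h.1]; omega : 1 < K.card)
  exact (dist_pos.2 hab).trans_le
    (Metric.dist_le_diam_of_mem (isCompact_hull K).isBounded (subset_hull ha) (subset_hull hb))

open scoped Classical in
-- Moving from the centre of the ball by ρ along the normal stays in the simplex and lowers the
-- coordinate of `a` by ρ divided by the height. That coordinate stays between 0 and 1.
theorem IsSimplex.radius_le_height {d : ℕ} (hd : 0 < d) {K : Finset (E d)} (h : IsSimplex K)
    {a : E d} (ha : a ∈ K) {c : E d} {ρ : ℝ} (hρ : 0 < ρ) (hball : Metric.closedBall c ρ ⊆ hull K) :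
    ρ ≤ height K (K.erase a) := by
  have hH := h.height_pos hd ha
  set n := outwardNormal K (K.erase a) with hn'
  have hn : ‖n‖ = 1 := norm_outwardNormal hH.ne'
  have h1 : c + ρ • n ∈ hull K := hball (by simp [norm_smul, hn, abs_of_pos hρ])
  have h2 : c ∈ hull K := hball (Metric.mem_closedBall_self hρ.le)
  have e1 := h.inner_normal hd ha (c + ρ • n)
  have e2 := h.inner_normal hd ha c
  have e3 : c + ρ • n - a = (c - a) + ρ • n := by abel
  rw [e3, inner_add_left, real_inner_smul_left, e2, ← hn', real_inner_self_eq_norm_sq, hn] at e1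
  have p1 := h.mem_hull.1 h1 a ha
  have p2 : coord K a c ≤ 1 := by
    rw [← h.sum_coord c]
    exact Finset.single_le_sum (f := fun b => coord K b c) (h.mem_hull.1 h2) ha
  nlinarith

/-- Cauchy-Schwarz in each row, with a unit normal, bounds |ε(v)n|² by |ε(v)|²; Young's inequality
with weight δ does the rest. -/
theorem two_mul_strainNormal_le {d : ℕ} {v : CellVec d} {K F : Finset (E d)}
    (hn : ‖outwardNormal K F‖ = 1) (x : E d) (J : Fin d → ℝ) {δ : ℝ} (hδ : 0 < δ) :
    2 * (strainNormal v K F x ⬝ᵥ J) ≤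
      δ * (∑ i, ∑ j, strain (v K) x i j ^ 2) + δ⁻¹ * (J ⬝ᵥ J) := by
  have hn2 : ∑ j, outwardNormal K F j ^ 2 = 1 := by
    have := EuclideanSpace.norm_sq_eq (outwardNormal K F)
    rw [hn] at this
    simpa using this.symm
  rw [dotProduct, dotProduct, Finset.mul_sum, Finset.mul_sum, Finset.mul_sum,
    ← Finset.sum_add_distrib]
  refine Finset.sum_le_sum fun i _ => ?_
  have h1 : strainNormal v K F x i ^ 2 ≤ ∑ j, strain (v K) x i j ^ 2 := by
    have := Finset.sum_mul_sq_le_sq_mul_sq Finset.univ (fun j => strain (v K) x i j)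
      (fun j => outwardNormal K F j)
    rwa [hn2, mul_one] at this
  set s := strainNormal v K F x i
  have h2 : 0 ≤ δ⁻¹ * (δ * s - J i) ^ 2 := by positivity
  have h3 : δ⁻¹ * (δ * s - J i) ^ 2 = δ * s ^ 2 - 2 * (s * J i) + δ⁻¹ * (J i * J i) := by
    field_simp; ring
  nlinarith [mul_le_mul_of_nonneg_left h1 hδ.le]

theorem continuousOn_jump {d : ℕ} (v : CellVec d) {vbar : FacetVec d} {F : Finset (E d)}
    (hv : ∀ i, ContinuousOn (vbar F i) (hull F)) (K : Finset (E d)) (i : Fin d) :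
    ContinuousOn (fun x => jump v vbar K F x i) (hull F) :=
  (continuous_ev _).continuousOn.sub (hv i)

theorem continuous_strainNormal {d : ℕ} (v : CellVec d) (K F : Finset (E d)) (i : Fin d) :
    Continuous fun x => strainNormal v K F x i := by
  have := fun j => continuous_strain (v K) i j
  simp only [strainNormal]
  fun_prop

open scoped Classical in
/-- Coercivity of the viscous form, for a penalty parameter that is large enough. -/
theorem exists_coercive {d : ℕ} (hd : 0 < d) (k : ℕ) (σ : ℝ) : ∃ β₀ : ℝ, 0 < β₀ ∧
    ∀ T : Triangulation d, T.ShapeRegular σ → ∀ μ β : ℝ, 0 < μ → β₀ ≤ β →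
    ∀ (u : CellVec d) (ubar : FacetVec d), (∀ K i, (u K i).totalDegree ≤ k) →
    (∀ F i, ContinuousOn (ubar F i) (hull F)) →
    ∑ K ∈ T.cells, (μ * cellInt K (fun x => ∑ i, ∑ j, strain (u K) x i j ^ 2) +
      2 * μ * (diam K)⁻¹ * bdryInt K (fun F x => jump u ubar K F x ⬝ᵥ jump u ubar K F x)) ≤
        aj T μ β u ubar u ubar := by
  obtain ⟨C, hC, htr⟩ := exists_facetInt_sq_le hd k
  -- The factors count the facets of a cell, the trace constant and the ratio of diameter to height.
  -- The form |σ| + 1 keeps `G` positive for every real σ.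
  set G : ℝ := (d + 1) * C * (|σ| + 1) with hG'
  have hG : 0 < G := by positivity
  refine ⟨2 * G + 1, by positivity, fun T hT μ β hμ hβ u ubar hu hub => ?_⟩
  refine Finset.sum_le_sum fun K hK => ?_
  have h := T.isSimplex hK
  have hh := h.diam_pos hd
  set hK' := diam K
  have hstr := fun i j => continuous_strain (u K) i j
  have hjmp := fun F i => continuousOn_jump u (hub F) K i
  have hsn := fun F i => continuous_strainNormal u K F i
  set S := cellInt K (fun x => ∑ i, ∑ j, strain (u K) x i j ^ 2) with hS
  have hS0 : 0 ≤ S := setIntegral_nonneg (isCompact_hull K).measurableSet fun x _ =>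
    Finset.sum_nonneg fun i _ => Finset.sum_nonneg fun j _ => sq_nonneg _
  set N : E d → ℝ := fun a => facetInt (K.erase a)
    (fun x => jump u ubar K (K.erase a) x ⬝ᵥ jump u ubar K (K.erase a) x) with hN
  set X : E d → ℝ := fun a => facetInt (K.erase a)
    (fun x => strainNormal u K (K.erase a) x ⬝ᵥ jump u ubar K (K.erase a) x) with hX
  have hN0 : ∀ a, 0 ≤ N a := fun a => setIntegral_nonneg (isCompact_hull _).measurableSet fun x _ =>
    Finset.sum_nonneg fun i _ => mul_self_nonneg _
  have hi1 : ∀ a, ContinuousOn (fun x => jump u ubar K (K.erase a) x ⬝ᵥ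
      jump u ubar K (K.erase a) x) (hull (K.erase a)) := fun a =>
    continuousOn_finsetSum _ fun i _ => (hjmp _ i).mul (hjmp _ i)
  have hi2 : ∀ a, ContinuousOn (fun x => strainNormal u K (K.erase a) x ⬝ᵥ
      jump u ubar K (K.erase a) x) (hull (K.erase a)) := fun a =>
    continuousOn_finsetSum _ fun i _ => (hsn _ i).continuousOn.mul (hjmp _ i)
  have e1 : cellInt K (fun x => 2 * μ * ∑ i, ∑ j, strain (u K) x i j * strain (u K) x i j) =
      2 * μ * S := by
    rw [hS, cellInt, cellInt, ← integral_const_mul]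
    congr 1; funext x; congr 1
    exact Finset.sum_congr rfl fun i _ => Finset.sum_congr rfl fun j _ => (sq _).symm
  have e2 : bdryInt K (fun F x => 2 * β * μ * hK'⁻¹ * (jump u ubar K F x ⬝ᵥ jump u ubar K F x)) =
      2 * β * μ * hK'⁻¹ * ∑ a ∈ K, N a := by
    rw [bdryInt, sum_facetsOf h.1, Finset.mul_sum]
    exact Finset.sum_congr rfl fun a _ => integral_const_mul _ _
  have e3 : bdryInt K (fun F x => 2 * μ * (strainNormal u K F x ⬝ᵥ jump u ubar K F x)) =
      2 * μ * ∑ a ∈ K, X a := by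
    rw [bdryInt, sum_facetsOf h.1, Finset.mul_sum]
    exact Finset.sum_congr rfl fun a _ => integral_const_mul _ _
  have e4 : bdryInt K (fun F x => jump u ubar K F x ⬝ᵥ jump u ubar K F x) = ∑ a ∈ K, N a := by
    rw [bdryInt, sum_facetsOf h.1]
  rw [e1, e2, e3, e4]
  obtain ⟨c, ρ, hρ, hball, hdiam⟩ := hT K hK
  have htrace : ∀ a ∈ K, facetInt (K.erase a) (fun x => ∑ i, ∑ j, strain (u K) x i j ^ 2) ≤
      C * (|σ| + 1) * hK'⁻¹ * S := by
    intro a ha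
    have hH := h.height_pos hd ha
    have hle : hK' ≤ (|σ| + 1) * height K (K.erase a) := by
      have h1 := h.radius_le_height hd ha hρ hball
      have h2 : σ * ρ ≤ (|σ| + 1) * ρ :=
        mul_le_mul_of_nonneg_right (by linarith [le_abs_self σ]) hρ.le
      have h3 : (|σ| + 1) * ρ ≤ (|σ| + 1) * height K (K.erase a) :=
        mul_le_mul_of_nonneg_left h1 (by positivity)
      exact hdiam.trans (h2.trans h3)
    have hs1 : facetInt (K.erase a) (fun x => ∑ i, ∑ j, strain (u K) x i j ^ 2) =
        ∑ i, ∑ j, facetInt (K.erase a) (fun x => strain (u K) x i j ^ 2) := by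
      simp only [facetInt]
      rw [integral_finsetSum _ fun i _ => h.integrableOn_facet hd ha (by fun_prop)]
      refine Finset.sum_congr rfl fun i _ => ?_
      rw [integral_finsetSum _ fun j _ => h.integrableOn_facet hd ha (by fun_prop)]
    have hs2 : S = ∑ i, ∑ j, cellInt K (fun x => strain (u K) x i j ^ 2) := by
      rw [hS]
      simp only [cellInt]
      rw [integral_finsetSum _ fun i _ => integrableOn_hull K (by fun_prop)]
      refine Finset.sum_congr rfl fun i _ => ?_
      rw [integral_finsetSum _ fun j _ => integrableOn_hull K (by fun_prop)]
    have hs3 : height K (K.erase a) *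
        facetInt (K.erase a) (fun x => ∑ i, ∑ j, strain (u K) x i j ^ 2) ≤ C * S := by
      rw [hs1, hs2, Finset.mul_sum, Finset.mul_sum]
      refine Finset.sum_le_sum fun i _ => ?_
      rw [Finset.mul_sum, Finset.mul_sum]
      refine Finset.sum_le_sum fun j _ => ?_
      have := htr K h a ha (strainPoly (u K) i j) (totalDegree_strainPoly_le (hu K) i j)
      simpa only [ev_strainPoly] using this
    set Y := facetInt (K.erase a) (fun x => ∑ i, ∑ j, strain (u K) x i j ^ 2)
    have hY : 0 ≤ Y := setIntegral_nonneg (isCompact_hull _).measurableSet fun x _ =>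
      Finset.sum_nonneg fun i _ => Finset.sum_nonneg fun j _ => sq_nonneg _
    have h4 : hK' * Y ≤ C * (|σ| + 1) * S := by
      calc hK' * Y ≤ (|σ| + 1) * height K (K.erase a) * Y := mul_le_mul_of_nonneg_right hle hY
        _ = (|σ| + 1) * (height K (K.erase a) * Y) := by ring
        _ ≤ (|σ| + 1) * (C * S) := mul_le_mul_of_nonneg_left hs3 (by positivity)
        _ = C * (|σ| + 1) * S := by ring
    have h5 : Y = hK'⁻¹ * (hK' * Y) := by field_simp
    rw [h5]
    calc hK'⁻¹ * (hK' * Y) ≤ hK'⁻¹ * (C * (|σ| + 1) * S) :=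
          mul_le_mul_of_nonneg_left h4 (inv_pos.2 hh).le
      _ = _ := by ring
  -- Chosen so that the strain contributions of all d + 1 facets add up to at most half of `S`; the
  -- jumps then carry the factor 2G/h_K.
  set δ : ℝ := hK' / (2 * G) with hδ'
  have hδ : 0 < δ := by positivity
  have hXle : ∀ a ∈ K, 2 * X a ≤ δ * (C * (|σ| + 1) * hK'⁻¹ * S) + δ⁻¹ * N a := by
    intro a ha
    have hn := norm_outwardNormal (h.height_pos hd ha).ne'
    have h1 : 2 * X a ≤ δ * facetInt (K.erase a) (fun x => ∑ i, ∑ j, strain (u K) x i j ^ 2) +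
        δ⁻¹ * N a := by
      rw [hX, hN]
      simp only [facetInt]
      rw [← integral_const_mul, ← integral_const_mul, ← integral_const_mul, ← integral_add]
      · refine setIntegral_mono_on ?_ ?_ (isCompact_hull _).measurableSet fun x _ =>
          two_mul_strainNormal_le hn x _ hδ
        · exact h.integrableOn_facet hd ha (continuousOn_const.mul (hi2 a))
        · exact h.integrableOn_facet hd ha
            ((Continuous.continuousOn (by fun_prop)).add (continuousOn_const.mul (hi1 a)))
      · exact h.integrableOn_facet hd ha (by fun_prop)
      · exact h.integrableOn_facet hd ha (continuousOn_const.mul (hi1 a))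
    have h2 := mul_le_mul_of_nonneg_left (htrace a ha) hδ.le
    linarith
  have hsum : 2 * ∑ a ∈ K, X a ≤ S / 2 + 2 * G * hK'⁻¹ * ∑ a ∈ K, N a := by
    rw [Finset.mul_sum]
    refine (Finset.sum_le_sum hXle).trans ?_
    rw [Finset.sum_add_distrib, Finset.sum_const, ← Finset.mul_sum, h.1, nsmul_eq_mul]
    have h1 : ((d + 1 : ℕ) : ℝ) * (δ * (C * (|σ| + 1) * hK'⁻¹ * S)) = S / 2 := by
      have : ((d + 1 : ℕ) : ℝ) * (δ * (C * (|σ| + 1) * hK'⁻¹ * S)) = G * δ * hK'⁻¹ * S := by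
        rw [hG']; push_cast; ring
      rw [this, hδ']
      field_simp
    have h2 : δ⁻¹ = 2 * G * hK'⁻¹ := by rw [hδ']; field_simp
    rw [h1, h2]
  have hNs : 0 ≤ hK'⁻¹ * ∑ a ∈ K, N a :=
    mul_nonneg (inv_pos.2 hh).le (Finset.sum_nonneg fun a _ => hN0 a)
  have hfin : 0 ≤ μ * (2 * (β - (2 * G + 1))) * (hK'⁻¹ * ∑ a ∈ K, N a) :=
    mul_nonneg (mul_nonneg hμ.le (by linarith)) hNs
  -- On the diagonal both consistency terms coincide. They cost μS out of 2μS, and 4Gμ/h_K times the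
  -- jumps out of 2βμ/h_K; β ≥ 2G + 1 leaves at least 2μ/h_K.
  nlinarith [mul_le_mul_of_nonneg_left hsum hμ.le]

/-- The energy vanishes only for zero: Korn's inequality in a qualitative form. -/
theorem eq_zero_of_energy_le_zero {d : ℕ} (hd : 0 < d) {k : ℕ} {T : Triangulation d}
    (hT : IsConnected T.domain) {Z : Finset (Finset (E d))} (hZ : Z ⊆ T.facets) (hZne : Z.Nonempty)
    {μ : ℝ} (hμ : 0 < μ) {u : CellVec d} {ubar : FacetVec d} (hub : ubar ∈ facetVecSpace T k Z)
    (hE : ∑ K ∈ T.cells, (μ * cellInt K (fun x => ∑ i, ∑ j, strain (u K) x i j ^ 2) +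
      2 * μ * (diam K)⁻¹ * bdryInt K (fun F x => jump u ubar K F x ⬝ᵥ jump u ubar K F x)) ≤ 0) :
    (∀ K ∈ T.cells, u K = 0) ∧ ubar = 0 := by
  classical
  have hub' := mem_facetVecSpace.1 hub
  have hjmp := fun K F i => continuousOn_jump u (fun i => continuousOn_of_mem_facetPoly (hub'.1 F i)) K i
  have hcN : ∀ K ∈ T.cells, 0 ≤ cellInt K (fun x => ∑ i, ∑ j, strain (u K) x i j ^ 2) := fun K _ =>
    setIntegral_nonneg (isCompact_hull K).measurableSet fun x _ =>
      Finset.sum_nonneg fun i _ => Finset.sum_nonneg fun j _ => sq_nonneg _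
  have hfN : ∀ K F, 0 ≤ facetInt F (fun x => jump u ubar K F x ⬝ᵥ jump u ubar K F x) :=
    fun K F => setIntegral_nonneg (isCompact_hull F).measurableSet fun x _ =>
      Finset.sum_nonneg fun i _ => mul_self_nonneg _
  have hbN : ∀ K, 0 ≤ bdryInt K (fun F x => jump u ubar K F x ⬝ᵥ jump u ubar K F x) :=
    fun K => Finset.sum_nonneg fun F _ => hfN K F
  have ht : ∀ K ∈ T.cells, 0 ≤ μ * cellInt K (fun x => ∑ i, ∑ j, strain (u K) x i j ^ 2) +
      2 * μ * (diam K)⁻¹ * bdryInt K (fun F x => jump u ubar K F x ⬝ᵥ jump u ubar K F x) :=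
    fun K hK => add_nonneg (mul_nonneg hμ.le (hcN K hK)) (mul_nonneg
      (mul_nonneg (by linarith) (inv_nonneg.2 Metric.diam_nonneg)) (hbN K))
  have hz := (Finset.sum_eq_zero_iff_of_nonneg ht).1 (le_antisymm hE (Finset.sum_nonneg ht))
  have hstrain : ∀ K ∈ T.cells, ∀ x i j, strain (u K) x i j = 0 := by
    intro K hK
    have h := T.isSimplex hK
    have h1 : cellInt K (fun x => ∑ i, ∑ j, strain (u K) x i j ^ 2) = 0 := by
      have h2 := hz K hK
      have h3 := mul_nonneg (mul_nonneg (by linarith : (0 : ℝ) ≤ 2 * μ)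
        (inv_nonneg.2 (Metric.diam_nonneg (s := hull K)))) (hbN K)
      have h4 := mul_nonneg hμ.le (hcN K hK)
      have h5 : μ * cellInt K (fun x => ∑ i, ∑ j, strain (u K) x i j ^ 2) = 0 := by
        change 0 ≤ 2 * μ * (diam K)⁻¹ * _ at h3
        linarith
      exact (mul_eq_zero.1 h5).resolve_left hμ.ne'
    have hstr := fun i j => continuous_strain (u K) i j
    have h2 := h.eq_zero_of_cellInt (f := fun x => ∑ i, ∑ j, strain (u K) x i j ^ 2)
      (by fun_prop) (fun x _ =>
        Finset.sum_nonneg fun i _ => Finset.sum_nonneg fun j _ => sq_nonneg _) h1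
    have h3 : ∀ i j, strainPoly (u K) i j = 0 := fun i j =>
      eq_zero_of_ev_eq_zero (s := hull K) h.interior_nonempty fun x hx => by
        have h4 := (Finset.sum_eq_zero_iff_of_nonneg
          (fun i _ => Finset.sum_nonneg fun j _ => sq_nonneg _)).1 (h2 x hx) i (Finset.mem_univ i)
        have h5 := (Finset.sum_eq_zero_iff_of_nonneg (fun j _ => sq_nonneg _)).1 h4 j
          (Finset.mem_univ j)
        rw [ev_strainPoly]
        exact pow_eq_zero_iff (two_ne_zero) |>.1 h5
    intro x i j
    rw [← ev_strainPoly, h3, ev_zero]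
  have hjump : ∀ K ∈ T.cells, ∀ F ∈ facetsOf K, ∀ x ∈ hull F, ∀ i, ev (u K i) x = ubar F i x := by
    intro K hK F hF x hx i
    have h := T.isSimplex hK
    have hdiam := h.diam_pos hd
    have h1 : bdryInt K (fun F x => jump u ubar K F x ⬝ᵥ jump u ubar K F x) = 0 := by
      have h2 := hz K hK
      have h4 := mul_nonneg hμ.le (hcN K hK)
      have hpos : 0 < 2 * μ * (diam K)⁻¹ := by positivity
      have h3 := mul_nonneg hpos.le (hbN K)
      have h5 : 2 * μ * (diam K)⁻¹ *
        bdryInt K (fun F x => jump u ubar K F x ⬝ᵥ jump u ubar K F x) = 0 := by linarith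
      exact (mul_eq_zero.1 h5).resolve_left hpos.ne'
    have h2 := (Finset.sum_eq_zero_iff_of_nonneg (fun F _ => hfN K F)).1 h1 F hF
    obtain ⟨a, ha, rfl⟩ := (mem_facetsOf h.1).1 hF
    have h3 := h.eq_zero_of_facetInt hd ha
      (continuousOn_finsetSum _ fun i _ => (hjmp K _ i).mul (hjmp K _ i))
      (fun x _ => Finset.sum_nonneg fun i _ => mul_self_nonneg _) h2 x hx
    have h4 := (Finset.sum_eq_zero_iff_of_nonneg (fun i _ => mul_self_nonneg _)).1 h3 i
      (Finset.mem_univ i)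
    exact sub_eq_zero.1 (mul_self_eq_zero.1 h4)
  -- The transported quantity is the vector polynomial itself: the difference of the polynomials of
  -- two neighbours has zero strain, and it vanishes on the common facet, where both equal `ubar`.
  have hconst := T.eq_of_isConnected hT u fun K hK L hL F hFK hFL => by
    have h := T.isSimplex hK
    obtain ⟨a, ha, rfl⟩ := (mem_facetsOf h.1).1 hFK
    rw [← sub_eq_zero]
    refine h.eq_zero_of_strain_eq_zero ha (fun x i j => ?_) fun x hx i => ?_
    · have h1 := hstrain K hK x i j
      have h2 := hstrain L hL x i j
      simp only [strain, Pi.sub_apply, map_sub, ev_sub] at h1 h2 ⊢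
      linarith
    · rw [Pi.sub_apply, ev_sub, hjump K hK _ hFK x hx, hjump L hL _ hFL x hx, sub_self]
  obtain ⟨F, hF⟩ := hZne
  obtain ⟨K, hK, hFK⟩ := T.mem_facets.1 (hZ hF)
  have hK0 : u K = 0 := by
    have h := T.isSimplex hK
    have hF0 : ubar F = 0 := hub'.2 F (by simp [hF])
    have hj := hjump K hK F hFK
    obtain ⟨a, ha, rfl⟩ := (mem_facetsOf h.1).1 hFK
    exact h.eq_zero_of_strain_eq_zero ha (hstrain K hK) fun x hx i => by
      rw [hj x hx, hF0]; rfl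
  have hu0 : ∀ L ∈ T.cells, u L = 0 := fun L hL => (hconst L hL K hK).trans hK0
  refine ⟨hu0, funext fun F => ?_⟩
  by_cases hF : F ∈ T.facets
  · obtain ⟨L, hL, hFL⟩ := T.mem_facets.1 hF
    funext i
    refine eq_zero_of_mem_facetPoly (hub'.1 F i) fun x hx => ?_
    rw [← hjump L hL F hFL x hx, hu0 L hL]; simp
  · exact hub'.2 F (by simp [hF])

/-! ### Linearity of the forms -/

theorem cellInt_add {d : ℕ} (K : Finset (E d)) {φ ψ : E d → ℝ} (hφ : ContinuousOn φ (hull K))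
    (hψ : ContinuousOn ψ (hull K)) :
    cellInt K (fun x => φ x + ψ x) = cellInt K φ + cellInt K ψ :=
  integral_add (integrableOn_hull K hφ) (integrableOn_hull K hψ)

theorem cellInt_const_mul {d : ℕ} (K : Finset (E d)) (c : ℝ) (φ : E d → ℝ) :
    cellInt K (fun x => c * φ x) = c * cellInt K φ :=
  integral_const_mul _ _

theorem IsSimplex.facetInt_add {d : ℕ} (hd : 0 < d) {K F : Finset (E d)} (h : IsSimplex K)
    (hF : F ∈ facetsOf K) {φ ψ : E d → ℝ} (hφ : ContinuousOn φ (hull F))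
    (hψ : ContinuousOn ψ (hull F)) :
    facetInt F (fun x => φ x + ψ x) = facetInt F φ + facetInt F ψ := by
  classical
  obtain ⟨a, ha, rfl⟩ := (mem_facetsOf h.1).1 hF
  exact integral_add (h.integrableOn_facet hd ha hφ) (h.integrableOn_facet hd ha hψ)

theorem facetInt_const_mul {d : ℕ} (F : Finset (E d)) (c : ℝ) (φ : E d → ℝ) :
    facetInt F (fun x => c * φ x) = c * facetInt F φ :=
  integral_const_mul _ _

theorem IsSimplex.bdryInt_add {d : ℕ} (hd : 0 < d) {K : Finset (E d)} (h : IsSimplex K)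
    {φ ψ : Finset (E d) → E d → ℝ} (hφ : ∀ F, ContinuousOn (φ F) (hull F))
    (hψ : ∀ F, ContinuousOn (ψ F) (hull F)) :
    bdryInt K (fun F x => φ F x + ψ F x) = bdryInt K φ + bdryInt K ψ := by
  simp only [bdryInt]
  rw [← Finset.sum_add_distrib]
  exact Finset.sum_congr rfl fun F hF => h.facetInt_add hd hF (hφ F) (hψ F)

theorem bdryInt_const_mul {d : ℕ} (K : Finset (E d)) (c : ℝ) (φ : Finset (E d) → E d → ℝ) :
    bdryInt K (fun F x => c * φ F x) = c * bdryInt K φ := by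
  simp only [bdryInt, Finset.mul_sum]
  exact Finset.sum_congr rfl fun F _ => facetInt_const_mul F c _

theorem Mesh.interfaceInt_add {d : ℕ} (hd : 0 < d) (M : Mesh d)
    {φ ψ : (Fin d → ℝ) → Finset (E d) → E d → ℝ} (hφ : ∀ n F, ContinuousOn (φ n F) (hull F))
    (hψ : ∀ n F, ContinuousOn (ψ n F) (hull F)) :
    M.interfaceInt (fun n F x => φ n F x + ψ n F x) = M.interfaceInt φ + M.interfaceInt ψ := by
  classical
  simp only [Mesh.interfaceInt]
  rw [← Finset.sum_add_distrib]
  refine Finset.sum_congr rfl fun K hK => ?_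
  rw [← Finset.sum_add_distrib]
  exact Finset.sum_congr rfl fun F hF =>
    (M.Ts.isSimplex hK).facetInt_add hd (Finset.mem_filter.1 hF).1 (hφ _ F) (hψ _ F)

theorem Mesh.interfaceInt_const_mul {d : ℕ} (M : Mesh d) (c : ℝ)
    (φ : (Fin d → ℝ) → Finset (E d) → E d → ℝ) :
    M.interfaceInt (fun n F x => c * φ n F x) = c * M.interfaceInt φ := by
  classical
  simp only [Mesh.interfaceInt, Finset.mul_sum]
  exact Finset.sum_congr rfl fun K _ => Finset.sum_congr rfl fun F _ => facetInt_const_mul F c _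

/-- Facet functions that are continuous on each facet. -/
def facetCont (d : ℕ) : Submodule ℝ (FacetFun d) where
  carrier := {q | ∀ F, ContinuousOn (q F) (hull F)}
  zero_mem' := fun _ => continuousOn_const
  add_mem' := fun h h' F => (h F).add (h' F)
  smul_mem' := fun c _ h F => (h F).const_smul c

/-- Vector facet functions that are continuous on each facet. -/
def facetVecCont (d : ℕ) : Submodule ℝ (FacetVec d) where
  carrier := {v | ∀ F i, ContinuousOn (v F i) (hull F)}
  zero_mem' := fun _ _ => continuousOn_const
  add_mem' := fun h h' F i => (h F i).add (h' F i)
  smul_mem' := fun c _ h F i => (h F i).const_smul c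

theorem strain_add {d : ℕ} (v w : Fin d → Poly d) (x : E d) :
    strain (v + w) x = strain v x + strain w x := by
  ext i j; simp [strain]; ring

theorem strain_smul {d : ℕ} (c : ℝ) (v : Fin d → Poly d) (x : E d) :
    strain (c • v) x = c • strain v x := by
  ext i j; simp [strain]; ring

theorem jump_add {d : ℕ} (v w : CellVec d) (vbar wbar : FacetVec d) (K F : Finset (E d)) (x : E d) :
    jump (v + w) (vbar + wbar) K F x = jump v vbar K F x + jump w wbar K F x := by
  ext i; simp [jump]; ring

theorem jump_smul {d : ℕ} (c : ℝ) (v : CellVec d) (vbar : FacetVec d) (K F : Finset (E d))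
    (x : E d) : jump (c • v) (c • vbar) K F x = c • jump v vbar K F x := by
  ext i; simp [jump]; ring

theorem strainNormal_add {d : ℕ} (v w : CellVec d) (K F : Finset (E d)) (x : E d) :
    strainNormal (v + w) K F x = strainNormal v K F x + strainNormal w K F x := by
  ext i; simp [strainNormal, strain_add, add_mul, Finset.sum_add_distrib]

theorem strainNormal_smul {d : ℕ} (c : ℝ) (v : CellVec d) (K F : Finset (E d)) (x : E d) :
    strainNormal (c • v) K F x = c • strainNormal v K F x := by
  ext i; simp [strainNormal, strain_smul, Finset.mul_sum, mul_assoc]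

theorem divergence_add {d : ℕ} (v w : Fin d → Poly d) (x : E d) :
    divergence (v + w) x = divergence v x + divergence w x := by
  simp [divergence, Finset.sum_add_distrib]

theorem divergence_smul {d : ℕ} (c : ℝ) (v : Fin d → Poly d) (x : E d) :
    divergence (c • v) x = c * divergence v x := by
  simp [divergence, Finset.mul_sum]

theorem continuous_divergence {d : ℕ} (v : Fin d → Poly d) : Continuous (divergence v) :=
  continuous_finsetSum _ fun _ _ => continuous_ev _

/-- The two consistency terms exchange their roles. Linearity in the second argument then follows
from linearity in the first. -/
theorem aj_symm {d : ℕ} (T : Triangulation d) (μ β : ℝ) (u : CellVec d) (ubar : FacetVec d)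
    (v : CellVec d) (vbar : FacetVec d) : aj T μ β u ubar v vbar = aj T μ β v vbar u ubar := by
  refine Finset.sum_congr rfl fun K _ => ?_
  have e1 : (fun x => 2 * μ * ∑ i, ∑ j, strain (u K) x i j * strain (v K) x i j) =
      fun x => 2 * μ * ∑ i, ∑ j, strain (v K) x i j * strain (u K) x i j := by
    simp only [mul_comm]
  have e2 : ∀ F x, jump u ubar K F x ⬝ᵥ jump v vbar K F x =
      jump v vbar K F x ⬝ᵥ jump u ubar K F x := fun F x => dotProduct_comm _ _
  rw [e1]
  simp only [e2]
  ring

/-- Additivity of the integrals needs integrability, hence the restriction to facet functions that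
are continuous on each closed facet. -/
theorem aj_add_left {d : ℕ} (hd : 0 < d) (T : Triangulation d) (μ β : ℝ) (u u' v : CellVec d)
    {ubar ubar' vbar : FacetVec d} (hu : ubar ∈ facetVecCont d) (hu' : ubar' ∈ facetVecCont d)
    (hv : vbar ∈ facetVecCont d) :
    aj T μ β (u + u') (ubar + ubar') v vbar =
      aj T μ β u ubar v vbar + aj T μ β u' ubar' v vbar := by
  simp only [aj]
  rw [← Finset.sum_add_distrib]
  refine Finset.sum_congr rfl fun K hK => ?_
  have h := T.isSimplex hK
  have hs := fun (w : CellVec d) i j => continuous_strain (w K) i j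
  have hn := fun (w : CellVec d) F i => (continuous_strainNormal w K F i).continuousOn (s := hull F)
  have hj := fun (w : CellVec d) (wbar : FacetVec d) (hw : wbar ∈ facetVecCont d) F i =>
    continuousOn_jump w (hw F) K i
  have hjj : ∀ (w : CellVec d) (wbar : FacetVec d), wbar ∈ facetVecCont d → ∀ F c,
      ContinuousOn (fun x => c * (jump w wbar K F x ⬝ᵥ jump v vbar K F x)) (hull F) :=
    fun w wbar hw F c => continuousOn_const.mul
      (continuousOn_finsetSum _ fun i _ => (hj w wbar hw F i).mul (hj v vbar hv F i))
  have hnj : ∀ (w y : CellVec d) (wbar : FacetVec d), wbar ∈ facetVecCont d → ∀ F c,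
      ContinuousOn (fun x => c * (strainNormal y K F x ⬝ᵥ jump w wbar K F x)) (hull F) :=
    fun w y wbar hw F c => continuousOn_const.mul
      (continuousOn_finsetSum _ fun i _ => (hn y F i).mul (hj w wbar hw F i))
  have hss : ∀ w y : CellVec d, Continuous fun x =>
      2 * μ * ∑ i, ∑ j, strain (w K) x i j * strain (y K) x i j := fun w y =>
    continuous_const.mul (continuous_finsetSum _ fun i _ => continuous_finsetSum _ fun j _ =>
      (hs w i j).mul (hs y i j))
  have e1 : cellInt K (fun x => 2 * μ * ∑ i, ∑ j, strain ((u + u') K) x i j * strain (v K) x i j) =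
      cellInt K (fun x => 2 * μ * ∑ i, ∑ j, strain (u K) x i j * strain (v K) x i j) +
        cellInt K (fun x => 2 * μ * ∑ i, ∑ j, strain (u' K) x i j * strain (v K) x i j) := by
    rw [← cellInt_add K (hss u v).continuousOn (hss u' v).continuousOn]
    congr 1; funext x
    simp only [Pi.add_apply, strain_add, Matrix.add_apply, add_mul, Finset.sum_add_distrib, mul_add]
  have e2 := h.bdryInt_add hd
    (φ := fun F x => 2 * β * μ * (diam K)⁻¹ * (jump u ubar K F x ⬝ᵥ jump v vbar K F x))
    (ψ := fun F x => 2 * β * μ * (diam K)⁻¹ * (jump u' ubar' K F x ⬝ᵥ jump v vbar K F x))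
    (fun F => hjj u ubar hu F _) (fun F => hjj u' ubar' hu' F _)
  have e3 := h.bdryInt_add hd
    (φ := fun F x => 2 * μ * (strainNormal u K F x ⬝ᵥ jump v vbar K F x))
    (ψ := fun F x => 2 * μ * (strainNormal u' K F x ⬝ᵥ jump v vbar K F x))
    (fun F => hnj v u vbar hv F _) (fun F => hnj v u' vbar hv F _)
  have e4 := h.bdryInt_add hd
    (φ := fun F x => 2 * μ * (strainNormal v K F x ⬝ᵥ jump u ubar K F x))
    (ψ := fun F x => 2 * μ * (strainNormal v K F x ⬝ᵥ jump u' ubar' K F x))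
    (fun F => hnj u v ubar hu F _) (fun F => hnj u' v ubar' hu' F _)
  simp only [jump_add, strainNormal_add, add_dotProduct, dotProduct_add, mul_add _ (_ ⬝ᵥ _)]
  rw [e1, e2, e3, e4]
  ring

theorem aj_smul_left {d : ℕ} (T : Triangulation d) (μ β c : ℝ) (u v : CellVec d)
    (ubar vbar : FacetVec d) :
    aj T μ β (c • u) (c • ubar) v vbar = c * aj T μ β u ubar v vbar := by
  simp only [aj, Finset.mul_sum (s := T.cells)]
  refine Finset.sum_congr rfl fun K hK => ?_
  have e1 : cellInt K (fun x => 2 * μ * ∑ i, ∑ j, strain ((c • u) K) x i j * strain (v K) x i j) =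
      c * cellInt K (fun x => 2 * μ * ∑ i, ∑ j, strain (u K) x i j * strain (v K) x i j) := by
    rw [← cellInt_const_mul]
    congr 1; funext x
    simp only [Pi.smul_apply, strain_smul, Matrix.smul_apply, smul_eq_mul, mul_assoc c,
      ← Finset.mul_sum]
    ring
  rw [e1]
  simp only [jump_smul, strainNormal_smul, smul_dotProduct, dotProduct_smul, smul_eq_mul,
    mul_left_comm _ c, bdryInt_const_mul K c]
  ring

theorem bj_add_left {d : ℕ} (hd : 0 < d) (T : Triangulation d) (q q' : CellFun d) (v : CellVec d)
    {qbar qbar' : FacetFun d} {vbar : FacetVec d} (hq : qbar ∈ facetCont d)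
    (hq' : qbar' ∈ facetCont d) (hv : vbar ∈ facetVecCont d) :
    bj T (q + q') (qbar + qbar') v vbar = bj T q qbar v vbar + bj T q' qbar' v vbar := by
  simp only [bj]
  rw [← Finset.sum_add_distrib]
  refine Finset.sum_congr rfl fun K hK => ?_
  have h := T.isSimplex hK
  have hj := fun F => continuousOn_finsetSum Finset.univ fun i _ =>
    (continuousOn_jump v (hv F) K i).mul (continuousOn_const (c := outwardNormal K F i))
  have hdc := continuous_divergence (v K)
  simp only [Pi.add_apply, ev_add, add_mul]
  rw [cellInt_add, h.bdryInt_add hd]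
  · ring
  · exact fun F => (hq F).mul (hj F)
  · exact fun F => (hq' F).mul (hj F)
  · exact ((continuous_ev _).mul hdc).continuousOn
  · exact ((continuous_ev _).mul hdc).continuousOn

theorem bj_smul_left {d : ℕ} (T : Triangulation d) (c : ℝ) (q : CellFun d) (qbar : FacetFun d)
    (v : CellVec d) (vbar : FacetVec d) :
    bj T (c • q) (c • qbar) v vbar = c * bj T q qbar v vbar := by
  simp only [bj, Finset.mul_sum]
  refine Finset.sum_congr rfl fun K hK => ?_
  simp only [Pi.smul_apply, ev_smul, smul_eq_mul, mul_assoc, cellInt_const_mul, bdryInt_const_mul]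
  ring

theorem bj_add_right {d : ℕ} (hd : 0 < d) (T : Triangulation d) (q : CellFun d) (v v' : CellVec d)
    {qbar : FacetFun d} {vbar vbar' : FacetVec d} (hq : qbar ∈ facetCont d)
    (hv : vbar ∈ facetVecCont d) (hv' : vbar' ∈ facetVecCont d) :
    bj T q qbar (v + v') (vbar + vbar') = bj T q qbar v vbar + bj T q qbar v' vbar' := by
  simp only [bj]
  rw [← Finset.sum_add_distrib]
  refine Finset.sum_congr rfl fun K hK => ?_
  have h := T.isSimplex hK
  have hj := fun (w : CellVec d) (wbar : FacetVec d) (hw : wbar ∈ facetVecCont d) F =>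
    continuousOn_finsetSum Finset.univ fun i _ =>
    (continuousOn_jump w (hw F) K i).mul (continuousOn_const (c := outwardNormal K F i))
  simp only [Pi.add_apply, divergence_add, jump_add, add_dotProduct, mul_add]
  rw [cellInt_add, h.bdryInt_add hd]
  · ring
  · exact fun F => (hq F).mul (hj _ _ hv F)
  · exact fun F => (hq F).mul (hj _ _ hv' F)
  · exact ((continuous_ev _).mul (continuous_divergence _)).continuousOn
  · exact ((continuous_ev _).mul (continuous_divergence _)).continuousOn

theorem bj_smul_right {d : ℕ} (T : Triangulation d) (c : ℝ) (q : CellFun d) (qbar : FacetFun d)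
    (v : CellVec d) (vbar : FacetVec d) :
    bj T q qbar (c • v) (c • vbar) = c * bj T q qbar v vbar := by
  simp only [bj, Finset.mul_sum]
  refine Finset.sum_congr rfl fun K hK => ?_
  simp only [Pi.smul_apply, divergence_smul, jump_smul, smul_dotProduct, smul_eq_mul,
    mul_left_comm _ c, cellInt_const_mul, bdryInt_const_mul]
  ring

theorem l2_symm {d : ℕ} (cells : Finset (Finset (E d))) (p q : CellFun d) :
    l2 cells p q = l2 cells q p := by
  simp only [l2, mul_comm]

theorem l2_add_left {d : ℕ} (cells : Finset (Finset (E d))) (p p' q : CellFun d) :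
    l2 cells (p + p') q = l2 cells p q + l2 cells p' q := by
  simp only [l2]
  rw [← Finset.sum_add_distrib]
  refine Finset.sum_congr rfl fun K hK => ?_
  simp only [Pi.add_apply, ev_add, add_mul]
  exact cellInt_add K ((continuous_ev _).mul (continuous_ev _)).continuousOn
    ((continuous_ev _).mul (continuous_ev _)).continuousOn

theorem l2_smul_left {d : ℕ} (cells : Finset (Finset (E d))) (c : ℝ) (p q : CellFun d) :
    l2 cells (c • p) q = c * l2 cells p q := by
  simp only [l2, Finset.mul_sum, Pi.smul_apply, ev_smul, mul_assoc, cellInt_const_mul]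

theorem l2Vec_symm {d : ℕ} (cells : Finset (Finset (E d))) (p q : CellVec d) :
    l2Vec cells p q = l2Vec cells q p := by
  simp only [l2Vec, mul_comm]

theorem l2Vec_add_left {d : ℕ} (cells : Finset (Finset (E d))) (p p' q : CellVec d) :
    l2Vec cells (p + p') q = l2Vec cells p q + l2Vec cells p' q := by
  simp only [l2Vec]
  rw [← Finset.sum_add_distrib]
  refine Finset.sum_congr rfl fun K hK => ?_
  simp only [Pi.add_apply, ev_add, add_mul, Finset.sum_add_distrib]
  have hc : ∀ w w' : Fin d → Poly d, Continuous fun x => ∑ i, ev (w i) x * ev (w' i) x :=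
    fun w w' => continuous_finsetSum _ fun i _ => (continuous_ev _).mul (continuous_ev _)
  exact cellInt_add K (hc _ _).continuousOn (hc _ _).continuousOn

theorem l2Vec_smul_left {d : ℕ} (cells : Finset (Finset (E d))) (c : ℝ) (p q : CellVec d) :
    l2Vec cells (c • p) q = c * l2Vec cells p q := by
  simp only [l2Vec, Finset.mul_sum, Pi.smul_apply, ev_smul, mul_assoc]
  simp only [← Finset.mul_sum, cellInt_const_mul]

theorem tangential_add {d : ℕ} (n v w : Fin d → ℝ) :
    tangential n (v + w) = tangential n v + tangential n w := by
  simp only [tangential, add_dotProduct, add_smul]; abel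

theorem tangential_smul {d : ℕ} (n : Fin d → ℝ) (c : ℝ) (v : Fin d → ℝ) :
    tangential n (c • v) = c • tangential n v := by
  simp only [tangential, smul_dotProduct, smul_sub, smul_smul, smul_eq_mul]

theorem continuousOn_tangential {d : ℕ} (n : Fin d → ℝ) {us ub : FacetVec d}
    (hs : us ∈ facetVecCont d) (hb : ub ∈ facetVecCont d) (F : Finset (E d)) :
    ContinuousOn (fun x => tangential n (fun i => us F i x - ub F i x)) (hull F) := by
  have h : ContinuousOn (fun x i => us F i x - ub F i x) (hull F) :=
    continuousOn_pi.2 fun i => (hs F i).sub (hb F i)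
  have ht : Continuous (tangential n) := by
    unfold tangential dotProduct; fun_prop
  exact ht.comp_continuousOn h

theorem Mesh.aI_symm {d : ℕ} (M : Mesh d) (P : Params) (us ub vs vb : FacetVec d) :
    M.aI P us ub vs vb = M.aI P vs vb us ub := by
  simp only [Mesh.aI, dotProduct_comm]

theorem Mesh.aI_add_left {d : ℕ} (hd : 0 < d) (M : Mesh d) (P : Params)
    {us us' ub ub' vs vb : FacetVec d} (hs : us ∈ facetVecCont d) (hs' : us' ∈ facetVecCont d)
    (hb : ub ∈ facetVecCont d) (hb' : ub' ∈ facetVecCont d) (hvs : vs ∈ facetVecCont d)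
    (hvb : vb ∈ facetVecCont d) :
    M.aI P (us + us') (ub + ub') vs vb = M.aI P us ub vs vb + M.aI P us' ub' vs vb := by
  have e : ∀ n F x, tangential n (fun i => (us + us') F i x - (ub + ub') F i x) =
      tangential n (fun i => us F i x - ub F i x) +
        tangential n (fun i => us' F i x - ub' F i x) := fun n F x => by
    rw [← tangential_add]; congr 1; funext i; simp; ring
  simp only [Mesh.aI, e, add_dotProduct, mul_add]
  have hdot : ∀ {φ ψ : E d → Fin d → ℝ} {s : Set (E d)} (c : ℝ), ContinuousOn φ s →
      ContinuousOn ψ s → ContinuousOn (fun x => c * (φ x ⬝ᵥ ψ x)) s := fun c hφ hψ =>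
    continuousOn_const.mul (continuousOn_finsetSum _ fun i _ =>
      (continuousOn_pi.1 hφ i).mul (continuousOn_pi.1 hψ i))
  exact M.interfaceInt_add hd
    (fun n F => hdot _ (continuousOn_tangential n hs hb F) (continuousOn_tangential n hvs hvb F))
    (fun n F => hdot _ (continuousOn_tangential n hs' hb' F) (continuousOn_tangential n hvs hvb F))

theorem Mesh.aI_smul_left {d : ℕ} (M : Mesh d) (P : Params) (c : ℝ) (us ub vs vb : FacetVec d) :
    M.aI P (c • us) (c • ub) vs vb = c * M.aI P us ub vs vb := by
  have e : ∀ n F x, tangential n (fun i => (c • us) F i x - (c • ub) F i x) =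
      c • tangential n (fun i => us F i x - ub F i x) := fun n F x => by
    rw [← tangential_smul]; congr 1; funext i; simp; ring
  simp only [Mesh.aI, e, smul_dotProduct, smul_eq_mul, mul_left_comm _ c]
  exact M.interfaceInt_const_mul c _

theorem continuousOn_normal_jump {d : ℕ} (n : Fin d → ℝ) {q : FacetFun d} {vs vb : FacetVec d}
    (hq : q ∈ facetCont d) (hs : vs ∈ facetVecCont d) (hb : vb ∈ facetVecCont d)
    (F : Finset (E d)) :
    ContinuousOn (fun x => q F x * ((fun i => vs F i x - vb F i x) ⬝ᵥ n)) (hull F) :=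
  (hq F).mul (continuousOn_finsetSum _ fun i _ => ((hs F i).sub (hb F i)).mul continuousOn_const)

theorem Mesh.bI_add_left {d : ℕ} (hd : 0 < d) (M : Mesh d) {q q' : FacetFun d}
    {vs vb : FacetVec d} (hq : q ∈ facetCont d) (hq' : q' ∈ facetCont d)
    (hs : vs ∈ facetVecCont d) (hb : vb ∈ facetVecCont d) :
    M.bI (q + q') vs vb = M.bI q vs vb + M.bI q' vs vb := by
  simp only [Mesh.bI, Pi.add_apply, add_mul]
  exact M.interfaceInt_add hd (fun n F => continuousOn_normal_jump n hq hs hb F)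
    (fun n F => continuousOn_normal_jump n hq' hs hb F)

theorem Mesh.bI_smul_left {d : ℕ} (M : Mesh d) (c : ℝ) (q : FacetFun d) (vs vb : FacetVec d) :
    M.bI (c • q) vs vb = c * M.bI q vs vb := by
  simp only [Mesh.bI, Pi.smul_apply, smul_eq_mul, mul_assoc]
  exact M.interfaceInt_const_mul c _

theorem Mesh.bI_add_right {d : ℕ} (hd : 0 < d) (M : Mesh d) {q : FacetFun d}
    {vs vb vs' vb' : FacetVec d} (hq : q ∈ facetCont d)
    (hs : vs ∈ facetVecCont d) (hb : vb ∈ facetVecCont d)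
    (hs' : vs' ∈ facetVecCont d) (hb' : vb' ∈ facetVecCont d) :
    M.bI q (vs + vs') (vb + vb') = M.bI q vs vb + M.bI q vs' vb' := by
  have e : ∀ (n : Fin d → ℝ) F x, (fun i => (vs + vs') F i x - (vb + vb') F i x) ⬝ᵥ n =
      (fun i => vs F i x - vb F i x) ⬝ᵥ n + (fun i => vs' F i x - vb' F i x) ⬝ᵥ n := fun n F x => by
    rw [← add_dotProduct]; congr 1; funext i; simp; ring
  simp only [Mesh.bI, e, mul_add]
  exact M.interfaceInt_add hd (fun n F => continuousOn_normal_jump n hq hs hb F)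
    (fun n F => continuousOn_normal_jump n hq hs' hb' F)

theorem Mesh.bI_smul_right {d : ℕ} (M : Mesh d) (c : ℝ) (q : FacetFun d) (vs vb : FacetVec d) :
    M.bI q (c • vs) (c • vb) = c * M.bI q vs vb := by
  have e : ∀ (n : Fin d → ℝ) F x, (fun i => (c • vs) F i x - (c • vb) F i x) ⬝ᵥ n =
      c * ((fun i => vs F i x - vb F i x) ⬝ᵥ n) := fun n F x => by
    rw [← smul_eq_mul, ← smul_dotProduct]; congr 1; funext i; simp; ring
  simp only [Mesh.bI, e, mul_left_comm _ c]
  exact M.interfaceInt_const_mul c _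

/-! ### The forms as bilinear maps -/

/-- `a_h^j` as a bilinear map. -/
noncomputable def ajMap {d : ℕ} (hd : 0 < d) (T : Triangulation d) (μ β : ℝ) :
    (CellVec d × facetVecCont d) →ₗ[ℝ] (CellVec d × facetVecCont d) →ₗ[ℝ] ℝ :=
  LinearMap.mk₂ ℝ (fun u v => aj T μ β u.1 u.2 v.1 v.2)
    (fun u u' v => aj_add_left hd T μ β _ _ _ u.2.2 u'.2.2 v.2.2)
    (fun c u v => aj_smul_left T μ β c _ _ _ _)
    (fun u v v' => by
      rw [aj_symm, aj_symm T μ β u.1 _ v.1, aj_symm T μ β u.1 _ v'.1]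
      exact aj_add_left hd T μ β _ _ _ v.2.2 v'.2.2 u.2.2)
    (fun c u v => by
      rw [aj_symm, aj_symm T μ β u.1 _ v.1]
      exact aj_smul_left T μ β c _ _ _ _)

/-- `b_h^j` as a bilinear map. -/
noncomputable def bjMap {d : ℕ} (hd : 0 < d) (T : Triangulation d) :
    (CellFun d × facetCont d) →ₗ[ℝ] (CellVec d × facetVecCont d) →ₗ[ℝ] ℝ :=
  LinearMap.mk₂ ℝ (fun q v => bj T q.1 q.2 v.1 v.2)
    (fun q q' v => bj_add_left hd T _ _ _ q.2.2 q'.2.2 v.2.2)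
    (fun c _ _ => bj_smul_left T c _ _ _ _)
    (fun q v v' => bj_add_right hd T _ _ _ q.2.2 v.2.2 v'.2.2)
    (fun c _ _ => bj_smul_right T c _ _ _ _)

/-- The scalar `L²` inner product over cells as a bilinear map. -/
noncomputable def l2Map {d : ℕ} (cells : Finset (Finset (E d))) :
    CellFun d →ₗ[ℝ] CellFun d →ₗ[ℝ] ℝ :=
  LinearMap.mk₂ ℝ (l2 cells) (l2_add_left cells) (l2_smul_left cells)
    (fun p q q' => by
      rw [l2_symm, l2_symm _ p q, l2_symm _ p q']; exact l2_add_left cells _ _ _)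
    (fun c p q => by rw [l2_symm, l2_symm _ p q]; exact l2_smul_left cells _ _ _)

/-- The vector `L²` inner product over cells as a bilinear map. -/
noncomputable def l2VecMap {d : ℕ} (cells : Finset (Finset (E d))) :
    CellVec d →ₗ[ℝ] CellVec d →ₗ[ℝ] ℝ :=
  LinearMap.mk₂ ℝ (l2Vec cells) (l2Vec_add_left cells) (l2Vec_smul_left cells)
    (fun p q q' => by
      rw [l2Vec_symm, l2Vec_symm _ p q, l2Vec_symm _ p q']; exact l2Vec_add_left cells _ _ _)
    (fun c p q => by rw [l2Vec_symm, l2Vec_symm _ p q]; exact l2Vec_smul_left cells _ _ _)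

/-- `a_h^I` as a bilinear map. -/
noncomputable def Mesh.aIMap {d : ℕ} (hd : 0 < d) (M : Mesh d) (P : Params) :
    (facetVecCont d × facetVecCont d) →ₗ[ℝ] (facetVecCont d × facetVecCont d) →ₗ[ℝ] ℝ :=
  LinearMap.mk₂ ℝ (fun u v => M.aI P u.1 u.2 v.1 v.2)
    (fun u u' v => M.aI_add_left hd P u.1.2 u'.1.2 u.2.2 u'.2.2 v.1.2 v.2.2)
    (fun c u v => M.aI_smul_left P c _ _ _ _)
    (fun u v v' => by
      rw [M.aI_symm, M.aI_symm P u.1 u.2 v.1, M.aI_symm P u.1 u.2 v'.1]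
      exact M.aI_add_left hd P v.1.2 v'.1.2 v.2.2 v'.2.2 u.1.2 u.2.2)
    (fun c u v => by
      rw [M.aI_symm, M.aI_symm P u.1 u.2 v.1]
      exact M.aI_smul_left P c _ _ _ _)

/-- `b_h^I` as a bilinear map. -/
noncomputable def Mesh.bIMap {d : ℕ} (hd : 0 < d) (M : Mesh d) :
    facetCont d →ₗ[ℝ] (facetVecCont d × facetVecCont d) →ₗ[ℝ] ℝ :=
  LinearMap.mk₂ ℝ (fun q v => M.bI q v.1 v.2)
    (fun q q' v => M.bI_add_left hd q.2 q'.2 v.1.2 v.2.2)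
    (fun c _ _ => M.bI_smul_left c _ _ _)
    (fun q v v' => M.bI_add_right hd q.2 v.1.2 v.2.2 v'.1.2 v'.2.2)
    (fun c _ _ => M.bI_smul_right c _ _ _)

/-! ### Vanishing, locality and positivity of the forms -/

/-- A form on one subdomain sees a cell function only on its own cells. This permits test functions
that are modified independently on Ω^s and Ω^b. -/
theorem aj_congr_right {d : ℕ} {T : Triangulation d} (μ β : ℝ) {u v v' : CellVec d}
    (ubar vbar : FacetVec d) (h : ∀ K ∈ T.cells, v K = v' K) :
    aj T μ β u ubar v vbar = aj T μ β u ubar v' vbar := by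
  refine Finset.sum_congr rfl fun K hK => ?_
  have e1 : ∀ F x, jump v vbar K F x = jump v' vbar K F x := fun F x => by
    funext i; simp only [jump, h K hK]
  have e2 : ∀ F x, strainNormal v K F x = strainNormal v' K F x := fun F x => by
    funext i; simp only [strainNormal, h K hK]
  simp only [h K hK, e1, e2]

theorem bj_congr {d : ℕ} {T : Triangulation d} {q q' : CellFun d} {v v' : CellVec d}
    (qbar : FacetFun d) (vbar : FacetVec d) (hq : ∀ K ∈ T.cells, q K = q' K)
    (hv : ∀ K ∈ T.cells, v K = v' K) : bj T q qbar v vbar = bj T q' qbar v' vbar := by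
  refine Finset.sum_congr rfl fun K hK => ?_
  have e1 : ∀ F x, jump v vbar K F x = jump v' vbar K F x := fun F x => by
    funext i; simp only [jump, hv K hK]
  simp only [hq K hK, hv K hK, e1]

theorem l2_congr_right {d : ℕ} {cells : Finset (Finset (E d))} (p : CellFun d) {q q' : CellFun d}
    (h : ∀ K ∈ cells, q K = q' K) : l2 cells p q = l2 cells p q' :=
  Finset.sum_congr rfl fun K hK => by rw [h K hK]

@[simp] theorem aj_zero_right {d : ℕ} (T : Triangulation d) (μ β : ℝ) (u : CellVec d)
    (ubar : FacetVec d) : aj T μ β u ubar 0 0 = 0 := by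
  rw [aj_symm]
  simpa using aj_smul_left T μ β 0 0 u 0 ubar

@[simp] theorem aj_zero_left {d : ℕ} (T : Triangulation d) (μ β : ℝ) (v : CellVec d)
    (vbar : FacetVec d) : aj T μ β 0 0 v vbar = 0 := by
  rw [aj_symm, aj_zero_right]

@[simp] theorem bj_zero_left {d : ℕ} (T : Triangulation d) (v : CellVec d) (vbar : FacetVec d) :
    bj T 0 0 v vbar = 0 := by
  simpa using bj_smul_left T 0 0 0 v vbar

@[simp] theorem bj_zero_right {d : ℕ} (T : Triangulation d) (q : CellFun d) (qbar : FacetFun d) :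
    bj T q qbar 0 0 = 0 := by
  simpa using bj_smul_right T 0 q qbar 0 0

@[simp] theorem l2_zero_right {d : ℕ} (cells : Finset (Finset (E d))) (p : CellFun d) :
    l2 cells p 0 = 0 := by
  rw [l2_symm]; simpa using l2_smul_left cells 0 0 p

@[simp] theorem l2Vec_zero_right {d : ℕ} (cells : Finset (Finset (E d))) (w : CellVec d) :
    l2Vec cells w 0 = 0 := by
  rw [l2Vec_symm]; simpa using l2Vec_smul_left cells 0 0 w

@[simp] theorem Mesh.aI_zero_left {d : ℕ} (M : Mesh d) (P : Params) (vs vb : FacetVec d) :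
    M.aI P 0 0 vs vb = 0 := by
  simpa using M.aI_smul_left P 0 0 0 vs vb

@[simp] theorem Mesh.aI_zero_right {d : ℕ} (M : Mesh d) (P : Params) (us ub : FacetVec d) :
    M.aI P us ub 0 0 = 0 := by
  rw [M.aI_symm, M.aI_zero_left]

@[simp] theorem Mesh.bI_zero_left {d : ℕ} (M : Mesh d) (vs vb : FacetVec d) :
    M.bI 0 vs vb = 0 := by
  simpa using M.bI_smul_left 0 0 vs vb

@[simp] theorem Mesh.bI_zero_right {d : ℕ} (M : Mesh d) (q : FacetFun d) : M.bI q 0 0 = 0 := by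
  simpa using M.bI_smul_right 0 q 0 0

theorem l2_sub_right {d : ℕ} (cells : Finset (Finset (E d))) (p q r : CellFun d) :
    l2 cells p (q - r) = l2 cells p q - l2 cells p r := by
  have h : q - r = q + (-1 : ℝ) • r := by rw [neg_one_smul, sub_eq_add_neg]
  rw [l2_symm, h, l2_add_left, l2_smul_left, l2_symm cells q, l2_symm cells r]
  ring

theorem cellInt_sq_nonneg {d : ℕ} (K : Finset (E d)) (p : Poly d) :
    0 ≤ cellInt K (fun x => ev p x * ev p x) :=
  setIntegral_nonneg (isCompact_hull K).measurableSet fun _ _ => mul_self_nonneg _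

theorem IsSimplex.eq_zero_of_cellInt_sq {d : ℕ} {K : Finset (E d)} (h : IsSimplex K) {p : Poly d}
    (hp : cellInt K (fun x => ev p x * ev p x) = 0) : p = 0 :=
  eq_zero_of_ev_eq_zero h.interior_nonempty fun x hx => mul_self_eq_zero.1
    (h.eq_zero_of_cellInt ((continuous_ev p).mul (continuous_ev p)).continuousOn
      (fun _ _ => mul_self_nonneg _) hp x hx)

theorem l2_self_nonneg {d : ℕ} (cells : Finset (Finset (E d))) (p : CellFun d) :
    0 ≤ l2 cells p p :=
  Finset.sum_nonneg fun K _ => cellInt_sq_nonneg K (p K)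

theorem Triangulation.eq_zero_of_l2_self {d : ℕ} (T : Triangulation d) {p : CellFun d}
    (hp : l2 T.cells p p = 0) : ∀ K ∈ T.cells, p K = 0 := fun K hK =>
  (T.isSimplex hK).eq_zero_of_cellInt_sq
    ((Finset.sum_eq_zero_iff_of_nonneg fun L _ => cellInt_sq_nonneg L (p L)).1 hp K hK)

theorem l2Vec_self_eq {d : ℕ} (cells : Finset (Finset (E d))) (w : CellVec d) :
    l2Vec cells w w = ∑ K ∈ cells, ∑ i, cellInt K (fun x => ev (w K i) x * ev (w K i) x) := by
  refine Finset.sum_congr rfl fun K _ => ?_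
  exact integral_finsetSum _ fun i _ => integrableOn_hull K
    ((continuous_ev _).mul (continuous_ev _)).continuousOn

theorem l2Vec_self_nonneg {d : ℕ} (cells : Finset (Finset (E d))) (w : CellVec d) :
    0 ≤ l2Vec cells w w := by
  rw [l2Vec_self_eq]
  exact Finset.sum_nonneg fun K _ => Finset.sum_nonneg fun i _ => cellInt_sq_nonneg K (w K i)

theorem Triangulation.eq_zero_of_l2Vec_self {d : ℕ} (T : Triangulation d) {w : CellVec d}
    (hw : l2Vec T.cells w w = 0) : ∀ K ∈ T.cells, w K = 0 := fun K hK => funext fun i => by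
  rw [l2Vec_self_eq] at hw
  have h1 := (Finset.sum_eq_zero_iff_of_nonneg fun L _ =>
    Finset.sum_nonneg fun i _ => cellInt_sq_nonneg L (w L i)).1 hw K hK
  exact (T.isSimplex hK).eq_zero_of_cellInt_sq
    ((Finset.sum_eq_zero_iff_of_nonneg fun i _ => cellInt_sq_nonneg K (w K i)).1 h1 i
      (Finset.mem_univ i))

theorem Mesh.aI_self_nonneg {d : ℕ} (M : Mesh d) (P : Params) (us ub : FacetVec d) :
    0 ≤ M.aI P us ub us ub := by
  classical
  refine Finset.sum_nonneg fun K _ => Finset.sum_nonneg fun F _ =>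
    setIntegral_nonneg (isCompact_hull F).measurableSet fun x _ => mul_nonneg
      (mul_nonneg P.γ_pos.le (Real.sqrt_nonneg _)) ?_
  exact Finset.sum_nonneg fun i _ => mul_self_nonneg _

/-! ### The kernel of the divergence form -/

theorem facet_nonempty {d : ℕ} (hd : 0 < d) {K F : Finset (E d)} (hF : F ∈ facetsOf K) :
    F.Nonempty := by
  rw [← Finset.card_pos, (Finset.mem_powersetCard.1 hF).2]; exact hd

/-- On a connected triangulation, a pressure in the kernel of the divergence form is constant. -/
theorem eq_const_of_bj_eq_zero {d : ℕ} (hd : 0 < d) {k : ℕ} (hk : 1 ≤ k) {T : Triangulation d}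
    (hT : IsConnected T.domain) {q : CellFun d} {qbar : FacetFun d}
    (hq : ∀ K, (q K).totalDegree ≤ k - 1) (hqbar : ∀ F, qbar F ∈ facetPoly k F)
    (H : ∀ w ∈ cellVecSpace T.cells k, bj T q qbar w 0 = 0) :
    ∃ c, (∀ K ∈ T.cells, ∀ x, ev (q K) x = c) ∧ ∀ F ∈ T.facets, ∀ x ∈ hull F, qbar F x = c := by
  classical
  have hloc : ∀ K ∈ T.cells, ∃ c, (∀ x, ev (q K) x = c) ∧
      ∀ F ∈ facetsOf K, ∀ x ∈ hull F, qbar F x = c := by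
    intro K hK
    refine (T.isSimplex hK).eq_const_of_divergence_form_eq_zero hd hk (hq K) (fun F _ => ?_)
      fun w hw => ?_
    · obtain ⟨p, hp, hqp⟩ := hqbar F
      exact ⟨p, hp, fun x hx => by rw [hqp, Set.indicator_of_mem hx]⟩
    -- Cell test functions are discontinuous, so one supported on a single cell isolates the local
    -- form.
    · have h1 := H (Pi.single K w) (mem_cellVecSpace.2 ⟨fun L i => ?_, fun L hL => ?_⟩)
      · rw [bj, Finset.sum_eq_single K] at h1
        · simpa [jump, dotProduct] using h1
        · intro L _ hLK
          have e : (Pi.single K w : CellVec d) L = 0 := Pi.single_eq_of_ne hLK _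
          simp [jump, e, divergence, cellInt, bdryInt, facetInt, dotProduct]
        · exact fun hn => absurd hK hn
      · by_cases hLK : L = K
        · subst hLK; rw [Pi.single_eq_same]; exact hw i
        · rw [Pi.single_eq_of_ne hLK]; simp
      · exact Pi.single_eq_of_ne (fun e => hL (by rw [e]; exact hK)) _
  choose! c hc1 hc2 using hloc
  -- The facet pressure is single-valued, so the constants of two cells with a common facet agree.
  have hconst := T.eq_of_isConnected hT c fun K hK L hL F hFK hFL => by
    have hx := centre_mem_hull (facet_nonempty hd hFK)
    rw [← hc2 K hK F hFK _ hx, ← hc2 L hL F hFL _ hx]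
  obtain ⟨x, hx⟩ := hT.nonempty
  obtain ⟨K, hK, -⟩ := Set.mem_iUnion₂.1 (interior_subset hx)
  refine ⟨c K, fun L hL x => ?_, fun F hF x hx => ?_⟩
  · rw [hc1 L hL, hconst L hL K hK]
  · obtain ⟨L, hL, hFL⟩ := T.mem_facets.1 hF
    rw [hc2 L hL F hFL x hx, hconst L hL K hK]

theorem facetFun_eq_zero {d k : ℕ} {T : Triangulation d} {Z : Finset (Finset (E d))}
    {q : FacetFun d} (hq : q ∈ facetSpace T k Z) (h : ∀ F ∈ T.facets, ∀ x ∈ hull F, q F x = 0) :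
    q = 0 := by
  classical
  have hq' := mem_facetSpace.1 hq
  funext F
  by_cases hF : F ∈ T.facets
  · exact eq_zero_of_mem_facetPoly (hq'.1 F) (h F hF)
  · exact hq'.2 F (by simp [hF])

theorem poly_eq_zero {d : ℕ} {p : Poly d} (h : ∀ x, ev p x = 0) : p = 0 :=
  eq_zero_of_ev_eq_zero (s := Set.univ) (by simp) fun x _ => h x

theorem Mesh.mem_cells {d : ℕ} {M : Mesh d} {K : Finset (E d)} :
    K ∈ M.cells ↔ K ∈ M.Ts.cells ∨ K ∈ M.Tb.cells := by
  classical
  simp [Mesh.cells]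

open scoped Classical in
/-- A constant pressure that is orthogonal to the normal facet velocities on a boundary facet
vanishes. -/
theorem const_eq_zero_of_boundary_facet {d : ℕ} (hd : 0 < d) {k : ℕ} {T : Triangulation d}
    {Z : Finset (Finset (E d))} {F : Finset (E d)} (hF : F ∈ T.facets) (hFZ : F ∉ Z)
    (hbd : hull F ⊆ frontier T.domain) {q : CellFun d} {qbar : FacetFun d} {c : ℝ}
    (hc : ∀ x ∈ hull F, qbar F x = c)
    (H : ∀ v ∈ facetVecSpace T k Z, bj T q qbar 0 v = 0) : c = 0 := by
  obtain ⟨K, hK, hFK⟩ := T.mem_facets.1 hF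
  have h := T.isSimplex hK
  have hne := facet_nonempty hd hFK
  set n := outwardNormal K F with hn'
  -- The test function is the constant unit normal on `F` and zero elsewhere. A boundary facet
  -- belongs to one cell only, so no contribution with the opposite normal occurs and the form
  -- equals -c times the measure of `F`.
  set v : FacetVec d := Pi.single F fun i => (hull F).indicator (ev (MvPolynomial.C (n i))) with hv
  have hvF : ∀ i, ∀ x ∈ hull F, v F i x = n i := fun i x hx => by
    rw [hv, Pi.single_eq_same, Set.indicator_of_mem hx, ev_C]
  have hvG : ∀ G, G ≠ F → v G = 0 := fun G hG => Pi.single_eq_of_ne hG _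
  have h1 := H v (mem_facetVecSpace.2 ⟨fun G i => ?_, fun G hG => ?_⟩)
  · obtain ⟨a, ha, rfl⟩ := (mem_facetsOf h.1).1 hFK
    have hn : ∑ i, n i * n i = 1 := by
      rw [← inner_eq_dotProduct, real_inner_self_eq_norm_sq,
        norm_outwardNormal (h.height_pos hd ha).ne', one_pow]
    have hz : ∀ L G, G ≠ K.erase a → facetInt G (fun x => qbar G x *
        (jump (0 : CellVec d) v L G x ⬝ᵥ fun i => outwardNormal L G i)) = 0 := fun L G hG => by
      refine setIntegral_eq_zero_of_forall_eq_zero fun x _ => ?_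
      simp [jump, hvG G hG, dotProduct]
    have hd0 : ∀ L, cellInt L (fun x => ev (q L) x * divergence ((0 : CellVec d) L) x) = 0 := fun L =>
      setIntegral_eq_zero_of_forall_eq_zero fun x _ => by simp [divergence]
    rw [bj, Finset.sum_eq_single K] at h1
    · rw [hd0, bdryInt, Finset.sum_eq_single (K.erase a)] at h1
      · have h2 : facetInt (K.erase a) (fun x => qbar (K.erase a) x *
            (jump (0 : CellVec d) v K (K.erase a) x ⬝ᵥ fun i => outwardNormal K (K.erase a) i)) =
            -c * facetInt (K.erase a) (fun _ => 1) := by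
          rw [← facetInt_const_mul]
          refine setIntegral_congr_fun (isCompact_hull _).measurableSet fun x hx => ?_
          have : jump (0 : CellVec d) v K (K.erase a) x ⬝ᵥ
              (fun i => outwardNormal K (K.erase a) i) = -1 := by
            rw [← hn]
            simp [jump, dotProduct, hvF _ x hx, ← hn']
          simp only [this, hc x hx]; ring
        rw [h2] at h1
        have h3 : facetInt (K.erase a) (fun _ => (1 : ℝ)) ≠ 0 := fun h0 => one_ne_zero
          (h.eq_zero_of_facetInt hd ha continuousOn_const (fun _ _ => zero_le_one) h0 _
            (centre_mem_hull hne))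
        have h4 : -c * facetInt (K.erase a) (fun _ => (1 : ℝ)) = 0 := by linarith
        exact neg_eq_zero.1 ((mul_eq_zero.1 h4).resolve_right h3)
      · exact fun G _ hG => hz K G hG
      · exact fun hn => absurd hFK hn
    · intro L hL hLK
      rw [hd0, bdryInt, Finset.sum_eq_zero, neg_zero, add_zero]
      intro G hG
      refine hz L G fun e => hLK ?_
      exact T.eq_of_facet_subset_frontier hd hL hK (e ▸ hG) hFK hbd
    · exact fun hn => absurd hK hn
  · by_cases hG : G = F
    · subst hG; rw [hv, Pi.single_eq_same]; exact ⟨_, by simp, rfl⟩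
    · rw [hvG G hG]; exact Submodule.zero_mem _
  · exact hvG G (fun e => hG (by rw [e]; simp [hF, hFZ]))

theorem energy_nonneg {d : ℕ} (T : Triangulation d) {μ : ℝ} (hμ : 0 < μ) (u : CellVec d)
    (ubar : FacetVec d) :
    0 ≤ ∑ K ∈ T.cells, (μ * cellInt K (fun x => ∑ i, ∑ j, strain (u K) x i j ^ 2) +
      2 * μ * (diam K)⁻¹ * bdryInt K (fun F x => jump u ubar K F x ⬝ᵥ jump u ubar K F x)) := by
  refine Finset.sum_nonneg fun K _ => add_nonneg (mul_nonneg hμ.le ?_)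
    (mul_nonneg (mul_nonneg (by linarith) (inv_nonneg.2 Metric.diam_nonneg)) ?_)
  · exact setIntegral_nonneg (isCompact_hull K).measurableSet fun x _ =>
      Finset.sum_nonneg fun i _ => Finset.sum_nonneg fun j _ => sq_nonneg _
  · exact Finset.sum_nonneg fun F _ => setIntegral_nonneg (isCompact_hull F).measurableSet fun x _ =>
      Finset.sum_nonneg fun i _ => mul_self_nonneg _

/-- Positivity of `a_h^j` on the discrete space, as it follows from coercivity. -/
def Coercive {d : ℕ} (T : Triangulation d) (k : ℕ) (μ β : ℝ) : Prop :=
  ∀ (u : CellVec d) (ubar : FacetVec d), (∀ K i, (u K i).totalDegree ≤ k) →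
    (∀ F i, ContinuousOn (ubar F i) (hull F)) →
    ∑ K ∈ T.cells, (μ * cellInt K (fun x => ∑ i, ∑ j, strain (u K) x i j ^ 2) +
      2 * μ * (diam K)⁻¹ * bdryInt K (fun F x => jump u ubar K F x ⬝ᵥ jump u ubar K F x)) ≤
        aj T μ β u ubar u ubar

open scoped Classical in
/-- The homogeneous system has only the trivial solution. -/
theorem Mesh.eq_zero_of_isStep {d : ℕ} (hd : 0 < d) {k : ℕ} (hk : 1 ≤ k) (M : Mesh d) (P : Params)
    {βs βb Δt : ℝ} (hcs : Coercive M.Ts k P.μs βs) (hcb : Coercive M.Tb k P.μb βb) (hΔt : 0 < Δt)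
    {x : XTuple d} (hx : x ∈ M.Xh k) (hstep : M.IsStep k P βs βb Δt 0 0 0 x) : x = 0 := by
  obtain ⟨⟨u, us, ub⟩, ⟨p, ps, pb⟩, z, π, πb⟩ := x
  obtain ⟨⟨hu, hus, hub⟩, ⟨hp, hps, hpb⟩, hz, hπ, hπb⟩ := hx
  obtain ⟨E1, E2, E3, E4⟩ := hstep
  simp only [dt, Prod.fst_zero, Prod.snd_zero, sub_zero, Pi.zero_apply, PiLp.zero_apply, zero_mul,
    Finset.sum_const_zero] at E1 E2 E3 E4
  have hc0 : ∀ K : Finset (E d), cellInt K (fun _ => (0 : ℝ)) = 0 := fun K => integral_zero _ _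
  simp only [hc0, Finset.sum_const_zero] at E1 E3
  set s := Δt⁻¹ with hs'
  have hs : 0 < s := inv_pos.2 hΔt
  simp only [SetLike.mem_coe] at hu hus hub hp hps hpb hz hπ hπb
  have hu' := mem_cellVecSpace.1 hu
  have hp' := mem_cellSpace.1 hp
  have hz' := mem_cellVecSpace.1 hz
  have hπ' := mem_cellSpace.1 hπ
  have hdisj : ∀ K ∈ M.Ts.cells, K ∉ M.Tb.cells := fun K hK hK' =>
    Finset.disjoint_left.1 M.nonoverlapping hK hK'
  have hFDs : M.FDs ⊆ M.Ts.facets := fun F hF => (Finset.mem_filter.1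
    (M.cover_s ▸ Finset.mem_union_left _ hF : F ∈ M.Ts.facetsOn _)).1
  have hFDb : M.FDb ⊆ M.Tb.facets := fun F hF => (Finset.mem_filter.1
    (M.cover_b ▸ Finset.mem_union_left _ hF : F ∈ M.Tb.facetsOn _)).1
  have hFPb : M.FPb ⊆ M.Tb.facets := fun F hF => (Finset.mem_filter.1
    (M.cover_p ▸ Finset.mem_union_left _ hF : F ∈ M.Tb.facetsOn _)).1
  -- On Ω^b the test function is the discrete velocity s u, because the interface terms pair ū^s
  -- with the difference quotient s ū^b.
  obtain ⟨v, hv, hvs, hvb⟩ : ∃ v ∈ cellVecSpace M.cells k,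
      (∀ K ∈ M.Ts.cells, v K = u K) ∧ ∀ K ∈ M.Tb.cells, v K = (s • u) K := by
    refine ⟨fun K => if K ∈ M.Tb.cells then s • u K else u K,
      mem_cellVecSpace.2 ⟨fun K i => ?_, fun K hK => ?_⟩,
      fun K hK => if_neg (hdisj K hK), fun K hK => if_pos hK⟩
    · split_ifs
      · exact (MvPolynomial.totalDegree_smul_le _ _).trans (hu'.1 K i)
      · exact hu'.1 K i
    · have := hu'.2 K hK
      split_ifs <;> simp [this]
  -- Restricting p to one subdomain splits the second equation in two, so that its Ω^b part can
  -- receive the extra factor s.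
  have hrestr : ∀ S : Finset (Finset (E d)), ∃ q ∈ cellSpace M.cells (k - 1),
      (∀ K ∈ S, q K = p K) ∧ ∀ K, K ∉ S → q K = 0 := by
    intro S
    refine ⟨fun K => if K ∈ S then p K else 0, mem_cellSpace.2 ⟨fun K => ?_, fun K hK => ?_⟩,
      fun K hK => if_pos hK, fun K hK => if_neg hK⟩
    · split_ifs
      · exact hp'.1 K
      · simp
    · have := hp'.2 K hK
      split_ifs <;> simp [this]
  obtain ⟨qs, hqs, hqs1, hqs0⟩ := hrestr M.Ts.cells
  obtain ⟨qb, hqb, hqb1, hqb0⟩ := hrestr M.Tb.cells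
  have e1 := E1 (v, us, s • ub) ⟨hv, hus, Submodule.smul_mem _ _ hub⟩
  have e2s := E2 (qs, ps, 0) ⟨hqs, hps, Submodule.zero_mem _⟩
  have e2b := E2 (qb, 0, pb) ⟨hqb, Submodule.zero_mem _, hpb⟩
  have e3 := E3 (π, πb) ⟨hπ, hπb⟩
  have e4 := E4 z hz
  simp only [Mesh.ah, Mesh.bh, Mesh.ch] at e1 e2s e2b e3 e4
  rw [aj_congr_right P.μs βs us us hvs, aj_congr_right P.μb βb ub (s • ub) hvb,
    bj_congr ps us (fun _ _ => rfl) hvs, bj_congr pb (s • ub) (fun _ _ => rfl) hvb,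
    aj_symm M.Tb, aj_smul_left, bj_smul_right] at e1
  rw [bj_congr ps us hqs1 (fun _ _ => rfl),
    bj_congr 0 ub (q' := 0) (fun K hK => hqs0 K fun h => hdisj K h hK) (fun _ _ => rfl),
    l2_congr_right _ (q' := 0) (fun K hK => hqs0 K fun h => hdisj K h hK), bj_zero_left,
    l2_zero_right, add_zero, add_zero] at e2s
  rw [bj_congr 0 us (q' := 0) (fun K hK => hqb0 K (hdisj K hK)) (fun _ _ => rfl),
    bj_congr pb ub hqb1 (fun _ _ => rfl), l2_congr_right _ hqb1, bj_zero_left, zero_add,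
    l2_smul_left] at e2b
  -- With zero previous values the difference quotient of αp^p - p is s times `D`, the same quantity
  -- that appears in the second equation on Ω^b.
  have hsm : P.α • s • π - s • p = s • (P.α • π - p) := by rw [smul_sub, smul_comm]
  rw [l2_smul_left, l2_smul_left, l2_smul_left, hsm, l2_smul_left] at e3
  rw [l2Vec_smul_left] at e4
  set D := P.α • π - p with hD
  have hDD : l2 M.Tb.cells D D = l2 M.Tb.cells D (P.α • π) - l2 M.Tb.cells D p :=
    l2_sub_right _ D _ _
  have hAs := hcs u us hu'.1 fun F i => continuousOn_of_mem_facetPoly ((mem_facetVecSpace.1 hus).1 F i)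
  have hAb := hcb u ub hu'.1 fun F i => continuousOn_of_mem_facetPoly ((mem_facetVecSpace.1 hub).1 F i)
  have nAs := energy_nonneg M.Ts P.μs_pos u us
  have nAb := energy_nonneg M.Tb P.μb_pos u ub
  have nI := M.aI_self_nonneg P us (s • ub)
  have nD := l2_self_nonneg M.Tb.cells D
  have nπ := l2_self_nonneg M.Tb.cells π
  have nz := l2Vec_self_nonneg M.Tb.cells z
  have hlam : 0 < P.lam⁻¹ := inv_pos.2 P.lam_pos
  have hκ : 0 < P.κ⁻¹ := inv_pos.2 P.κ_pos
  have mD : 0 ≤ s * (P.lam⁻¹ * l2 M.Tb.cells D D) := by positivity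
  have mπ : 0 ≤ P.c₀ * (s * l2 M.Tb.cells π π) :=
    mul_nonneg P.c₀_nonneg (mul_nonneg hs.le nπ)
  have mz : 0 ≤ P.κ⁻¹ * l2Vec M.Tb.cells z z := by positivity
  have mAb := mul_nonneg hs.le (nAb.trans hAb)
  have hsum : aj M.Ts P.μs βs u us u us + s * aj M.Tb P.μb βb u ub u ub +
      M.aI P us (s • ub) us (s • ub) + s * (P.lam⁻¹ * l2 M.Tb.cells D D) +
      P.c₀ * (s * l2 M.Tb.cells π π) + P.κ⁻¹ * l2Vec M.Tb.cells z z = 0 := by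
    rw [hDD]
    -- The signs cancel every b-form and the interface pressure term. The two pressure couplings
    -- combine to the square of `D`.
    linear_combination e1 - e2s - s * e2b + e3 + e4
  have mAs := nAs.trans hAs
  obtain ⟨hus0', hus0⟩ := eq_zero_of_energy_le_zero hd M.connected_s hFDs M.FDs_nonempty P.μs_pos hus
    (u := u) (by linarith)
  have hAb0 : s * aj M.Tb P.μb βb u ub u ub = 0 := by linarith
  obtain ⟨hub0', hub0⟩ := eq_zero_of_energy_le_zero hd M.connected_b hFDb M.FDb_nonempty P.μb_pos hub
    (u := u) (by
      have := (mul_eq_zero.1 hAb0).resolve_left hs.ne'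
      linarith)
  have hu0 : u = 0 := by
    funext K
    by_cases hK : K ∈ M.cells
    · rcases Mesh.mem_cells.1 hK with h | h
      · exact hus0' K h
      · exact hub0' K h
    · exact hu'.2 K hK
  have hD0 : ∀ K ∈ M.Tb.cells, D K = 0 := by
    have h1 : s * (P.lam⁻¹ * l2 M.Tb.cells D D) = 0 := by linarith
    exact M.Tb.eq_zero_of_l2_self
      ((mul_eq_zero.1 ((mul_eq_zero.1 h1).resolve_left hs.ne')).resolve_left hlam.ne')
  have hz0 : z = 0 := by
    have h1 : P.κ⁻¹ * l2Vec M.Tb.cells z z = 0 := by linarith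
    have h2 := M.Tb.eq_zero_of_l2Vec_self ((mul_eq_zero.1 h1).resolve_left hκ.ne')
    funext K
    by_cases hK : K ∈ M.Tb.cells
    · exact h2 K hK
    · exact hz'.2 K hK
  clear e1 e2s e2b e3 e4 hsum
  subst hu0 hus0 hub0 hz0
  -- With z = 0 the Darcy equation says that the pore pressure annihilates all cell fields, so it is
  -- constant, and Γ_P fixes the constant. This also covers c₀ = 0, where the energy gives no
  -- control of p^p.
  have hπc : π = 0 ∧ πb = 0 := by
    obtain ⟨c, hc1, hc2⟩ := eq_const_of_bj_eq_zero hd hk M.connected_b hπ'.1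
      (mem_facetSpace.1 hπb).1 (fun w hw => by
        have := E4 w hw
        rwa [smul_zero, l2Vec_symm, l2Vec_zero_right, zero_add] at this)
    obtain ⟨F, hF⟩ := M.FPb_nonempty
    obtain ⟨K, hK, hFK⟩ := M.Tb.mem_facets.1 (hFPb hF)
    have hc : c = 0 := by
      rw [← hc2 F (hFPb hF) _ (centre_mem_hull (facet_nonempty hd hFK)),
        (mem_facetSpace.1 hπb).2 F (by simp [hF])]
      rfl
    subst hc
    refine ⟨funext fun K => ?_, facetFun_eq_zero hπb hc2⟩
    by_cases hK : K ∈ M.Tb.cells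
    · exact poly_eq_zero (hc1 K hK)
    · exact hπ'.2 K hK
  obtain ⟨rfl, rfl⟩ := hπc
  have hpTb : ∀ K ∈ M.Tb.cells, p K = 0 := fun K hK => by
    have := hD0 K hK
    simpa [hD] using this
  -- Once velocity and pore pressure vanish, the momentum equation contains only the total
  -- pressures.
  have hB : ∀ v vs vb, v ∈ cellVecSpace M.cells k → vs ∈ facetVecSpace M.Ts k M.FDs →
      vb ∈ facetVecSpace M.Tb k M.FDb → bj M.Ts p ps v vs + bj M.Tb p pb v vb = 0 := by
    intro v vs vb hv hvs hvb
    have := E1 (v, vs, vb) ⟨hv, hvs, hvb⟩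
    simpa [Mesh.ah, Mesh.bh] using this
  have hsub : ∀ {T : Triangulation d}, T.cells ⊆ M.cells → ∀ w ∈ cellVecSpace T.cells k,
      w ∈ cellVecSpace M.cells k := fun hT w hw =>
    mem_cellVecSpace.2 ⟨(mem_cellVecSpace.1 hw).1,
      fun K hK => (mem_cellVecSpace.1 hw).2 K fun h => hK (hT h)⟩
  obtain ⟨c, hc1, hc2⟩ := eq_const_of_bj_eq_zero hd hk M.connected_s hp'.1
    (mem_facetSpace.1 hps).1 (fun w hw => by
      have := hB w 0 0 (hsub (fun K hK => Mesh.mem_cells.2 (Or.inl hK)) w hw)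
        (Submodule.zero_mem _) (Submodule.zero_mem _)
      rwa [bj_congr pb 0 (q' := p) (v' := 0) (fun _ _ => rfl)
        (fun K hK => (mem_cellVecSpace.1 hw).2 K fun h => hdisj K h hK), bj_zero_right,
        add_zero] at this)
  obtain ⟨c', hc1', hc2'⟩ := eq_const_of_bj_eq_zero hd hk M.connected_b hp'.1
    (mem_facetSpace.1 hpb).1 (fun w hw => by
      have := hB w 0 0 (hsub (fun K hK => Mesh.mem_cells.2 (Or.inr hK)) w hw)
        (Submodule.zero_mem _) (Submodule.zero_mem _)
      rwa [bj_congr ps 0 (q' := p) (v' := 0) (fun _ _ => rfl)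
        (fun K hK => (mem_cellVecSpace.1 hw).2 K (hdisj K hK)), bj_zero_right,
        zero_add] at this)
  -- On Ω^b the cell pressure equals α times the pore pressure, so it is already zero; any cell
  -- identifies the constant.
  have hc' : c' = 0 := by
    obtain ⟨F, hF⟩ := M.FDb_nonempty
    obtain ⟨K, hK, -⟩ := M.Tb.mem_facets.1 (hFDb hF)
    rw [← hc1' K hK 0, hpTb K hK, ev_zero]
  -- On Ω^s a traction facet is needed: the velocity test functions are free there, and being on
  -- ∂Ω^s it has a cell of Ω^s on one side only.
  have hc : c = 0 := by
    obtain ⟨F, hF⟩ := M.FNs_nonempty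
    have hFon := Finset.mem_filter.1
      (M.cover_s ▸ Finset.mem_union_right _ hF : F ∈ M.Ts.facetsOn _)
    refine const_eq_zero_of_boundary_facet hd (k := k) (Z := M.FDs) hFon.1
      (Finset.disjoint_right.1 M.disjoint_s hF) (fun x hx => (hFon.2 hx).2)
      (hc2 F hFon.1) (q := p) fun v hv => ?_
    have := hB 0 v 0 (Submodule.zero_mem _) hv (Submodule.zero_mem _)
    rwa [bj_zero_right, add_zero] at this
  subst hc hc'
  have hp0 : p = 0 := by
    funext K
    by_cases hK : K ∈ M.cells
    · rcases Mesh.mem_cells.1 hK with h | h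
      · exact poly_eq_zero (hc1 K h)
      · exact hpTb K h
    · exact hp'.2 K hK
  rw [hp0, facetFun_eq_zero hps hc2, facetFun_eq_zero hpb hc2']
  rfl

/-! ### Finite dimension of the discrete spaces -/

/-- The families are indexed by all vertex sets, an infinite type, but vanish off finitely many.
Restriction to those indices is injective into a finite product. -/
theorem fg_pi_of_eq_bot {ι : Type*} {V : ι → Type*} [∀ i, AddCommGroup (V i)]
    [∀ i, Module ℝ (V i)] (s : Finset ι) (S : ∀ i, Submodule ℝ (V i)) (hS : ∀ i ∈ s, (S i).FG)
    (h0 : ∀ i, i ∉ s → S i = ⊥) : (Submodule.pi Set.univ S).FG := by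
  have : ∀ i : s, Module.Finite ℝ (S i) := fun i => Module.Finite.iff_fg.2 (hS i i.2)
  let Ψ : Submodule.pi Set.univ S →ₗ[ℝ] ((i : s) → S i) :=
    LinearMap.pi fun i => ((LinearMap.proj (i : ι)).comp (Submodule.subtype _)).codRestrict (S i)
      fun x => x.2 i (Set.mem_univ _)
  have hΨ : Function.Injective Ψ := fun x y h => by
    refine Subtype.ext (funext fun i => ?_)
    by_cases hi : i ∈ s
    · exact congrArg Subtype.val (congrFun h ⟨i, hi⟩)
    · have hx : x.1 i ∈ S i := x.2 i (Set.mem_univ _)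
      have hy : y.1 i ∈ S i := y.2 i (Set.mem_univ _)
      rw [h0 i hi, Submodule.mem_bot] at hx hy
      rw [hx, hy]
  exact Module.Finite.iff_fg.1 (Module.Finite.of_injective Ψ hΨ)

theorem fg_restrictTotalDegree (d m : ℕ) :
    (MvPolynomial.restrictTotalDegree (Fin d) ℝ m).FG :=
  Module.Finite.iff_fg.1 inferInstance

theorem fg_facetPoly {d : ℕ} (k : ℕ) (F : Finset (E d)) : (facetPoly k F).FG := by
  let Ψ : Poly d →ₗ[ℝ] (E d → ℝ) :=
    { toFun := fun p => (hull F).indicator (ev p)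
      map_add' := fun p q => by
        funext x
        by_cases hx : x ∈ hull F <;> simp [hx]
      map_smul' := fun c p => by
        funext x
        by_cases hx : x ∈ hull F <;> simp [hx] }
  have h : facetPoly k F = (MvPolynomial.restrictTotalDegree (Fin d) ℝ k).map Ψ := by
    ext q
    simp only [Submodule.mem_map, MvPolynomial.mem_restrictTotalDegree, mem_facetPoly]
    exact exists_congr fun p => and_congr_right fun _ => eq_comm
  rw [h]
  exact (fg_restrictTotalDegree d k).map Ψ

theorem fg_pi_fin {ι V : Type*} [Finite ι] [AddCommGroup V] [Module ℝ V] {S : Submodule ℝ V}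
    (hS : S.FG) : (Submodule.pi Set.univ fun _ : ι => S).FG := by
  cases nonempty_fintype ι
  exact fg_pi_of_eq_bot Finset.univ _ (fun _ _ => hS) fun i hi => absurd (Finset.mem_univ i) hi

theorem pi_bot {ι V : Type*} [AddCommGroup V] [Module ℝ V] :
    (Submodule.pi Set.univ fun _ : ι => (⊥ : Submodule ℝ V)) = ⊥ := by
  ext x
  simp [funext_iff]

theorem fg_cellSpace {d : ℕ} (cells : Finset (Finset (E d))) (m : ℕ) : (cellSpace cells m).FG :=
  fg_pi_of_eq_bot cells _ (fun K hK => by rw [if_pos hK]; exact fg_restrictTotalDegree d m)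
    fun K hK => if_neg hK

theorem fg_cellVecSpace {d : ℕ} (cells : Finset (Finset (E d))) (m : ℕ) :
    (cellVecSpace cells m).FG :=
  fg_pi_of_eq_bot cells _
    (fun K hK => by rw [if_pos hK]; exact fg_pi_fin (fg_restrictTotalDegree d m))
    fun K hK => by rw [if_neg hK]; exact pi_bot

theorem fg_facetSpace {d : ℕ} (T : Triangulation d) (k : ℕ) (Z : Finset (Finset (E d))) :
    (facetSpace T k Z).FG := by
  classical
  exact fg_pi_of_eq_bot (T.facets \ Z) _ (fun F hF => by
    rw [if_pos (by convert hF)]; exact fg_facetPoly k F) fun F hF => if_neg (by convert hF)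

theorem fg_facetVecSpace {d : ℕ} (T : Triangulation d) (k : ℕ) (Z : Finset (Finset (E d))) :
    (facetVecSpace T k Z).FG := by
  classical
  exact fg_pi_of_eq_bot (T.facets \ Z) _ (fun F hF => by
    rw [if_pos (by convert hF)]; exact fg_pi_fin (fg_facetPoly k F)) fun F hF => by
      rw [if_neg (by convert hF)]; exact pi_bot

instance Mesh.finite_Xh {d : ℕ} (M : Mesh d) (k : ℕ) : Module.Finite ℝ (M.Xh k) :=
  Module.Finite.iff_fg.2 <|
    ((fg_cellVecSpace _ _).prod ((fg_facetVecSpace _ _ _).prod (fg_facetVecSpace _ _ _))).prod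
      (((fg_cellSpace _ _).prod ((fg_facetSpace _ _ _).prod (fg_facetSpace _ _ _))).prod
        ((fg_cellVecSpace _ _).prod ((fg_cellSpace _ _).prod (fg_facetSpace _ _ _))))

/-! ### The load functional -/

/-- Only the open cell is known to lie in Ω; the boundary of a convex set is null, so the closed
cell has the same integrals. Finite measure then gives L² ⊆ L¹. -/
theorem integrableOn_hull_of_memLp {d : ℕ} {V : Type*} [NormedAddCommGroup V] {Ω : Set (E d)}
    {K : Finset (E d)} (hK : interior (hull K) ⊆ Ω) {f : E d → V}
    (hf : MemLp f 2 (volume.restrict Ω)) : IntegrableOn f (hull K) := by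
  have hae : volume.restrict (interior (hull K)) = volume.restrict (hull K) :=
    Measure.restrict_congr_set
      (interior_ae_eq_of_null_frontier ((convex_hull K).addHaar_frontier volume))
  have h1 : MemLp f 2 (volume.restrict (hull K)) :=
    hae ▸ hf.mono_measure (Measure.restrict_mono hK le_rfl)
  have : IsFiniteMeasure (volume.restrict (hull K)) :=
    isFiniteMeasure_restrict.2 (isCompact_hull K).measure_ne_top
  exact h1.integrable one_le_two

theorem integrableOn_mul_ev {d : ℕ} {K : Finset (E d)} {g : E d → ℝ}
    (hg : IntegrableOn g (hull K)) (p : Poly d) : IntegrableOn (fun x => g x * ev p x) (hull K) :=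
  hg.mul_continuousOn (continuous_ev p).continuousOn (isCompact_hull K)

/-- Integration over `K` against `g`, as a functional on polynomials. -/
noncomputable def momentMap {d : ℕ} {K : Finset (E d)} {g : E d → ℝ}
    (hg : IntegrableOn g (hull K)) : Poly d →ₗ[ℝ] ℝ where
  toFun p := cellInt K fun x => g x * ev p x
  map_add' p q := by
    simp only [ev_add, mul_add]
    exact integral_add (integrableOn_mul_ev hg p) (integrableOn_mul_ev hg q)
  map_smul' c p := by
    simp only [ev_smul, RingHom.id_apply, smul_eq_mul, mul_left_comm _ c]
    exact cellInt_const_mul K c _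

theorem Mesh.hull_subset_union {d : ℕ} (M : Mesh d) {K : Finset (E d)} (hK : K ∈ M.cells) :
    interior (hull K) ⊆ unionDomain M.Ts M.Tb := by
  refine interior_mono ?_
  rcases Mesh.mem_cells.1 hK with h | h
  · exact (Set.subset_biUnion_of_mem (u := fun K => hull K) h).trans Set.subset_union_left
  · exact (Set.subset_biUnion_of_mem (u := fun K => hull K) h).trans Set.subset_union_right

/-- The right-hand side `(f, v)_Ω + (g, r)_{Ω^b}`. -/
noncomputable def Mesh.load {d : ℕ} (M : Mesh d) (f : E d → E d) (g : E d → ℝ) (y : XTuple d) : ℝ :=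
  (∑ K ∈ M.cells, cellInt K fun x => ∑ i, f x i * ev (y.1.1 K i) x) +
    ∑ K ∈ M.Tb.cells, cellInt K fun x => g x * ev (y.2.2.2.1 K) x

theorem Mesh.exists_load_eq {d : ℕ} (M : Mesh d) (k : ℕ) {f : E d → E d} {g : E d → ℝ}
    (hf : MemLp f 2 (volume.restrict (unionDomain M.Ts M.Tb)))
    (hg : MemLp g 2 (volume.restrict M.Tb.domain)) :
    ∃ ℓ : Module.Dual ℝ (M.Xh k), ∀ y, ℓ y = M.load f g y := by
  have hfi : ∀ K ∈ M.cells, ∀ i, IntegrableOn (fun x => f x i) (hull K) := fun K hK i =>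
    (EuclideanSpace.proj (𝕜 := ℝ) i).integrable_comp
      (integrableOn_hull_of_memLp (M.hull_subset_union hK) hf)
  have hgi : ∀ K ∈ M.Tb.cells, IntegrableOn g (hull K) := fun K hK =>
    integrableOn_hull_of_memLp (M.Tb.interior_hull_subset hK) hg
  let ιu : M.Xh k →ₗ[ℝ] CellVec d :=
    LinearMap.fst ℝ _ _ ∘ₗ LinearMap.fst ℝ _ _ ∘ₗ (M.Xh k).subtype
  let ιr : M.Xh k →ₗ[ℝ] CellFun d := LinearMap.fst ℝ _ _ ∘ₗ LinearMap.snd ℝ _ _ ∘ₗ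
    LinearMap.snd ℝ _ _ ∘ₗ LinearMap.snd ℝ _ _ ∘ₗ (M.Xh k).subtype
  refine ⟨(∑ K : M.cells, ∑ i, momentMap (hfi K K.2 i) ∘ₗ LinearMap.proj i ∘ₗ
      LinearMap.proj (K : Finset (E d)) ∘ₗ ιu) +
    ∑ K : M.Tb.cells, momentMap (hgi K K.2) ∘ₗ LinearMap.proj (K : Finset (E d)) ∘ₗ ιr,
    fun y => ?_⟩
  rw [LinearMap.add_apply, LinearMap.sum_apply, LinearMap.sum_apply, Mesh.load]
  congr 1
  · rw [← Finset.sum_coe_sort M.cells]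
    refine Finset.sum_congr rfl fun K _ => ?_
    rw [LinearMap.sum_apply]
    exact (integral_finsetSum _ fun i _ => integrableOn_mul_ev (hfi K K.2 i) _).symm
  · rw [← Finset.sum_coe_sort M.Tb.cells]
    rfl

/-! ### Solvability of one step -/

/-- The inclusions of the components of `X_h` into the spaces on which the forms are bilinear. -/
noncomputable def Mesh.uComp {d : ℕ} (M : Mesh d) (k : ℕ) : M.Xh k →ₗ[ℝ] CellVec d :=
  LinearMap.fst ℝ _ _ ∘ₗ LinearMap.fst ℝ _ _ ∘ₗ (M.Xh k).subtype

noncomputable def Mesh.usComp {d : ℕ} (M : Mesh d) (k : ℕ) : M.Xh k →ₗ[ℝ] facetVecCont d :=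
  (LinearMap.fst ℝ _ _ ∘ₗ LinearMap.snd ℝ _ _ ∘ₗ LinearMap.fst ℝ _ _ ∘ₗ
    (M.Xh k).subtype).codRestrict _ fun x F i =>
      continuousOn_of_mem_facetPoly ((mem_facetVecSpace.1 x.2.1.2.1).1 F i)

noncomputable def Mesh.ubComp {d : ℕ} (M : Mesh d) (k : ℕ) : M.Xh k →ₗ[ℝ] facetVecCont d :=
  (LinearMap.snd ℝ _ _ ∘ₗ LinearMap.snd ℝ _ _ ∘ₗ LinearMap.fst ℝ _ _ ∘ₗ
    (M.Xh k).subtype).codRestrict _ fun x F i =>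
      continuousOn_of_mem_facetPoly ((mem_facetVecSpace.1 x.2.1.2.2).1 F i)

noncomputable def Mesh.pComp {d : ℕ} (M : Mesh d) (k : ℕ) : M.Xh k →ₗ[ℝ] CellFun d :=
  LinearMap.fst ℝ _ _ ∘ₗ LinearMap.fst ℝ _ _ ∘ₗ LinearMap.snd ℝ _ _ ∘ₗ (M.Xh k).subtype

noncomputable def Mesh.psComp {d : ℕ} (M : Mesh d) (k : ℕ) : M.Xh k →ₗ[ℝ] facetCont d :=
  (LinearMap.fst ℝ _ _ ∘ₗ LinearMap.snd ℝ _ _ ∘ₗ LinearMap.fst ℝ _ _ ∘ₗ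
    LinearMap.snd ℝ _ _ ∘ₗ (M.Xh k).subtype).codRestrict _ fun x F =>
      continuousOn_of_mem_facetPoly ((mem_facetSpace.1 x.2.2.1.2.1).1 F)

noncomputable def Mesh.pbComp {d : ℕ} (M : Mesh d) (k : ℕ) : M.Xh k →ₗ[ℝ] facetCont d :=
  (LinearMap.snd ℝ _ _ ∘ₗ LinearMap.snd ℝ _ _ ∘ₗ LinearMap.fst ℝ _ _ ∘ₗ
    LinearMap.snd ℝ _ _ ∘ₗ (M.Xh k).subtype).codRestrict _ fun x F =>
      continuousOn_of_mem_facetPoly ((mem_facetSpace.1 x.2.2.1.2.2).1 F)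

noncomputable def Mesh.zComp {d : ℕ} (M : Mesh d) (k : ℕ) : M.Xh k →ₗ[ℝ] CellVec d :=
  LinearMap.fst ℝ _ _ ∘ₗ LinearMap.snd ℝ _ _ ∘ₗ LinearMap.snd ℝ _ _ ∘ₗ (M.Xh k).subtype

noncomputable def Mesh.rComp {d : ℕ} (M : Mesh d) (k : ℕ) : M.Xh k →ₗ[ℝ] CellFun d :=
  LinearMap.fst ℝ _ _ ∘ₗ LinearMap.snd ℝ _ _ ∘ₗ LinearMap.snd ℝ _ _ ∘ₗ LinearMap.snd ℝ _ _ ∘ₗ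
    (M.Xh k).subtype

noncomputable def Mesh.rbComp {d : ℕ} (M : Mesh d) (k : ℕ) : M.Xh k →ₗ[ℝ] facetCont d :=
  (LinearMap.snd ℝ _ _ ∘ₗ LinearMap.snd ℝ _ _ ∘ₗ LinearMap.snd ℝ _ _ ∘ₗ
    LinearMap.snd ℝ _ _ ∘ₗ (M.Xh k).subtype).codRestrict _ fun x F =>
      continuousOn_of_mem_facetPoly ((mem_facetSpace.1 x.2.2.2.2.2).1 F)

/-- The sum of the left-hand sides of the four equations, as a bilinear form in the pair of the new
values and their difference quotients, and the test functions. -/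
noncomputable def Mesh.stepForm {d : ℕ} (hd : 0 < d) (M : Mesh d) (k : ℕ) (P : Params)
    (βs βb : ℝ) : (M.Xh k × M.Xh k) →ₗ[ℝ] M.Xh k →ₗ[ℝ] ℝ :=
  let now : (M.Xh k × M.Xh k) →ₗ[ℝ] M.Xh k := LinearMap.fst ℝ _ _
  let rate : (M.Xh k × M.Xh k) →ₗ[ℝ] M.Xh k := LinearMap.snd ℝ _ _
  let us := (M.uComp k).prod (M.usComp k)
  let ub := (M.uComp k).prod (M.ubComp k)
  let ps := (M.pComp k).prod (M.psComp k)
  let pb := (M.pComp k).prod (M.pbComp k)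
  let r := (M.rComp k).prod (M.rbComp k)
  let z := (M.zComp k).prod (0 : M.Xh k →ₗ[ℝ] facetVecCont d)
  let ubars := (M.usComp k).prod (M.ubComp k)
  let ubarI := (M.usComp k ∘ₗ now).prod (M.ubComp k ∘ₗ rate)
  (ajMap hd M.Ts P.μs βs).compl₁₂ (us ∘ₗ now) us +
    (ajMap hd M.Tb P.μb βb).compl₁₂ (ub ∘ₗ now) ub +
    (M.aIMap hd P).compl₁₂ ubarI ubars +
    (bjMap hd M.Ts).compl₁₂ (ps ∘ₗ now) us + (bjMap hd M.Tb).compl₁₂ (pb ∘ₗ now) ub +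
    (M.bIMap hd).compl₁₂ (M.rbComp k ∘ₗ now) ubars +
    (bjMap hd M.Ts).flip.compl₁₂ (us ∘ₗ now) ps + (bjMap hd M.Tb).flip.compl₁₂ (ub ∘ₗ now) pb +
    (l2Map M.Tb.cells).compl₁₂ (P.lam⁻¹ • (P.α • M.rComp k - M.pComp k) ∘ₗ now) (M.pComp k) +
    (l2Map M.Tb.cells).compl₁₂ (P.c₀ • M.rComp k ∘ₗ rate) (M.rComp k) +
    (l2Map M.Tb.cells).compl₁₂ (P.lam⁻¹ • (P.α • M.rComp k - M.pComp k) ∘ₗ rate)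
      (P.α • M.rComp k) -
    (bjMap hd M.Tb).flip.compl₁₂ (z ∘ₗ now) r -
    (M.bIMap hd).flip.compl₁₂ ubarI (M.rbComp k) +
    (l2VecMap M.Tb.cells).compl₁₂ (P.κ⁻¹ • M.zComp k ∘ₗ now) (M.zComp k) +
    (bjMap hd M.Tb).compl₁₂ (r ∘ₗ now) z

theorem Mesh.stepForm_apply {d : ℕ} (hd : 0 < d) (M : Mesh d) (k : ℕ) (P : Params)
    (βs βb : ℝ) (x ξ y : M.Xh k) :
    M.stepForm hd k P βs βb (x, ξ) y =
      (M.ah P βs βb x.1.1 y.1.1 + M.aI P x.1.1.2.1 ξ.1.1.2.2 y.1.1.2.1 y.1.1.2.2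
        + M.bh x.1.2.1 y.1.1 + M.bI x.1.2.2.2.2 y.1.1.2.1 y.1.1.2.2) +
      (M.bh y.1.2.1 x.1.1 + M.ch P x.1.2.2.2.1 x.1.2.1.1 y.1.2.1.1) +
      (l2 M.Tb.cells (P.c₀ • ξ.1.2.2.2.1) y.1.2.2.2.1
        + M.ch P ξ.1.2.2.2.1 ξ.1.2.1.1 (P.α • y.1.2.2.2.1)
        - bj M.Tb y.1.2.2.2.1 y.1.2.2.2.2 x.1.2.2.1 0
        - M.bI y.1.2.2.2.2 x.1.1.2.1 ξ.1.1.2.2) +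
      (l2Vec M.Tb.cells (P.κ⁻¹ • x.1.2.2.1) y.1.2.2.1
        + bj M.Tb x.1.2.2.2.1 x.1.2.2.2.2 y.1.2.2.1 0) := by
  have : M.stepForm hd k P βs βb (x, ξ) y =
      aj M.Ts P.μs βs x.1.1.1 x.1.1.2.1 y.1.1.1 y.1.1.2.1 +
      aj M.Tb P.μb βb x.1.1.1 x.1.1.2.2 y.1.1.1 y.1.1.2.2 +
      M.aI P x.1.1.2.1 ξ.1.1.2.2 y.1.1.2.1 y.1.1.2.2 +
      bj M.Ts x.1.2.1.1 x.1.2.1.2.1 y.1.1.1 y.1.1.2.1 +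
      bj M.Tb x.1.2.1.1 x.1.2.1.2.2 y.1.1.1 y.1.1.2.2 +
      M.bI x.1.2.2.2.2 y.1.1.2.1 y.1.1.2.2 +
      bj M.Ts y.1.2.1.1 y.1.2.1.2.1 x.1.1.1 x.1.1.2.1 +
      bj M.Tb y.1.2.1.1 y.1.2.1.2.2 x.1.1.1 x.1.1.2.2 +
      M.ch P x.1.2.2.2.1 x.1.2.1.1 y.1.2.1.1 +
      l2 M.Tb.cells (P.c₀ • ξ.1.2.2.2.1) y.1.2.2.2.1 +
      M.ch P ξ.1.2.2.2.1 ξ.1.2.1.1 (P.α • y.1.2.2.2.1) -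
      bj M.Tb y.1.2.2.2.1 y.1.2.2.2.2 x.1.2.2.1 0 -
      M.bI y.1.2.2.2.2 x.1.1.2.1 ξ.1.1.2.2 +
      l2Vec M.Tb.cells (P.κ⁻¹ • x.1.2.2.1) y.1.2.2.1 +
      bj M.Tb x.1.2.2.2.1 x.1.2.2.2.2 y.1.2.2.1 0 := rfl
  rw [this, Mesh.ah, Mesh.bh, Mesh.bh]
  ring

/-- The four test components are independent, so the system is equivalent to its sum tested on all
of `M.Xh k`; each equation is recovered by setting the other three components to zero. -/
theorem Mesh.isStep_iff {d : ℕ} (hd : 0 < d) (M : Mesh d) (k : ℕ) (P : Params) (βs βb Δt : ℝ)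
    (f : E d → E d) (g : E d → ℝ) (x₀ x : M.Xh k) :
    M.IsStep k P βs βb Δt f g x₀ x ↔
      ∀ y : M.Xh k, M.stepForm hd k P βs βb (x, Δt⁻¹ • (x - x₀)) y = M.load f g y := by
  have hc0 : ∀ K : Finset (E d), cellInt K (fun _ => (0 : ℝ)) = 0 := fun K => integral_zero _ _
  simp only [Mesh.stepForm_apply, Mesh.load]
  constructor
  · rintro ⟨E1, E2, E3, E4⟩ y
    rw [← E1 y.1.1 y.2.1, ← E3 y.1.2.2.2 y.2.2.2.2]
    have e2 := E2 y.1.2.1 y.2.2.1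
    have e4 := E4 y.1.2.2.1 y.2.2.2.1
    have key : ∀ a b c d : ℝ, b = 0 → d = 0 → a + b + c + d = a + c := fun a b c d hb hd => by
      rw [hb, hd]; ring
    exact key _ _ _ _ e2 e4
  · intro H
    refine ⟨fun v hv => ?_, fun q hq => ?_, fun r hr => ?_, fun w hw => ?_⟩
    · have := H ⟨(v, 0), hv, Submodule.zero_mem _⟩
      simpa [Mesh.bh, Mesh.ch, hc0, dt] using this
    · have := H ⟨(0, q, 0), Submodule.zero_mem _, hq, Submodule.zero_mem _⟩
      simpa [Mesh.ah, Mesh.bh, Mesh.ch, hc0, dt] using this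
    · have := H ⟨(0, 0, 0, r), Submodule.zero_mem _, Submodule.zero_mem _, Submodule.zero_mem _, hr⟩
      simpa [Mesh.ah, Mesh.bh, Mesh.ch, hc0, dt] using this
    · have := H ⟨(0, 0, w, 0), Submodule.zero_mem _, Submodule.zero_mem _, hw, Submodule.zero_mem _⟩
      simpa [Mesh.ah, Mesh.bh, Mesh.ch, hc0, dt] using this

/-- Unique solvability of a linear step on a finite-dimensional space, from uniqueness for the
homogeneous step. -/
theorem existsUnique_of_homogeneous {X : Type*} [AddCommGroup X] [Module ℝ X] [Module.Finite ℝ X]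
    (Φ : (X × X) →ₗ[ℝ] X →ₗ[ℝ] ℝ) (s : ℝ) (h : ∀ x, (∀ y, Φ (x, s • x) y = 0) → x = 0)
    (ℓ : Module.Dual ℝ X) (x₀ : X) : ∃! x, ∀ y, Φ (x, s • (x - x₀)) y = ℓ y := by
  -- This is the operator of the homogeneous step. A space and its dual have the same finite
  -- dimension, so injectivity implies surjectivity; the previous values only shift the right-hand
  -- side.
  let A : X →ₗ[ℝ] Module.Dual ℝ X := Φ ∘ₗ LinearMap.prod LinearMap.id (s • LinearMap.id)
  have hA : ∀ x y, A x y = Φ (x, s • x) y := fun _ _ => rfl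
  have hinj : Function.Injective A := by
    rw [← LinearMap.ker_eq_bot, LinearMap.ker_eq_bot']
    exact fun x hx => h x fun y => by rw [← hA, hx]; rfl
  have hsurj : Function.Surjective A :=
    (LinearMap.injective_iff_surjective_of_finrank_eq_finrank
      Subspace.dual_finrank_eq.symm).1 hinj
  have hiff : ∀ x, (∀ y, Φ (x, s • (x - x₀)) y = ℓ y) ↔ A x = ℓ + Φ (0, s • x₀) := fun x => by
    have hsplit : (x, s • (x - x₀)) = (x, s • x) - (0, s • x₀) := by
      rw [Prod.mk_sub_mk, sub_zero, smul_sub]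
    rw [LinearMap.ext_iff, hsplit, map_sub]
    refine forall_congr' fun y => ?_
    rw [LinearMap.sub_apply, LinearMap.add_apply, hA, sub_eq_iff_eq_add]
  obtain ⟨x, hx⟩ := hsurj (ℓ + Φ (0, s • x₀))
  exact ⟨x, (hiff x).2 hx, fun y hy => hinj (((hiff y).1 hy).trans hx.symm)⟩

theorem Mesh.existsUnique_isStep {d : ℕ} (hd : 0 < d) {k : ℕ} (hk : 1 ≤ k) (M : Mesh d)
    (P : Params) {βs βb Δt : ℝ} (hcs : Coercive M.Ts k P.μs βs) (hcb : Coercive M.Tb k P.μb βb)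
    (hΔt : 0 < Δt) {f : E d → E d} {g : E d → ℝ}
    (hf : MemLp f 2 (volume.restrict (unionDomain M.Ts M.Tb)))
    (hg : MemLp g 2 (volume.restrict M.Tb.domain)) (x₀ : M.Xh k) :
    ∃! x : M.Xh k, M.IsStep k P βs βb Δt f g x₀ x := by
  obtain ⟨ℓ, hℓ⟩ := M.exists_load_eq k hf hg
  simp only [M.isStep_iff hd, ← hℓ]
  refine existsUnique_of_homogeneous _ _ (fun x hx => ?_) ℓ x₀
  refine Subtype.ext (M.eq_zero_of_isStep hd hk P hcs hcb hΔt x.2 ?_)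
  refine (M.isStep_iff hd k P βs βb Δt 0 0 0 x).2 fun y => ?_
  have hc0 : ∀ K : Finset (E d), cellInt K (fun _ => (0 : ℝ)) = 0 := fun K => integral_zero _ _
  rw [sub_zero, hx y]
  simp [Mesh.load, hc0]

/-! ### Sequences -/

/-- The sequence is extended by one value at a time: a solution of length N + 1 restricts to the
unique shorter one, whose last value determines the new one. -/
theorem existsUnique_seq {X : Type*} (N : ℕ) (R : ℕ → X → X → Prop)
    (h : ∀ n < N, ∀ x₀, ∃! x, R n x₀ x) (x₀ : X) :
    ∃! x : Fin (N + 1) → X, x 0 = x₀ ∧ ∀ n : Fin N, R n (x n.castSucc) (x n.succ) := by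
  induction N with
  | zero =>
    exact ⟨fun _ => x₀, ⟨rfl, fun n => n.elim0⟩, fun y hy => funext fun i => by
      rw [Fin.fin_one_eq_zero i]; exact hy.1⟩
  | succ N ih =>
    obtain ⟨x, ⟨hx0, hx⟩, huniq⟩ := ih fun n hn => h n (hn.trans N.lt_succ_self)
    obtain ⟨y, hy, hyu⟩ := h N N.lt_succ_self (x (Fin.last N))
    refine ⟨Fin.snoc (α := fun _ => X) x y, ⟨?_, fun n => ?_⟩, fun w ⟨hw0, hw⟩ => ?_⟩
    · rw [← Fin.castSucc_zero, Fin.snoc_castSucc, hx0]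
    · induction n using Fin.lastCases with
      | last =>
        rw [Fin.snoc_castSucc, Fin.succ_last, Fin.snoc_last]
        exact hy
      | cast n =>
        rw [Fin.snoc_castSucc, Fin.succ_castSucc, Fin.snoc_castSucc]
        exact hx n
    · have h1 : Fin.init w = x := huniq _ ⟨hw0, fun n => by
        have := hw n.castSucc
        rwa [Fin.succ_castSucc] at this⟩
      have h2 : w (Fin.last (N + 1)) = y := hyu _ (by
        have := hw (Fin.last N)
        rwa [Fin.succ_last, ← h1] at *)
      rw [← h1, ← h2]
      exact (Fin.snoc_init_self w).symm

end StokesBiot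

theorem mainTheorem4 (d : ℕ) (hd : d = 2 ∨ d = 3) (k : ℕ) (hk : 1 ≤ k) (σ : ℝ) :
    ∃ β₀ : ℝ, 0 < β₀ ∧
      ∀ (M : StokesBiot.Mesh d), M.Ts.ShapeRegular σ → M.Tb.ShapeRegular σ →
      ∀ (P : StokesBiot.Params) (βs βb : ℝ), β₀ ≤ βs → β₀ ≤ βb →
      ∀ (Δt : ℝ), 0 < Δt → ∀ (N : ℕ)
        (f : ℝ → StokesBiot.E d → StokesBiot.E d) (g : ℝ → StokesBiot.E d → ℝ),
      (∀ n < N, MeasureTheory.MemLp (f ((n + 1 : ℕ) * Δt)) 2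
        (MeasureTheory.volume.restrict (StokesBiot.unionDomain M.Ts M.Tb))) →
      (∀ n < N, MeasureTheory.MemLp (g ((n + 1 : ℕ) * Δt)) 2
        (MeasureTheory.volume.restrict M.Tb.domain)) →
      (∀ n < N, ∀ x₀ : M.Xh k, ∃! x : M.Xh k,
        M.IsStep k P βs βb Δt (f ((n + 1 : ℕ) * Δt)) (g ((n + 1 : ℕ) * Δt)) x₀ x) ∧
      (∀ x₀ : M.Xh k, ∃! x : Fin (N + 1) → M.Xh k, x 0 = x₀ ∧
        ∀ n : Fin N, M.IsStep k P βs βb Δt (f (((n : ℕ) + 1 : ℕ) * Δt))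
          (g (((n : ℕ) + 1 : ℕ) * Δt)) (x n.castSucc) (x n.succ)) := by
  have hd0 : 0 < d := by omega
  -- The threshold is fixed before mesh and parameters are chosen, and the same value serves both
  -- subdomains, since coercivity is uniform over triangulations with constant σ.
  obtain ⟨β₀, hβ₀, hco⟩ := StokesBiot.exists_coercive hd0 k σ
  refine ⟨β₀, hβ₀, fun M hTs hTb P βs βb hβs hβb Δt hΔt N f g hf hg => ?_⟩
  have hstep : ∀ n < N, ∀ x₀ : M.Xh k, ∃! x : M.Xh k,
      M.IsStep k P βs βb Δt (f ((n + 1 : ℕ) * Δt)) (g ((n + 1 : ℕ) * Δt)) x₀ x := fun n hn x₀ =>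
    M.existsUnique_isStep hd0 hk P (hco M.Ts hTs P.μs βs P.μs_pos hβs)
      (hco M.Tb hTb P.μb βb P.μb_pos hβb) hΔt (hf n hn) (hg n hn) x₀
  exact ⟨hstep, StokesBiot.existsUnique_seq N
    (fun n (x₀ x : M.Xh k) => M.IsStep k P βs βb Δt (f ((n + 1 : ℕ) * Δt)) (g ((n + 1 : ℕ) * Δt)) x₀ x) hstep⟩
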